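/- **Conventions.** Composition is written diagrammatically, $f;g$. A *symmetric linearly distributive category* (SLDC) is a category with two symmetric monoidal structures $(\otimes,\top)$ and $(\oplus,\bot)$ and natural linear distributivities $\delta^L_{A,B,C}\colon A\otimes(B\oplus C)\to(A\otimes B)\oplus C$ and $\delta^R_{A,B,C}\colon (A\oplus B)\otimes C\to A\oplus(B\otimes C)$ satisfying the Cockett–Seely coherence conditions (with units, associators, each other and the symmetries). A *cartesian* LDC (CLDC) is an SLDC in which $(\otimes,\top)$ is given by finite products and $(\oplus,\bot)$ by finite coproducts. Associators are denoted $\alpha^\otimes_{A,B,C}\colon (A\otimes B)\otimes C\to A\otimes(B\otimes C)$ and $\alpha^\oplus_{A,B,C}\colon A\oplus(B\oplus C)\to (A\oplus B)\oplus C$; $\tau^\otimes,\tau^\oplus$ are the canonical flips $(A\otimes B)\otimes(C\otimes D)\to(A\otimes C)\otimes(B\otimes D)$, and likewise for $\oplus$. A *(strong symmetric) linear functor* $F=(F_\otimes,F_\oplus)\colon\mathbb X\to\mathbb Y$ of SLDCs consists of a strong symmetric $\otimes$-monoidal functor $(F_\otimes,m_\top,m_\otimes)$, a strong symmetric $\oplus$-comonoidal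 functor $(F_\oplus,n_\bot,n_\oplus)$, and natural linear strengths $$v^R_\otimes\colon F_\otimes(A\oplus B)\to F_\oplus A\oplus F_\otimes B,\quad v^L_\otimes\colon F_\otimes(A\oplus B)\to F_\otimes A\oplus F_\oplus B,$$ $$v^R_\oplus\colon F_\otimes A\otimes F_\oplus B\to F_\oplus(A\otimes B),\quad v^L_\oplus\colon F_\oplus A\otimes F_\otimes B\to F_\oplus(A\otimes B)$$ satisfying the Cockett–Seely coherence conditions (with units, associators, linear distributivities, each other and symmetries). A *linear transformation* $\alpha\colon F\Rightarrow G$ is a pair of a $\otimes$-monoidal transformation $\alpha_\otimes\colon F_\otimes\Rightarrow G_\otimes$ and a $\oplus$-comonoidal transformation $\alpha_\oplus\colon G_\oplus\Rightarrow F_\oplus$ compatible with the four linear strengths. $\mathbf{CLDC}$ is the 2-category of CLDCs, strong symmetric linear functors (called cartesian linear functors) and linear transformations. **Symmetric medial LDCs.** A *symmetric medial LDC* (SMLDC) is an SLDC with maps $\Delta_\bot\colon\bot\to\bot\otimes\bot$, $\nabla_\top\colon\top\oplus\top\to\top$, $m\colon\bot\to\top$ and natural medial maps $\mu_{A,B,C,D}\colon(A\otimes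 B)\oplus(C\otimes D)\to(A\oplus C)\otimes(B\oplus D)$ such that: 1. $(\bot,\Delta_\bot,m)$ is a cocommutative $\otimes$-comonoid, $(\top,\nabla_\top,m)$ is a commutative $\oplus$-monoid, and the two maps $A\otimes B\to A\oplus B$ built from $m$ and $\delta^L$, respectively $m$ and $\delta^R$, agree; 2. $\mu$ is compatible with both associators, with the unitors of $\oplus$ (via $\Delta_\bot$) and of $\otimes$ (via $\nabla_\top$), so that $(\mathbb X,\oplus,\bot,\otimes,\top)$ is a duoidal category, and $\mu$ is compatible with both symmetries; 3. $\mu$ is compatible with the linear distributivities: $(\mu_{A,B,C,D}\otimes 1_E);\alpha^\otimes;(1\otimes\delta^R)=\delta^R;(1\oplus\alpha^\otimes);\mu_{A,B,C,D\otimes E}$, $(1_E\otimes\mu_{A,B,C,D});(\alpha^\otimes)^{-1};(\delta^L\otimes 1)=\delta^L;((\alpha^\otimes)^{-1}\oplus1);\mu_{E\otimes A,B,C,D}$, $(\delta^R_{E,A,B}\oplus1);(\alpha^\oplus)^{-1};(1\oplus\mu_{A,B,C,D})=\mu_{E\oplus A,B,C,D};((\alpha^\oplus)^{-1}\otimes1);\delta^R$,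 $(1\oplus\delta^L_{C,D,E});\alpha^\oplus;(\mu_{A,B,C,D}\oplus1)=\mu_{A,B,C,D\oplus E};(1\otimes\alpha^\oplus);\delta^L$. A *medial linear functor* $F\colon\mathbb X\to\mathbb Y$ of SMLDCs is a strong symmetric linear functor together with a symmetric lax $\oplus$-monoidal structure $(m_\bot,m_\oplus)$ on $F_\otimes$ and a symmetric $\otimes$-comonoidal structure $(n_\top,n_\otimes)$ on $F_\oplus$ such that $(F_\otimes,m_\bot,m_\oplus,m_\top^{-1},m_\otimes^{-1})$ and $(F_\oplus,n_\bot^{-1},n_\oplus^{-1},n_\top,n_\otimes)$ are bilax duoidal functors (compatible with $\Delta_\bot,\nabla_\top,m,\mu$) and $F_\oplus(\Delta_\bot)=n_\bot;\Delta_\bot;(m_\bot\otimes n_\bot^{-1});v^R_\oplus$, $F_\otimes(\nabla_\top)=v^R_\otimes;(n_\top\oplus m_\top^{-1});\nabla_\top;m_\top$, $F_\otimes(\mu_{A,B,C,D});m_\otimes^{-1};(v^R_\otimes\otimes v^R_\otimes)=v^R_\otimes;(n_\otimes\oplus m_\otimes^{-1});\mu$, $(v^R_\oplus\oplus v^R_\oplus);n_\oplus^{-1};F_\oplus(\mu_{A,B,C,D})=\mu;(m_\oplus\otimes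 n_\oplus^{-1});v^R_\oplus$, $m_\oplus;F_\otimes((\alpha^\oplus_{A,B,C})^{-1});v^R_\otimes=(v^R_\otimes\oplus1);(\alpha^\oplus)^{-1};(1\oplus m_\oplus)$, $v^R_\oplus;F_\oplus((\alpha^\otimes_{A,B,C})^{-1});n_\otimes=(1\otimes n_\otimes);(\alpha^\otimes)^{-1};(v^R_\oplus\otimes1)$. A *medial linear transformation* is a linear transformation $\alpha$ such that $\alpha_\otimes$ is also monoidal for $(m_\bot,m_\oplus)$ and $\alpha_\oplus$ is also comonoidal for $(n_\top,n_\otimes)$. These form the 2-category $\mathbf{SMLDC}$. **Medial bimonoids.** A *bicommutative medial bimonoid* in an SMLDC $\mathbb X$ is an object $A$ with a cocommutative $\otimes$-comonoid structure $(\Delta_A,e_A)$ and a commutative $\oplus$-monoid structure $(\nabla_A,u_A)$ such that $\nabla_A;\Delta_A=(\Delta_A\oplus\Delta_A);\mu;(\nabla_A\otimes\nabla_A)$, $u_A;e_A=m$, $\nabla_A;e_A=(e_A\oplus e_A);\nabla_\top$ and $u_A;\Delta_A=\Delta_\bot;(u_A\otimes u_A)$. $\mathsf B[\mathbb X]$ is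 the category of these and of the maps that are both comonoid and monoid morphisms. **Proposition.** There is a (strict) 2-functor $\mathsf B[-]\colon\mathbf{SMLDC}\to\mathbf{CLDC}$ given as follows. * On objects: for an SMLDC $\mathbb X$, the category $\mathsf B[\mathbb X]$ is a CLDC whose structure morphisms (tensor and par of morphisms, associators, unitors, symmetries, $\delta^L$, $\delta^R$) are those of $\mathbb X$, with units $\langle\top,\top\cong\top\otimes\top,1,\nabla_\top,m\rangle$ and $\langle\bot,\Delta_\bot,m,\bot\oplus\bot\cong\bot,1\rangle$; tensor $A\otimes B$ with $\Delta=(\Delta_A\otimes\Delta_B);\tau^\otimes$, $e=(e_A\otimes e_B);(\top\otimes\top\cong\top)$, $\nabla=\mu_{A,B,A,B};(\nabla_A\otimes\nabla_B)$, $u=\Delta_\bot;(u_A\otimes u_B)$; and par $A\oplus B$ with $\Delta=(\Delta_A\oplus\Delta_B);\mu_{A,A,B,B}$, $e=(e_A\oplus e_B);\nabla_\top$, $\nabla=\tau^\oplus;(\nabla_A\oplus\nabla_B)$, $u=(\bot\cong\bot\oplus\bot);(u_A\oplus u_B)$. * On 1-cells: a medial linear functor $F\colon\mathbb X\to\mathbb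 Y$ induces a cartesian linear functor $\mathsf B[F]\colon\mathsf B[\mathbb X]\to\mathsf B[\mathbb Y]$ which acts on morphisms as $F_\otimes$, $F_\oplus$, has the structure maps $m_\top,m_\otimes,n_\bot,n_\oplus$ and linear strengths of $F$, and sends a bimonoid $A$ to $F_\otimes A$ with $\Delta=F_\otimes(\Delta_A);m_\otimes^{-1}$, $e=F_\otimes(e_A);m_\top^{-1}$, $\nabla=m_\oplus;F_\otimes(\nabla_A)$, $u=m_\bot;F_\otimes(u_A)$, respectively to $F_\oplus A$ with $\Delta=F_\oplus(\Delta_A);n_\otimes$, $e=F_\oplus(e_A);n_\top$, $\nabla=n_\oplus^{-1};F_\oplus(\nabla_A)$, $u=n_\bot^{-1};F_\oplus(u_A)$. * On 2-cells: a medial linear transformation $\alpha\colon F\Rightarrow G$ induces a linear transformation $\mathsf B[\alpha]\colon\mathsf B[F]\Rightarrow\mathsf B[G]$ with components $(\alpha_\otimes)_A$ and $(\alpha_\oplus)_A$. -/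

import Mathlib

open CategoryTheory

universe v u v₁ u₁ v₂ u₂ v₃ u₃

section SymMon

variable {C : Type u₁} [Category.{v₁} C] {D : Type u₂} [Category.{v₂} D]
  {E : Type u₃} [Category.{v₃} E]

/-- A symmetric monoidal structure on a category, as an explicit value (a linearly distributive
category carries two of them). -/
structure SymMon (C : Type u) [Category.{v} C] where
  [mon : MonoidalCategory C]
  [sym : SymmetricCategory C]

namespace SymMon

variable (M : SymMon C)

def unit : C :=
  letI := M.mon
  MonoidalCategory.tensorUnit C

def obj (A B : C) : C :=
  letI := M.mon
  MonoidalCategory.tensorObj A B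

def hom {A A' B B' : C} (f : A ⟶ A') (g : B ⟶ B') : M.obj A B ⟶ M.obj A' B' :=
  letI := M.mon
  MonoidalCategory.tensorHom f g

def assoc (A B X : C) : M.obj (M.obj A B) X ≅ M.obj A (M.obj B X) :=
  letI := M.mon
  MonoidalCategory.associator A B X

def left (A : C) : M.obj M.unit A ≅ A :=
  letI := M.mon
  MonoidalCategory.leftUnitor A

def right (A : C) : M.obj A M.unit ≅ A :=
  letI := M.mon
  MonoidalCategory.rightUnitor A

def braid (A B : C) : M.obj A B ≅ M.obj B A :=
  letI := M.mon
  letI := M.sym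
  BraidedCategory.braiding A B

/-- The canonical flip `(A ⊗ B) ⊗ (X ⊗ Y) ⟶ (A ⊗ X) ⊗ (B ⊗ Y)`. -/
def flip (A B X Y : C) : M.obj (M.obj A B) (M.obj X Y) ⟶ M.obj (M.obj A X) (M.obj B Y) :=
  letI := M.mon
  letI := M.sym
  MonoidalCategory.tensorμ A B X Y

theorem hom_id (A B : C) : M.hom (𝟙 A) (𝟙 B) = 𝟙 (M.obj A B) :=
  @MonoidalCategory.id_tensorHom_id C _ M.mon A B

theorem hom_comp {A A' A'' B B' B'' : C} (f : A ⟶ A') (f' : A' ⟶ A'') (g : B ⟶ B')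
    (g' : B' ⟶ B'') : M.hom (f ≫ f') (g ≫ g') = M.hom f g ≫ M.hom f' g' :=
  (@MonoidalCategory.tensorHom_comp_tensorHom C _ M.mon _ _ _ _ _ _ f g f' g').symm

theorem hom_comp_id {A A' A'' : C} (f : A ⟶ A') (f' : A' ⟶ A'') (B : C) :
    M.hom (f ≫ f') (𝟙 B) = M.hom f (𝟙 B) ≫ M.hom f' (𝟙 B) := by
  rw [← hom_comp, Category.comp_id]

theorem id_hom_comp (A : C) {B B' B'' : C} (g : B ⟶ B') (g' : B' ⟶ B'') :
    M.hom (𝟙 A) (g ≫ g') = M.hom (𝟙 A) g ≫ M.hom (𝟙 A) g' := by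
  rw [← hom_comp, Category.comp_id]

/-- `⟨A, Δ, e⟩` is a cocommutative comonoid. -/
structure IsCocommComonoid {A : C} (Δ : A ⟶ M.obj A A) (e : A ⟶ M.unit) : Prop where
  coassoc : Δ ≫ M.hom (𝟙 A) Δ = Δ ≫ M.hom Δ (𝟙 A) ≫ (M.assoc A A A).hom
  counit_right : Δ ≫ M.hom (𝟙 A) e ≫ (M.right A).hom = 𝟙 A
  counit_left : Δ ≫ M.hom e (𝟙 A) ≫ (M.left A).hom = 𝟙 A
  cocomm : Δ ≫ (M.braid A A).hom = Δ

/-- `⟨A, nab, u⟩` is a commutative monoid. -/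
structure IsCommMonoid {A : C} (nab : M.obj A A ⟶ A) (u : M.unit ⟶ A) : Prop where
  assoc : M.hom (𝟙 A) nab ≫ nab = (M.assoc A A A).inv ≫ M.hom nab (𝟙 A) ≫ nab
  unit_right : (M.right A).inv ≫ M.hom (𝟙 A) u ≫ nab = 𝟙 A
  unit_left : (M.left A).inv ≫ M.hom u (𝟙 A) ≫ nab = 𝟙 A
  comm : (M.braid A A).hom ≫ nab = nab

/-- The monoidal structure is cartesian: the unit is terminal, and the product of `A` and `B` is
their categorical product, with the projections induced by the maps to the unit. -/
structure IsCartesian : Prop where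
  terminal : Nonempty (Limits.IsTerminal M.unit)
  product : ∀ (t : Limits.IsTerminal M.unit) (A B : C),
    Nonempty (Limits.IsLimit (Limits.BinaryFan.mk
      (M.hom (𝟙 A) (t.from B) ≫ (M.right A).hom) (M.hom (t.from A) (𝟙 B) ≫ (M.left B).hom)))

/-- The monoidal structure is cocartesian. -/
structure IsCocartesian : Prop where
  initial : Nonempty (Limits.IsInitial M.unit)
  coproduct : ∀ (t : Limits.IsInitial M.unit) (A B : C),
    Nonempty (Limits.IsColimit (Limits.BinaryCofan.mk
      ((M.right A).inv ≫ M.hom (𝟙 A) (t.to B)) ((M.left B).inv ≫ M.hom (t.to A) (𝟙 B))))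

variable (N : SymMon D) (K : SymMon E)

/-- Symmetric (lax) monoidal structures on a functor. -/
structure Lax (F : C ⥤ D) where
  unitMap : N.unit ⟶ F.obj M.unit
  prodMap (A B : C) : N.obj (F.obj A) (F.obj B) ⟶ F.obj (M.obj A B)
  natural {A A' B B' : C} (f : A ⟶ A') (g : B ⟶ B') :
    N.hom (F.map f) (F.map g) ≫ prodMap A' B' = prodMap A B ≫ F.map (M.hom f g)
  assoc (A B X : C) :
    N.hom (prodMap A B) (𝟙 (F.obj X)) ≫ prodMap (M.obj A B) X ≫ F.map (M.assoc A B X).hom =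
      (N.assoc (F.obj A) (F.obj B) (F.obj X)).hom ≫ N.hom (𝟙 (F.obj A)) (prodMap B X) ≫
        prodMap A (M.obj B X)
  unit_left (A : C) :
    N.hom unitMap (𝟙 (F.obj A)) ≫ prodMap M.unit A ≫ F.map (M.left A).hom =
      (N.left (F.obj A)).hom
  unit_right (A : C) :
    N.hom (𝟙 (F.obj A)) unitMap ≫ prodMap A M.unit ≫ F.map (M.right A).hom =
      (N.right (F.obj A)).hom
  braided (A B : C) :
    prodMap A B ≫ F.map (M.braid A B).hom =
      (N.braid (F.obj A) (F.obj B)).hom ≫ prodMap B A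

/-- Symmetric comonoidal (that is, oplax monoidal) structures on a functor. -/
structure Oplax (F : C ⥤ D) where
  unitMap : F.obj M.unit ⟶ N.unit
  prodMap (A B : C) : F.obj (M.obj A B) ⟶ N.obj (F.obj A) (F.obj B)
  natural {A A' B B' : C} (f : A ⟶ A') (g : B ⟶ B') :
    F.map (M.hom f g) ≫ prodMap A' B' = prodMap A B ≫ N.hom (F.map f) (F.map g)
  assoc (A B X : C) :
    F.map (M.assoc A B X).hom ≫ prodMap A (M.obj B X) ≫ N.hom (𝟙 (F.obj A)) (prodMap B X) =
      prodMap (M.obj A B) X ≫ N.hom (prodMap A B) (𝟙 (F.obj X)) ≫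
        (N.assoc (F.obj A) (F.obj B) (F.obj X)).hom
  unit_left (A : C) :
    F.map (M.left A).inv ≫ prodMap M.unit A ≫ N.hom unitMap (𝟙 (F.obj A)) =
      (N.left (F.obj A)).inv
  unit_right (A : C) :
    F.map (M.right A).inv ≫ prodMap A M.unit ≫ N.hom (𝟙 (F.obj A)) unitMap =
      (N.right (F.obj A)).inv
  braided (A B : C) :
    F.map (M.braid A B).hom ≫ prodMap B A =
      prodMap A B ≫ (N.braid (F.obj A) (F.obj B)).hom

/-- Strong symmetric monoidal structures on a functor. Read through the inverses of the structure
maps, these are also the strong symmetric comonoidal structures. -/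
structure Strong (F : C ⥤ D) extends Lax M N F where
  unitInv : F.obj M.unit ⟶ N.unit
  prodInv (A B : C) : F.obj (M.obj A B) ⟶ N.obj (F.obj A) (F.obj B)
  unitMap_unitInv : unitMap ≫ unitInv = 𝟙 _
  unitInv_unitMap : unitInv ≫ unitMap = 𝟙 _
  prodMap_prodInv (A B : C) : prodMap A B ≫ prodInv A B = 𝟙 _
  prodInv_prodMap (A B : C) : prodInv A B ≫ prodMap A B = 𝟙 _

variable {M N K}

namespace Lax

theorem ext' {F : C ⥤ D} {h k : M.Lax N F} (h₁ : h.unitMap = k.unitMap)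
    (h₂ : ∀ A B, h.prodMap A B = k.prodMap A B) : h = k := by
  cases h
  cases k
  obtain rfl := h₁
  obtain rfl := funext fun A => funext fun B => h₂ A B
  rfl

variable (M) in
def id : M.Lax M (𝟭 C) where
  unitMap := 𝟙 _
  prodMap A B := 𝟙 _
  natural := by simp
  assoc := by simp [hom_id]
  unit_left := by simp [hom_id]
  unit_right := by simp [hom_id]
  braided := by simp

def comp {F : C ⥤ D} {G : D ⥤ E} (h : M.Lax N F) (k : N.Lax K G) : M.Lax K (F ⋙ G) where
  unitMap := k.unitMap ≫ G.map h.unitMap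
  prodMap A B := k.prodMap (F.obj A) (F.obj B) ≫ G.map (h.prodMap A B)
  natural f g := by
    simp only [Functor.comp_map, Category.assoc, ← G.map_comp, ← h.natural]
    rw [G.map_comp, reassoc_of% (k.natural (F.map f) (F.map g))]
  assoc A B X := by
    have e₁ := k.natural (h.prodMap A B) (𝟙 (F.obj X))
    have e₂ := k.natural (𝟙 (F.obj A)) (h.prodMap B X)
    simp only [G.map_id] at e₁ e₂
    simp only [Functor.comp_obj, Functor.comp_map, hom_comp_id, id_hom_comp, Category.assoc]
    rw [reassoc_of% e₁, reassoc_of% e₂, ← reassoc_of% (k.assoc (F.obj A) (F.obj B) (F.obj X))]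
    simp only [← G.map_comp]
    rw [h.assoc]
  unit_left A := by
    have e₁ := k.natural h.unitMap (𝟙 (F.obj A))
    simp only [G.map_id] at e₁
    simp only [Functor.comp_obj, Functor.comp_map, hom_comp_id, Category.assoc]
    rw [reassoc_of% e₁, ← k.unit_left, ← h.unit_left]
    simp only [G.map_comp]
  unit_right A := by
    have e₁ := k.natural (𝟙 (F.obj A)) h.unitMap
    simp only [G.map_id] at e₁
    simp only [Functor.comp_obj, Functor.comp_map, id_hom_comp, Category.assoc]
    rw [reassoc_of% e₁, ← k.unit_right, ← h.unit_right]
    simp only [G.map_comp]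
  braided A B := by
    simp only [Functor.comp_obj, Functor.comp_map, Category.assoc]
    rw [← G.map_comp, h.braided, G.map_comp, reassoc_of% (k.braided (F.obj A) (F.obj B))]

end Lax

namespace Oplax

theorem ext' {F : C ⥤ D} {h k : M.Oplax N F} (h₁ : h.unitMap = k.unitMap)
    (h₂ : ∀ A B, h.prodMap A B = k.prodMap A B) : h = k := by
  cases h
  cases k
  obtain rfl := h₁
  obtain rfl := funext fun A => funext fun B => h₂ A B
  rfl

variable (M) in
def id : M.Oplax M (𝟭 C) where
  unitMap := 𝟙 _
  prodMap A B := 𝟙 _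
  natural := by simp
  assoc := by simp [hom_id]
  unit_left := by simp [hom_id]
  unit_right := by simp [hom_id]
  braided := by simp

def comp {F : C ⥤ D} {G : D ⥤ E} (h : M.Oplax N F) (k : N.Oplax K G) : M.Oplax K (F ⋙ G) where
  unitMap := G.map h.unitMap ≫ k.unitMap
  prodMap A B := G.map (h.prodMap A B) ≫ k.prodMap (F.obj A) (F.obj B)
  natural f g := by
    simp only [Functor.comp_map, Category.assoc, ← k.natural]
    simp only [← G.map_comp_assoc, h.natural]
  assoc A B X := by
    have e₁ := k.natural (h.prodMap A B) (𝟙 (F.obj X))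
    have e₂ := k.natural (𝟙 (F.obj A)) (h.prodMap B X)
    simp only [G.map_id] at e₁ e₂
    simp only [Functor.comp_obj, Functor.comp_map, hom_comp_id, id_hom_comp, Category.assoc]
    rw [← reassoc_of% e₁, ← reassoc_of% e₂, ← k.assoc (F.obj A) (F.obj B) (F.obj X)]
    simp only [← G.map_comp_assoc, Category.assoc]
    rw [h.assoc]
  unit_left A := by
    have e₁ := k.natural h.unitMap (𝟙 (F.obj A))
    simp only [G.map_id] at e₁
    simp only [Functor.comp_obj, Functor.comp_map, hom_comp_id, Category.assoc]
    rw [← reassoc_of% e₁, ← k.unit_left, ← h.unit_left]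
    simp only [G.map_comp, Category.assoc]
  unit_right A := by
    have e₁ := k.natural (𝟙 (F.obj A)) h.unitMap
    simp only [G.map_id] at e₁
    simp only [Functor.comp_obj, Functor.comp_map, id_hom_comp, Category.assoc]
    rw [← reassoc_of% e₁, ← k.unit_right, ← h.unit_right]
    simp only [G.map_comp, Category.assoc]
  braided A B := by
    simp only [Functor.comp_obj, Functor.comp_map, Category.assoc]
    rw [← G.map_comp_assoc, h.braided, G.map_comp_assoc, k.braided (F.obj A) (F.obj B)]

end Oplax

namespace Strong

def unitIso {F : C ⥤ D} (h : M.Strong N F) : N.unit ≅ F.obj M.unit where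
  hom := h.unitMap
  inv := h.unitInv
  hom_inv_id := h.unitMap_unitInv
  inv_hom_id := h.unitInv_unitMap

def prodIso {F : C ⥤ D} (h : M.Strong N F) (A B : C) :
    N.obj (F.obj A) (F.obj B) ≅ F.obj (M.obj A B) where
  hom := h.prodMap A B
  inv := h.prodInv A B
  hom_inv_id := h.prodMap_prodInv A B
  inv_hom_id := h.prodInv_prodMap A B

theorem ext' {F : C ⥤ D} {h k : M.Strong N F} (h₁ : h.unitMap = k.unitMap)
    (h₂ : ∀ A B, h.prodMap A B = k.prodMap A B) : h = k := by
  have h₃ : h.unitIso = k.unitIso := Iso.ext h₁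
  have h₄ : ∀ A B, h.prodIso A B = k.prodIso A B := fun A B => Iso.ext (h₂ A B)
  have h₅ : h.unitInv = k.unitInv := congrArg Iso.inv h₃
  have h₆ : h.prodInv = k.prodInv := funext fun A => funext fun B => congrArg Iso.inv (h₄ A B)
  have h₇ : h.toLax = k.toLax := Lax.ext' h₁ h₂
  cases h
  cases k
  obtain rfl := h₅
  obtain rfl := h₆
  obtain rfl := h₇
  rfl

variable (M) in
def id : M.Strong M (𝟭 C) where
  toLax := Lax.id M
  unitInv := 𝟙 _
  prodInv A B := 𝟙 _
  unitMap_unitInv := Category.id_comp _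
  unitInv_unitMap := Category.id_comp _
  prodMap_prodInv _ _ := Category.id_comp _
  prodInv_prodMap _ _ := Category.id_comp _

def comp {F : C ⥤ D} {G : D ⥤ E} (h : M.Strong N F) (k : N.Strong K G) : M.Strong K (F ⋙ G) where
  toLax := h.toLax.comp k.toLax
  unitInv := G.map h.unitInv ≫ k.unitInv
  prodInv A B := G.map (h.prodInv A B) ≫ k.prodInv (F.obj A) (F.obj B)
  unitMap_unitInv := (k.unitIso ≪≫ G.mapIso h.unitIso).hom_inv_id
  unitInv_unitMap := (k.unitIso ≪≫ G.mapIso h.unitIso).inv_hom_id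
  prodMap_prodInv A B := (k.prodIso _ _ ≪≫ G.mapIso (h.prodIso A B)).hom_inv_id
  prodInv_prodMap A B := (k.prodIso _ _ ≪≫ G.mapIso (h.prodIso A B)).inv_hom_id

end Strong

end SymMon

end SymMon

/-- Two symmetric monoidal structures on one category: the tensor `T` and the par `P`. -/
class TensorPar (C : Type u) [Category.{v} C] where
  T : SymMon C
  P : SymMon C

infixr:70 " ⨂ " => SymMon.obj TensorPar.T
infixr:70 " ⅋ " => SymMon.obj TensorPar.P
infixr:70 " ⨂ₘ " => SymMon.hom TensorPar.T
infixr:70 " ⅋ₘ " => SymMon.hom TensorPar.P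
notation "⊤[" C "]" => SymMon.unit (TensorPar.T : SymMon C)
notation "⊥[" C "]" => SymMon.unit (TensorPar.P : SymMon C)

namespace TensorPar

variable {C : Type u} [Category.{v} C] [TensorPar C]

def αT (A B X : C) : (A ⨂ B) ⨂ X ≅ A ⨂ (B ⨂ X) := T.assoc A B X

def lT (A : C) : A ≅ ⊤[C] ⨂ A := (T.left A).symm

def rT (A : C) : A ≅ A ⨂ ⊤[C] := (T.right A).symm

def σT (A B : C) : A ⨂ B ≅ B ⨂ A := T.braid A B

def αP (A B X : C) : A ⅋ (B ⅋ X) ≅ (A ⅋ B) ⅋ X := (P.assoc A B X).symm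

def lP (A : C) : ⊥[C] ⅋ A ≅ A := P.left A

def rP (A : C) : A ⅋ ⊥[C] ≅ A := P.right A

def σP (A B : C) : A ⅋ B ≅ B ⅋ A := P.braid A B

end TensorPar

open TensorPar

/-- A symmetric linearly distributive category. -/
class SLDC (C : Type u) [Category.{v} C] extends TensorPar C where
  δL (A B X : C) : A ⨂ (B ⅋ X) ⟶ (A ⨂ B) ⅋ X
  δR (A B X : C) : (A ⅋ B) ⨂ X ⟶ A ⅋ (B ⨂ X)
  δL_natural {A A' B B' X X' : C} (f : A ⟶ A') (g : B ⟶ B') (h : X ⟶ X') :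
    (f ⨂ₘ (g ⅋ₘ h)) ≫ δL A' B' X' = δL A B X ≫ ((f ⨂ₘ g) ⅋ₘ h)
  δR_natural {A A' B B' X X' : C} (f : A ⟶ A') (g : B ⟶ B') (h : X ⟶ X') :
    ((f ⅋ₘ g) ⨂ₘ h) ≫ δR A' B' X' = δR A B X ≫ (f ⅋ₘ (g ⨂ₘ h))
  -- units and linear distributivities
  lT_δL (A B : C) : (lT (A ⅋ B)).hom ≫ δL ⊤[C] A B = (lT A).hom ⅋ₘ 𝟙 B
  rT_δR (A B : C) : (rT (A ⅋ B)).hom ≫ δR A B ⊤[C] = 𝟙 A ⅋ₘ (rT B).hom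
  δR_lP (A B : C) : δR ⊥[C] A B ≫ (lP (A ⨂ B)).hom = (lP A).hom ⨂ₘ 𝟙 B
  δL_rP (A B : C) : δL A B ⊥[C] ≫ (rP (A ⨂ B)).hom = 𝟙 A ⨂ₘ (rP B).hom
  -- associativities and linear distributivities
  δL_αT (A B X Y : C) :
    δL (A ⨂ B) X Y ≫ ((αT A B X).hom ⅋ₘ 𝟙 Y) =
      (αT A B (X ⅋ Y)).hom ≫ (𝟙 A ⨂ₘ δL B X Y) ≫ δL A (B ⨂ X) Y
  αT_δR (A B X Y : C) :
    (αT (A ⅋ B) X Y).hom ≫ δR A B (X ⨂ Y) =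
      (δR A B X ⨂ₘ 𝟙 Y) ≫ δR A (B ⨂ X) Y ≫ (𝟙 A ⅋ₘ (αT B X Y).hom)
  δL_αP (A B X Y : C) :
    δL A B (X ⅋ Y) ≫ (αP (A ⨂ B) X Y).hom =
      (𝟙 A ⨂ₘ (αP B X Y).hom) ≫ δL A (B ⅋ X) Y ≫ (δL A B X ⅋ₘ 𝟙 Y)
  αP_δR (A B X Y : C) :
    ((αP A B X).hom ⨂ₘ 𝟙 Y) ≫ δR (A ⅋ B) X Y =
      δR A (B ⅋ X) Y ≫ (𝟙 A ⅋ₘ δR B X Y) ≫ (αP A B (X ⨂ Y)).hom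
  -- left and right linear distributivities
  δL_δR (A B X Y : C) :
    δL (A ⅋ B) X Y ≫ (δR A B X ⅋ₘ 𝟙 Y) =
      δR A B (X ⅋ Y) ≫ (𝟙 A ⅋ₘ δL B X Y) ≫ (αP A (B ⨂ X) Y).hom
  δR_δL (A B X Y : C) :
    (δL A B X ⨂ₘ 𝟙 Y) ≫ δR (A ⨂ B) X Y =
      (αT A (B ⅋ X) Y).hom ≫ (𝟙 A ⨂ₘ δR B X Y) ≫ δL A B (X ⨂ Y)
  -- braidings and linear distributivities
  δR_σ (A B X : C) :
    δR A B X = (σT (A ⅋ B) X).hom ≫ (𝟙 X ⨂ₘ (σP A B).hom) ≫ δL X B A ≫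
      ((σT X B).hom ⅋ₘ 𝟙 A) ≫ (σP (B ⨂ X) A).hom

open SLDC

/-- A cartesian linearly distributive category. -/
class CLDC (C : Type u) [Category.{v} C] extends SLDC C where
  cartesian : (T : SymMon C).IsCartesian
  cocartesian : (P : SymMon C).IsCocartesian

/-- A symmetric medial linearly distributive category. -/
class SMLDC (C : Type u) [Category.{v} C] extends SLDC C where
  /-- `⊥`-contraction. -/
  Δbot : ⊥[C] ⟶ ⊥[C] ⨂ ⊥[C]
  /-- `⊤`-cocontraction. -/
  nabTop : ⊤[C] ⅋ ⊤[C] ⟶ ⊤[C]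
  /-- Nullary mix. -/
  mix : ⊥[C] ⟶ ⊤[C]
  /-- The medial maps. -/
  med (A B X Y : C) : (A ⨂ B) ⅋ (X ⨂ Y) ⟶ (A ⅋ X) ⨂ (B ⅋ Y)
  med_natural {A A' B B' X X' Y Y' : C} (f : A ⟶ A') (g : B ⟶ B') (h : X ⟶ X') (k : Y ⟶ Y') :
    ((f ⨂ₘ g) ⅋ₘ (h ⨂ₘ k)) ≫ med A' B' X' Y' = med A B X Y ≫ ((f ⅋ₘ h) ⨂ₘ (g ⅋ₘ k))
  -- the mix law
  mix_law (A B : C) :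
    (𝟙 A ⨂ₘ (lP B).inv) ≫ (𝟙 A ⨂ₘ (mix ⅋ₘ 𝟙 B)) ≫ δL A ⊤[C] B ≫ ((rT A).inv ⅋ₘ 𝟙 B) =
      ((rP A).inv ⨂ₘ 𝟙 B) ≫ ((𝟙 A ⅋ₘ mix) ⨂ₘ 𝟙 B) ≫ δR A ⊤[C] B ≫ (𝟙 A ⅋ₘ (lT B).inv)
  -- medial maps and linear distributivities
  med_δR (A B X Y Z : C) :
    (med A B X Y ⨂ₘ 𝟙 Z) ≫ (αT (A ⅋ X) (B ⅋ Y) Z).hom ≫ (𝟙 (A ⅋ X) ⨂ₘ δR B Y Z) =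
      δR (A ⨂ B) (X ⨂ Y) Z ≫ (𝟙 (A ⨂ B) ⅋ₘ (αT X Y Z).hom) ≫ med A B X (Y ⨂ Z)
  med_δL (A B X Y Z : C) :
    (𝟙 Z ⨂ₘ med A B X Y) ≫ (αT Z (A ⅋ X) (B ⅋ Y)).inv ≫ (δL Z A X ⨂ₘ 𝟙 (B ⅋ Y)) =
      δL Z (A ⨂ B) (X ⨂ Y) ≫ ((αT Z A B).inv ⅋ₘ 𝟙 (X ⨂ Y)) ≫ med (Z ⨂ A) B X Y
  δR_med (A B X Y Z : C) :
    (δR Z A B ⅋ₘ 𝟙 (X ⨂ Y)) ≫ (αP Z (A ⨂ B) (X ⨂ Y)).inv ≫ (𝟙 Z ⅋ₘ med A B X Y) =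
      med (Z ⅋ A) B X Y ≫ ((αP Z A X).inv ⨂ₘ 𝟙 (B ⅋ Y)) ≫ δR Z (A ⅋ X) (B ⅋ Y)
  δL_med (A B X Y Z : C) :
    (𝟙 (A ⨂ B) ⅋ₘ δL X Y Z) ≫ (αP (A ⨂ B) (X ⨂ Y) Z).hom ≫ (med A B X Y ⅋ₘ 𝟙 Z) =
      med A B X (Y ⅋ Z) ≫ (𝟙 (A ⅋ X) ⨂ₘ (αP B Y Z).hom) ≫ δL (A ⅋ X) (B ⅋ Y) Z
  -- the units
  bot_comonoid : (T : SymMon C).IsCocommComonoid Δbot mix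
  top_monoid : (P : SymMon C).IsCommMonoid nabTop mix
  -- medial maps and associators
  med_αT (A B X A' B' X' : C) :
    med (A ⨂ B) X (A' ⨂ B') X' ≫ (med A B A' B' ⨂ₘ 𝟙 (X ⅋ X')) ≫
        (αT (A ⅋ A') (B ⅋ B') (X ⅋ X')).hom =
      ((αT A B X).hom ⅋ₘ (αT A' B' X').hom) ≫ med A (B ⨂ X) A' (B' ⨂ X') ≫
        (𝟙 (A ⅋ A') ⨂ₘ med B X B' X')
  med_αP (A B X Y Z W : C) :
    (αP (A ⨂ B) (X ⨂ Y) (Z ⨂ W)).hom ≫ (med A B X Y ⅋ₘ 𝟙 (Z ⨂ W)) ≫ med (A ⅋ X) (B ⅋ Y) Z W =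
      (𝟙 (A ⨂ B) ⅋ₘ med X Y Z W) ≫ med A B (X ⅋ Z) (Y ⅋ W) ≫ ((αP A X Z).hom ⨂ₘ (αP B Y W).hom)
  -- medial maps and unitors
  med_lP (A B : C) :
    (Δbot ⅋ₘ 𝟙 (A ⨂ B)) ≫ med ⊥[C] ⊥[C] A B ≫ ((lP A).hom ⨂ₘ (lP B).hom) = (lP (A ⨂ B)).hom
  med_rP (A B : C) :
    (𝟙 (A ⨂ B) ⅋ₘ Δbot) ≫ med A B ⊥[C] ⊥[C] ≫ ((rP A).hom ⨂ₘ (rP B).hom) = (rP (A ⨂ B)).hom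
  med_lT (A B : C) :
    ((lT A).hom ⅋ₘ (lT B).hom) ≫ med ⊤[C] A ⊤[C] B ≫ (nabTop ⨂ₘ 𝟙 (A ⅋ B)) = (lT (A ⅋ B)).hom
  med_rT (A B : C) :
    ((rT A).hom ⅋ₘ (rT B).hom) ≫ med A ⊤[C] B ⊤[C] ≫ (𝟙 (A ⅋ B) ⨂ₘ nabTop) = (rT (A ⅋ B)).hom
  -- medial maps and braidings
  med_σT (A B X Y : C) :
    med A B X Y ≫ (σT (A ⅋ X) (B ⅋ Y)).hom = ((σT A B).hom ⅋ₘ (σT X Y).hom) ≫ med B A Y X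
  med_σP (A B X Y : C) :
    med A B X Y ≫ ((σP A X).hom ⨂ₘ (σP B Y).hom) = (σP (A ⨂ B) (X ⨂ Y)).hom ≫ med X Y A B

open SMLDC

section Functors

variable (C : Type u₁) [Category.{v₁} C] (D : Type u₂) [Category.{v₂} D]

/-- A strong symmetric linear functor `(FT, FP)` between symmetric linearly distributive
categories. -/
@[ext]
structure LinFunctor [SLDC C] [SLDC D] where
  FT : C ⥤ D
  FP : C ⥤ D
  strT : (T : SymMon C).Strong (T : SymMon D) FT
  strP : (P : SymMon C).Strong (P : SymMon D) FP
  vRT (A B : C) : FT.obj (A ⅋ B) ⟶ FP.obj A ⅋ FT.obj B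
  vLT (A B : C) : FT.obj (A ⅋ B) ⟶ FT.obj A ⅋ FP.obj B
  vRP (A B : C) : FT.obj A ⨂ FP.obj B ⟶ FP.obj (A ⨂ B)
  vLP (A B : C) : FP.obj A ⨂ FT.obj B ⟶ FP.obj (A ⨂ B)
  vRT_natural {A A' B B' : C} (f : A ⟶ A') (g : B ⟶ B') :
    FT.map (f ⅋ₘ g) ≫ vRT A' B' = vRT A B ≫ (FP.map f ⅋ₘ FT.map g)
  vLT_natural {A A' B B' : C} (f : A ⟶ A') (g : B ⟶ B') :
    FT.map (f ⅋ₘ g) ≫ vLT A' B' = vLT A B ≫ (FT.map f ⅋ₘ FP.map g)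
  vRP_natural {A A' B B' : C} (f : A ⟶ A') (g : B ⟶ B') :
    (FT.map f ⨂ₘ FP.map g) ≫ vRP A' B' = vRP A B ≫ FP.map (f ⨂ₘ g)
  vLP_natural {A A' B B' : C} (f : A ⟶ A') (g : B ⟶ B') :
    (FP.map f ⨂ₘ FT.map g) ≫ vLP A' B' = vLP A B ≫ FP.map (f ⨂ₘ g)
  -- linear strengths and units
  vRT_unit (A : C) :
    vRT ⊥[C] A ≫ (strP.unitInv ⅋ₘ 𝟙 (FT.obj A)) ≫ (lP (FT.obj A)).hom = FT.map (lP A).hom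
  vLT_unit (A : C) :
    vLT A ⊥[C] ≫ (𝟙 (FT.obj A) ⅋ₘ strP.unitInv) ≫ (rP (FT.obj A)).hom = FT.map (rP A).hom
  vRP_unit (A : C) :
    (lT (FP.obj A)).hom ≫ (strT.unitMap ⨂ₘ 𝟙 (FP.obj A)) ≫ vRP ⊤[C] A = FP.map (lT A).hom
  vLP_unit (A : C) :
    (rT (FP.obj A)).hom ≫ (𝟙 (FP.obj A) ⨂ₘ strT.unitMap) ≫ vLP A ⊤[C] = FP.map (rT A).hom
  -- linear strengths and associativities
  vRT_assoc (A B X : C) :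
    vRT A (B ⅋ X) ≫ (𝟙 (FP.obj A) ⅋ₘ vRT B X) ≫ (αP (FP.obj A) (FP.obj B) (FT.obj X)).hom =
      FT.map (αP A B X).hom ≫ vRT (A ⅋ B) X ≫ (strP.prodInv A B ⅋ₘ 𝟙 (FT.obj X))
  vLT_assoc (A B X : C) :
    vLT A (B ⅋ X) ≫ (𝟙 (FT.obj A) ⅋ₘ strP.prodInv B X) ≫
        (αP (FT.obj A) (FP.obj B) (FP.obj X)).hom =
      FT.map (αP A B X).hom ≫ vLT (A ⅋ B) X ≫ (vLT A B ⅋ₘ 𝟙 (FP.obj X))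
  vRP_assoc (A B X : C) :
    (αT (FT.obj A) (FT.obj B) (FP.obj X)).hom ≫ (𝟙 (FT.obj A) ⨂ₘ vRP B X) ≫ vRP A (B ⨂ X) =
      (strT.prodMap A B ⨂ₘ 𝟙 (FP.obj X)) ≫ vRP (A ⨂ B) X ≫ FP.map (αT A B X).hom
  vLP_assoc (A B X : C) :
    (αT (FP.obj A) (FT.obj B) (FT.obj X)).hom ≫ (𝟙 (FP.obj A) ⨂ₘ strT.prodMap B X) ≫
        vLP A (B ⨂ X) =
      (vLP A B ⨂ₘ 𝟙 (FT.obj X)) ≫ vLP (A ⨂ B) X ≫ FP.map (αT A B X).hom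
  -- linear strengths and linear distributivities
  vRT_dist (A B X : C) :
    strT.prodMap (A ⅋ B) X ≫ FT.map (δR A B X) ≫ vRT A (B ⨂ X) =
      (vRT A B ⨂ₘ 𝟙 (FT.obj X)) ≫ δR (FP.obj A) (FT.obj B) (FT.obj X) ≫
        (𝟙 (FP.obj A) ⅋ₘ strT.prodMap B X)
  vLT_dist (A B X : C) :
    strT.prodMap A (B ⅋ X) ≫ FT.map (δL A B X) ≫ vLT (A ⨂ B) X =
      (𝟙 (FT.obj A) ⨂ₘ vLT B X) ≫ δL (FT.obj A) (FT.obj B) (FP.obj X) ≫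
        (strT.prodMap A B ⅋ₘ 𝟙 (FP.obj X))
  vRP_dist (A B X : C) :
    vRP A (B ⅋ X) ≫ FP.map (δL A B X) ≫ strP.prodInv (A ⨂ B) X =
      (𝟙 (FT.obj A) ⨂ₘ strP.prodInv B X) ≫ δL (FT.obj A) (FP.obj B) (FP.obj X) ≫
        (vRP A B ⅋ₘ 𝟙 (FP.obj X))
  vLP_dist (A B X : C) :
    vLP (A ⅋ B) X ≫ FP.map (δR A B X) ≫ strP.prodInv A (B ⨂ X) =
      (strP.prodInv A B ⨂ₘ 𝟙 (FT.obj X)) ≫ δR (FP.obj A) (FP.obj B) (FT.obj X) ≫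
        (𝟙 (FP.obj A) ⅋ₘ vLP B X)
  -- linear strengths among themselves, via associators
  vRT_vLT (A B X : C) :
    vRT A (B ⅋ X) ≫ (𝟙 (FP.obj A) ⅋ₘ vLT B X) ≫ (αP (FP.obj A) (FT.obj B) (FP.obj X)).hom =
      FT.map (αP A B X).hom ≫ vLT (A ⅋ B) X ≫ (vRT A B ⅋ₘ 𝟙 (FP.obj X))
  vLP_vRP (A B X : C) :
    (αT (FT.obj A) (FP.obj B) (FT.obj X)).hom ≫ (𝟙 (FT.obj A) ⨂ₘ vLP B X) ≫ vRP A (B ⨂ X) =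
      (vRP A B ⨂ₘ 𝟙 (FT.obj X)) ≫ vLP (A ⨂ B) X ≫ FP.map (αT A B X).hom
  -- linear strengths among themselves, via linear distributivities
  vRT_vRP (A B X : C) :
    strT.prodMap A (B ⅋ X) ≫ FT.map (δL A B X) ≫ vRT (A ⨂ B) X =
      (𝟙 (FT.obj A) ⨂ₘ vRT B X) ≫ δL (FT.obj A) (FP.obj B) (FT.obj X) ≫
        (vRP A B ⅋ₘ 𝟙 (FT.obj X))
  vLT_vLP (A B X : C) :
    strT.prodMap (A ⅋ B) X ≫ FT.map (δR A B X) ≫ vLT A (B ⨂ X) =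
      (vLT A B ⨂ₘ 𝟙 (FT.obj X)) ≫ δR (FT.obj A) (FP.obj B) (FT.obj X) ≫
        (𝟙 (FT.obj A) ⅋ₘ vLP B X)
  vRP_vRT (A B X : C) :
    vRP (A ⅋ B) X ≫ FP.map (δR A B X) ≫ strP.prodInv A (B ⨂ X) =
      (vRT A B ⨂ₘ 𝟙 (FP.obj X)) ≫ δR (FP.obj A) (FT.obj B) (FP.obj X) ≫
        (𝟙 (FP.obj A) ⅋ₘ vRP B X)
  vLP_vLT (A B X : C) :
    vLP A (B ⅋ X) ≫ FP.map (δL A B X) ≫ strP.prodInv (A ⨂ B) X =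
      (𝟙 (FP.obj A) ⨂ₘ vLT B X) ≫ δL (FP.obj A) (FT.obj B) (FP.obj X) ≫
        (vLP A B ⅋ₘ 𝟙 (FP.obj X))
  -- linear strengths and braidings
  vT_braid (A B : C) :
    vRT A B ≫ (σP (FP.obj A) (FT.obj B)).hom = FT.map (σP A B).hom ≫ vLT B A
  vP_braid (A B : C) :
    vRP A B ≫ FP.map (σT A B).hom = (σT (FT.obj A) (FP.obj B)).hom ≫ vLP B A

/-- A (strong symmetric) medial linear functor between symmetric medial linearly distributive
categories. The structure maps are `strT.unitMap`, `strT.prodMap` (`m_⊤`, `m_⊗`), `laxP.unitMap`,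
`laxP.prodMap` (`m_⊥`, `m_⊕`), `strP.unitInv`, `strP.prodInv` (`n_⊥`, `n_⊕`), `oplaxT.unitMap`,
`oplaxT.prodMap` (`n_⊤`, `n_⊗`). -/
@[ext]
structure MedialFunctor [SMLDC C] [SMLDC D] extends LinFunctor C D where
  laxP : (P : SymMon C).Lax (P : SymMon D) FT
  oplaxT : (T : SymMon C).Oplax (T : SymMon D) FP
  -- `FT` is bilax duoidal
  FT_Δbot : Δbot ≫ (laxP.unitMap ⨂ₘ laxP.unitMap) ≫ strT.prodMap ⊥[C] ⊥[C] =
    laxP.unitMap ≫ FT.map Δbot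
  FT_nabTop : (strT.unitMap ⅋ₘ strT.unitMap) ≫ laxP.prodMap ⊤[C] ⊤[C] ≫ FT.map nabTop =
    nabTop ≫ strT.unitMap
  FT_mix : mix ≫ strT.unitMap = laxP.unitMap ≫ FT.map mix
  FT_med (A B X Y : C) :
    (strT.prodMap A B ⅋ₘ strT.prodMap X Y) ≫ laxP.prodMap (A ⨂ B) (X ⨂ Y) ≫
        FT.map (med A B X Y) =
      med (FT.obj A) (FT.obj B) (FT.obj X) (FT.obj Y) ≫
        (laxP.prodMap A X ⨂ₘ laxP.prodMap B Y) ≫ strT.prodMap (A ⅋ X) (B ⅋ Y)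
  -- `FP` is bilax duoidal
  FP_Δbot : FP.map Δbot ≫ oplaxT.prodMap ⊥[C] ⊥[C] ≫ (strP.unitInv ⨂ₘ strP.unitInv) =
    strP.unitInv ≫ Δbot
  FP_nabTop : strP.prodInv ⊤[C] ⊤[C] ≫ (oplaxT.unitMap ⅋ₘ oplaxT.unitMap) ≫ nabTop =
    FP.map nabTop ≫ oplaxT.unitMap
  FP_mix : strP.unitInv ≫ mix = FP.map mix ≫ oplaxT.unitMap
  FP_med (A B X Y : C) :
    FP.map (med A B X Y) ≫ oplaxT.prodMap (A ⅋ X) (B ⅋ Y) ≫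
        (strP.prodInv A X ⨂ₘ strP.prodInv B Y) =
      strP.prodInv (A ⨂ B) (X ⨂ Y) ≫ (oplaxT.prodMap A B ⅋ₘ oplaxT.prodMap X Y) ≫
        med (FP.obj A) (FP.obj B) (FP.obj X) (FP.obj Y)
  -- linear strengths, `⊥`-contraction and `⊤`-cocontraction
  vRP_Δbot : FP.map Δbot =
    strP.unitInv ≫ Δbot ≫ (laxP.unitMap ⨂ₘ strP.unitMap) ≫ vRP ⊥[C] ⊥[C]
  vRT_nabTop : FT.map nabTop =
    vRT ⊤[C] ⊤[C] ≫ (oplaxT.unitMap ⅋ₘ strT.unitInv) ≫ nabTop ≫ strT.unitMap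
  -- linear strengths and medial maps
  vRT_med (A B X Y : C) :
    FT.map (med A B X Y) ≫ strT.prodInv (A ⅋ X) (B ⅋ Y) ≫ (vRT A X ⨂ₘ vRT B Y) =
      vRT (A ⨂ B) (X ⨂ Y) ≫ (oplaxT.prodMap A B ⅋ₘ strT.prodInv X Y) ≫
        med (FP.obj A) (FP.obj B) (FT.obj X) (FT.obj Y)
  vRP_med (A B X Y : C) :
    (vRP A B ⅋ₘ vRP X Y) ≫ strP.prodMap (A ⨂ B) (X ⨂ Y) ≫ FP.map (med A B X Y) =
      med (FT.obj A) (FP.obj B) (FT.obj X) (FP.obj Y) ≫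
        (laxP.prodMap A X ⨂ₘ strP.prodMap B Y) ≫ vRP (A ⅋ X) (B ⅋ Y)
  -- linear strengths, `m_⊕` and `n_⊗`
  vRT_laxP (A B X : C) :
    laxP.prodMap (A ⅋ B) X ≫ FT.map (αP A B X).inv ≫ vRT A (B ⅋ X) =
      (vRT A B ⅋ₘ 𝟙 (FT.obj X)) ≫ (αP (FP.obj A) (FT.obj B) (FT.obj X)).inv ≫
        (𝟙 (FP.obj A) ⅋ₘ laxP.prodMap B X)
  vRP_oplaxT (A B X : C) :
    vRP A (B ⨂ X) ≫ FP.map (αT A B X).inv ≫ oplaxT.prodMap (A ⨂ B) X =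
      (𝟙 (FT.obj A) ⨂ₘ oplaxT.prodMap B X) ≫ (αT (FT.obj A) (FP.obj B) (FP.obj X)).inv ≫
        (vRP A B ⨂ₘ 𝟙 (FP.obj X))

variable {C D}

/-- Linear transformations. -/
@[ext]
structure LinTrans [SLDC C] [SLDC D] (F G : LinFunctor C D) where
  τT : F.FT ⟶ G.FT
  τP : G.FP ⟶ F.FP
  τT_unit : F.strT.unitMap ≫ τT.app ⊤[C] = G.strT.unitMap
  τT_prod (A B : C) :
    F.strT.prodMap A B ≫ τT.app (A ⨂ B) = (τT.app A ⨂ₘ τT.app B) ≫ G.strT.prodMap A B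
  τP_unit : τP.app ⊥[C] ≫ F.strP.unitInv = G.strP.unitInv
  τP_prod (A B : C) :
    τP.app (A ⅋ B) ≫ F.strP.prodInv A B = G.strP.prodInv A B ≫ (τP.app A ⅋ₘ τP.app B)
  τ_vRT (A B : C) :
    τT.app (A ⅋ B) ≫ G.vRT A B ≫ (τP.app A ⅋ₘ 𝟙 (G.FT.obj B)) =
      F.vRT A B ≫ (𝟙 (F.FP.obj A) ⅋ₘ τT.app B)
  τ_vLT (A B : C) :
    τT.app (A ⅋ B) ≫ G.vLT A B ≫ (𝟙 (G.FT.obj A) ⅋ₘ τP.app B) =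
      F.vLT A B ≫ (τT.app A ⅋ₘ 𝟙 (F.FP.obj B))
  τ_vLP (A B : C) :
    (𝟙 (G.FP.obj A) ⨂ₘ τT.app B) ≫ G.vLP A B ≫ τP.app (A ⨂ B) =
      (τP.app A ⨂ₘ 𝟙 (F.FT.obj B)) ≫ F.vLP A B
  τ_vRP (A B : C) :
    (τT.app A ⨂ₘ 𝟙 (G.FP.obj B)) ≫ G.vRP A B ≫ τP.app (A ⨂ B) =
      (𝟙 (F.FT.obj A) ⨂ₘ τP.app B) ≫ F.vRP A B

/-- Medial linear transformations. -/
@[ext]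
structure MedialTrans [SMLDC C] [SMLDC D] (F G : MedialFunctor C D) extends
    LinTrans F.toLinFunctor G.toLinFunctor where
  τT_unitP : F.laxP.unitMap ≫ τT.app ⊥[C] = G.laxP.unitMap
  τT_prodP (A B : C) :
    F.laxP.prodMap A B ≫ τT.app (A ⅋ B) = (τT.app A ⅋ₘ τT.app B) ≫ G.laxP.prodMap A B
  τP_unitT : τP.app ⊤[C] ≫ F.oplaxT.unitMap = G.oplaxT.unitMap
  τP_prodT (A B : C) :
    τP.app (A ⨂ B) ≫ F.oplaxT.prodMap A B = G.oplaxT.prodMap A B ≫ (τP.app A ⨂ₘ τP.app B)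

end Functors

section Composition

variable {C : Type u₁} [Category.{v₁} C] {D : Type u₂} [Category.{v₂} D]
  {E : Type u₃} [Category.{v₃} E]

open SymMon

namespace SymMon

theorem Lax.natural_left {M : SymMon C} {N : SymMon D} {F : C ⥤ D} (h : M.Lax N F) {A A' : C}
    (f : A ⟶ A') (B : C) : N.hom (F.map f) (𝟙 (F.obj B)) ≫ h.prodMap A' B =
      h.prodMap A B ≫ F.map (M.hom f (𝟙 B)) := by
  simpa using h.natural f (𝟙 B)

theorem Lax.natural_right {M : SymMon C} {N : SymMon D} {F : C ⥤ D} (h : M.Lax N F) (A : C)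
    {B B' : C} (g : B ⟶ B') : N.hom (𝟙 (F.obj A)) (F.map g) ≫ h.prodMap A B' =
      h.prodMap A B ≫ F.map (M.hom (𝟙 A) g) := by
  simpa using h.natural (𝟙 A) g

theorem Oplax.natural_left {M : SymMon C} {N : SymMon D} {F : C ⥤ D} (h : M.Oplax N F) {A A' : C}
    (f : A ⟶ A') (B : C) : h.prodMap A B ≫ N.hom (F.map f) (𝟙 (F.obj B)) =
      F.map (M.hom f (𝟙 B)) ≫ h.prodMap A' B := by
  simpa using (h.natural f (𝟙 B)).symm

theorem Oplax.natural_right {M : SymMon C} {N : SymMon D} {F : C ⥤ D} (h : M.Oplax N F) (A : C)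
    {B B' : C} (g : B ⟶ B') : h.prodMap A B ≫ N.hom (𝟙 (F.obj A)) (F.map g) =
      F.map (M.hom (𝟙 A) g) ≫ h.prodMap A B' := by
  simpa using (h.natural (𝟙 A) g).symm

theorem Strong.inv_natural {M : SymMon C} {N : SymMon D} {F : C ⥤ D} (h : M.Strong N F)
    {A A' B B' : C} (f : A ⟶ A') (g : B ⟶ B') : h.prodInv A B ≫ N.hom (F.map f) (F.map g) =
      F.map (M.hom f g) ≫ h.prodInv A' B' := by
  have e := h.natural f g
  have e' : N.hom (F.map f) (F.map g) = h.prodMap A B ≫ F.map (M.hom f g) ≫ h.prodInv A' B' := by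
    rw [← reassoc_of% e, h.prodMap_prodInv, Category.comp_id]
  rw [e', reassoc_of% (h.prodInv_prodMap A B)]

theorem Strong.inv_natural_left {M : SymMon C} {N : SymMon D} {F : C ⥤ D} (h : M.Strong N F)
    {A A' : C} (f : A ⟶ A') (B : C) : h.prodInv A B ≫ N.hom (F.map f) (𝟙 (F.obj B)) =
      F.map (M.hom f (𝟙 B)) ≫ h.prodInv A' B := by
  simpa using h.inv_natural f (𝟙 B)

theorem Strong.inv_natural_right {M : SymMon C} {N : SymMon D} {F : C ⥤ D} (h : M.Strong N F)
    (A : C) {B B' : C} (g : B ⟶ B') : h.prodInv A B ≫ N.hom (𝟙 (F.obj A)) (F.map g) =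
      F.map (M.hom (𝟙 A) g) ≫ h.prodInv A B' := by
  simpa using h.inv_natural (𝟙 A) g

end SymMon

namespace LinFunctor

section

variable [SLDC C] [SLDC D] (G : LinFunctor C D)

theorem vRT_left {A A' : C} (f : A ⟶ A') (B : C) :
    G.vRT A B ≫ (G.FP.map f ⅋ₘ 𝟙 (G.FT.obj B)) = G.FT.map (f ⅋ₘ 𝟙 B) ≫ G.vRT A' B := by
  simpa using (G.vRT_natural f (𝟙 B)).symm

theorem vRT_right (A : C) {B B' : C} (g : B ⟶ B') :
    G.vRT A B ≫ (𝟙 (G.FP.obj A) ⅋ₘ G.FT.map g) = G.FT.map (𝟙 A ⅋ₘ g) ≫ G.vRT A B' := by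
  simpa using (G.vRT_natural (𝟙 A) g).symm

theorem vLT_left {A A' : C} (f : A ⟶ A') (B : C) :
    G.vLT A B ≫ (G.FT.map f ⅋ₘ 𝟙 (G.FP.obj B)) = G.FT.map (f ⅋ₘ 𝟙 B) ≫ G.vLT A' B := by
  simpa using (G.vLT_natural f (𝟙 B)).symm

theorem vLT_right (A : C) {B B' : C} (g : B ⟶ B') :
    G.vLT A B ≫ (𝟙 (G.FT.obj A) ⅋ₘ G.FP.map g) = G.FT.map (𝟙 A ⅋ₘ g) ≫ G.vLT A B' := by
  simpa using (G.vLT_natural (𝟙 A) g).symm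

theorem vRP_left {A A' : C} (f : A ⟶ A') (B : C) :
    (G.FT.map f ⨂ₘ 𝟙 (G.FP.obj B)) ≫ G.vRP A' B = G.vRP A B ≫ G.FP.map (f ⨂ₘ 𝟙 B) := by
  simpa using G.vRP_natural f (𝟙 B)

theorem vRP_right (A : C) {B B' : C} (g : B ⟶ B') :
    (𝟙 (G.FT.obj A) ⨂ₘ G.FP.map g) ≫ G.vRP A B' = G.vRP A B ≫ G.FP.map (𝟙 A ⨂ₘ g) := by
  simpa using G.vRP_natural (𝟙 A) g

theorem vLP_left {A A' : C} (f : A ⟶ A') (B : C) :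
    (G.FP.map f ⨂ₘ 𝟙 (G.FT.obj B)) ≫ G.vLP A' B = G.vLP A B ≫ G.FP.map (f ⨂ₘ 𝟙 B) := by
  simpa using G.vLP_natural f (𝟙 B)

theorem vLP_right (A : C) {B B' : C} (g : B ⟶ B') :
    (𝟙 (G.FP.obj A) ⨂ₘ G.FT.map g) ≫ G.vLP A B' = G.vLP A B ≫ G.FP.map (𝟙 A ⨂ₘ g) := by
  simpa using G.vLP_natural (𝟙 A) g

variable (C) in
/-- The identity linear functor. -/
def id : LinFunctor C C where
  FT := 𝟭 C
  FP := 𝟭 C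
  strT := Strong.id T
  strP := Strong.id P
  vRT A B := 𝟙 _
  vLT A B := 𝟙 _
  vRP A B := 𝟙 _
  vLP A B := 𝟙 _
  vRT_natural := by simp
  vLT_natural := by simp
  vRP_natural := by simp
  vLP_natural := by simp
  vRT_unit := by simp [Strong.id, SymMon.hom_id]
  vLT_unit := by simp [Strong.id, SymMon.hom_id]
  vRP_unit := by simp [Strong.id, Lax.id, SymMon.hom_id]
  vLP_unit := by simp [Strong.id, Lax.id, SymMon.hom_id]
  vRT_assoc := by simp [Strong.id, SymMon.hom_id]
  vLT_assoc := by simp [Strong.id, SymMon.hom_id]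
  vRP_assoc := by simp [Strong.id, Lax.id, SymMon.hom_id]
  vLP_assoc := by simp [Strong.id, Lax.id, SymMon.hom_id]
  vRT_dist := by simp [Strong.id, Lax.id, SymMon.hom_id]
  vLT_dist := by simp [Strong.id, Lax.id, SymMon.hom_id]
  vRP_dist := by simp [Strong.id, SymMon.hom_id]
  vLP_dist := by simp [Strong.id, SymMon.hom_id]
  vRT_vLT := by simp [SymMon.hom_id]
  vLP_vRP := by simp [SymMon.hom_id]
  vRT_vRP := by simp [Strong.id, Lax.id, SymMon.hom_id]
  vLT_vLP := by simp [Strong.id, Lax.id, SymMon.hom_id]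
  vRP_vRT := by simp [Strong.id, SymMon.hom_id]
  vLP_vLT := by simp [Strong.id, SymMon.hom_id]
  vT_braid := by simp
  vP_braid := by simp

end

variable [SLDC C] [SLDC D] [SLDC E]

/-- The composite of linear functors. -/
def comp (F : LinFunctor C D) (G : LinFunctor D E) : LinFunctor C E where
  FT := F.FT ⋙ G.FT
  FP := F.FP ⋙ G.FP
  strT := F.strT.comp G.strT
  strP := F.strP.comp G.strP
  vRT A B := G.FT.map (F.vRT A B) ≫ G.vRT _ _
  vLT A B := G.FT.map (F.vLT A B) ≫ G.vLT _ _
  vRP A B := G.vRP _ _ ≫ G.FP.map (F.vRP A B)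
  vLP A B := G.vLP _ _ ≫ G.FP.map (F.vLP A B)
  vRT_natural f g := by
    have eF := congrArg G.FT.map (F.vRT_natural f g)
    simp only [Functor.map_comp] at eF
    simp only [Functor.comp_map, Category.assoc, reassoc_of% eF, G.vRT_natural]
  vLT_natural f g := by
    have eF := congrArg G.FT.map (F.vLT_natural f g)
    simp only [Functor.map_comp] at eF
    simp only [Functor.comp_map, Category.assoc, reassoc_of% eF, G.vLT_natural]
  vRP_natural f g := by
    have eF := congrArg G.FP.map (F.vRP_natural f g)
    simp only [Functor.map_comp] at eF
    simp only [Functor.comp_map, Category.assoc, ← eF, reassoc_of% G.vRP_natural]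
  vLP_natural f g := by
    have eF := congrArg G.FP.map (F.vLP_natural f g)
    simp only [Functor.map_comp] at eF
    simp only [Functor.comp_map, Category.assoc, ← eF, reassoc_of% G.vLP_natural]
  vRT_unit A := by
    have eF := congrArg G.FT.map (F.vRT_unit A)
    simp only [Functor.map_comp] at eF
    simp only [Strong.comp, Functor.comp_obj, Functor.comp_map, hom_comp_id, Category.assoc,
      reassoc_of% G.vRT_left, G.vRT_unit, eF]
  vLT_unit A := by
    have eF := congrArg G.FT.map (F.vLT_unit A)
    simp only [Functor.map_comp] at eF
    simp only [Strong.comp, Functor.comp_obj, Functor.comp_map, id_hom_comp, Category.assoc,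
      reassoc_of% G.vLT_right, G.vLT_unit, eF]
  vRP_unit A := by
    have eF := congrArg G.FP.map (F.vRP_unit A)
    simp only [Functor.map_comp] at eF
    simp only [Strong.comp, Lax.comp, Functor.comp_obj, Functor.comp_map, hom_comp_id,
      Category.assoc, reassoc_of% G.vRP_left, reassoc_of% G.vRP_unit, eF]
  vLP_unit A := by
    have eF := congrArg G.FP.map (F.vLP_unit A)
    simp only [Functor.map_comp] at eF
    simp only [Strong.comp, Lax.comp, Functor.comp_obj, Functor.comp_map, id_hom_comp,
      Category.assoc, reassoc_of% G.vLP_right, reassoc_of% G.vLP_unit, eF]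
  vRT_assoc A B X := by
    have eF := congrArg G.FT.map (F.vRT_assoc A B X)
    simp only [Functor.map_comp] at eF
    simp only [Strong.comp, Functor.comp_obj, Functor.comp_map, id_hom_comp, hom_comp_id,
      Category.assoc, reassoc_of% G.vRT_left, reassoc_of% G.vRT_right, G.vRT_assoc,
      reassoc_of% eF]
  vLT_assoc A B X := by
    have eF := congrArg G.FT.map (F.vLT_assoc A B X)
    simp only [Functor.map_comp] at eF
    simp only [Strong.comp, Functor.comp_obj, Functor.comp_map, id_hom_comp, hom_comp_id,
      Category.assoc, reassoc_of% G.vLT_left, reassoc_of% G.vLT_right, G.vLT_assoc,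
      reassoc_of% eF]
  vRP_assoc A B X := by
    have eF := congrArg G.FP.map (F.vRP_assoc A B X)
    simp only [Functor.map_comp] at eF
    simp only [Strong.comp, Lax.comp, Functor.comp_obj, Functor.comp_map, id_hom_comp, hom_comp_id,
      Category.assoc, reassoc_of% G.vRP_left, reassoc_of% G.vRP_right, reassoc_of% G.vRP_assoc,
      eF]
  vLP_assoc A B X := by
    have eF := congrArg G.FP.map (F.vLP_assoc A B X)
    simp only [Functor.map_comp] at eF
    simp only [Strong.comp, Lax.comp, Functor.comp_obj, Functor.comp_map, id_hom_comp, hom_comp_id,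
      Category.assoc, reassoc_of% G.vLP_left, reassoc_of% G.vLP_right, reassoc_of% G.vLP_assoc,
      eF]
  vRT_dist A B X := by
    have eF := congrArg G.FT.map (F.vRT_dist A B X)
    simp only [Functor.map_comp] at eF
    simp only [Strong.comp, Lax.comp, Functor.comp_obj, Functor.comp_map, id_hom_comp, hom_comp_id,
      Category.assoc, reassoc_of% eF, ← reassoc_of% G.vRT_dist,
      reassoc_of% G.strT.natural_left, G.vRT_right]
  vLT_dist A B X := by
    have eF := congrArg G.FT.map (F.vLT_dist A B X)
    simp only [Functor.map_comp] at eF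
    simp only [Strong.comp, Lax.comp, Functor.comp_obj, Functor.comp_map, id_hom_comp, hom_comp_id,
      Category.assoc, reassoc_of% eF, ← reassoc_of% G.vLT_dist,
      reassoc_of% G.strT.natural_right, G.vLT_left]
  vRP_dist A B X := by
    have eF := congrArg G.FP.map (F.vRP_dist A B X)
    simp only [Functor.map_comp] at eF
    simp only [Strong.comp, Functor.comp_obj, Functor.comp_map, id_hom_comp, hom_comp_id,
      Category.assoc, reassoc_of% eF, ← reassoc_of% G.vRP_dist,
      reassoc_of% G.vRP_right, G.strP.inv_natural_left]
  vLP_dist A B X := by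
    have eF := congrArg G.FP.map (F.vLP_dist A B X)
    simp only [Functor.map_comp] at eF
    simp only [Strong.comp, Functor.comp_obj, Functor.comp_map, id_hom_comp, hom_comp_id,
      Category.assoc, reassoc_of% eF, ← reassoc_of% G.vLP_dist,
      reassoc_of% G.vLP_left, G.strP.inv_natural_right]
  vRT_vLT A B X := by
    have eF := congrArg G.FT.map (F.vRT_vLT A B X)
    simp only [Functor.map_comp] at eF
    simp only [Functor.comp_obj, Functor.comp_map, id_hom_comp, hom_comp_id,
      Category.assoc, reassoc_of% G.vRT_right, reassoc_of% G.vLT_left, G.vRT_vLT,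
      reassoc_of% eF]
  vLP_vRP A B X := by
    have eF := congrArg G.FP.map (F.vLP_vRP A B X)
    simp only [Functor.map_comp] at eF
    simp only [Functor.comp_obj, Functor.comp_map, id_hom_comp, hom_comp_id,
      Category.assoc, reassoc_of% G.vRP_right, reassoc_of% G.vLP_left, reassoc_of% G.vLP_vRP,
      eF]
  vRT_vRP A B X := by
    have eF := congrArg G.FT.map (F.vRT_vRP A B X)
    simp only [Functor.map_comp] at eF
    simp only [Strong.comp, Lax.comp, Functor.comp_obj, Functor.comp_map, id_hom_comp, hom_comp_id,
      Category.assoc, reassoc_of% eF, ← reassoc_of% G.vRT_vRP,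
      reassoc_of% G.strT.natural_right, G.vRT_left]
  vLT_vLP A B X := by
    have eF := congrArg G.FT.map (F.vLT_vLP A B X)
    simp only [Functor.map_comp] at eF
    simp only [Strong.comp, Lax.comp, Functor.comp_obj, Functor.comp_map, id_hom_comp, hom_comp_id,
      Category.assoc, reassoc_of% eF, ← reassoc_of% G.vLT_vLP,
      reassoc_of% G.strT.natural_left, G.vLT_right]
  vRP_vRT A B X := by
    have eF := congrArg G.FP.map (F.vRP_vRT A B X)
    simp only [Functor.map_comp] at eF
    simp only [Strong.comp, Functor.comp_obj, Functor.comp_map, id_hom_comp, hom_comp_id,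
      Category.assoc, reassoc_of% eF, ← reassoc_of% G.vRP_vRT,
      reassoc_of% G.vRP_left, G.strP.inv_natural_right]
  vLP_vLT A B X := by
    have eF := congrArg G.FP.map (F.vLP_vLT A B X)
    simp only [Functor.map_comp] at eF
    simp only [Strong.comp, Functor.comp_obj, Functor.comp_map, id_hom_comp, hom_comp_id,
      Category.assoc, reassoc_of% eF, ← reassoc_of% G.vLP_vLT,
      reassoc_of% G.vLP_right, G.strP.inv_natural_left]
  vT_braid A B := by
    have eF := congrArg G.FT.map (F.vT_braid A B)
    simp only [Functor.map_comp] at eF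
    simp only [Functor.comp_obj, Functor.comp_map, Category.assoc, G.vT_braid, reassoc_of% eF]
  vP_braid A B := by
    have eF := congrArg G.FP.map (F.vP_braid A B)
    simp only [Functor.map_comp] at eF
    simp only [Functor.comp_obj, Functor.comp_map, Category.assoc, eF, reassoc_of% G.vP_braid]

end LinFunctor

namespace MedialFunctor

variable (C) in
/-- The identity medial linear functor. -/
def id [SMLDC C] : MedialFunctor C C where
  toLinFunctor := LinFunctor.id C
  laxP := Lax.id P
  oplaxT := Oplax.id T
  FT_Δbot := by simp [LinFunctor.id, Strong.id, Lax.id, SymMon.hom_id]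
  FT_nabTop := by simp [LinFunctor.id, Strong.id, Lax.id, SymMon.hom_id]
  FT_mix := by simp [LinFunctor.id, Strong.id, Lax.id]
  FT_med := by simp [LinFunctor.id, Strong.id, Lax.id, SymMon.hom_id]
  FP_Δbot := by simp [LinFunctor.id, Strong.id, Oplax.id, SymMon.hom_id]
  FP_nabTop := by simp [LinFunctor.id, Strong.id, Oplax.id, SymMon.hom_id]
  FP_mix := by simp [LinFunctor.id, Strong.id, Oplax.id]
  FP_med := by simp [LinFunctor.id, Strong.id, Oplax.id, SymMon.hom_id]
  vRP_Δbot := by simp [LinFunctor.id, Strong.id, Lax.id, SymMon.hom_id]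
  vRT_nabTop := by simp [LinFunctor.id, Strong.id, Lax.id, Oplax.id, SymMon.hom_id]
  vRT_med := by simp [LinFunctor.id, Strong.id, Oplax.id, SymMon.hom_id]
  vRP_med := by simp [LinFunctor.id, Strong.id, Lax.id, SymMon.hom_id]
  vRT_laxP := by simp [LinFunctor.id, Lax.id, SymMon.hom_id]
  vRP_oplaxT := by simp [LinFunctor.id, Oplax.id, SymMon.hom_id]

/-- The composite of medial linear functors. -/
def comp [SMLDC C] [SMLDC D] [SMLDC E] (F : MedialFunctor C D) (G : MedialFunctor D E) :
    MedialFunctor C E where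
  toLinFunctor := F.toLinFunctor.comp G.toLinFunctor
  laxP := F.laxP.comp G.laxP
  oplaxT := F.oplaxT.comp G.oplaxT
  FT_Δbot := by
    have eF := congrArg G.FT.map F.FT_Δbot
    simp only [Functor.map_comp] at eF
    simp only [LinFunctor.comp, Strong.comp, Lax.comp, Functor.comp_obj, Functor.comp_map,
      SymMon.hom_comp, Category.assoc, reassoc_of% G.strT.natural, ← eF,
      ← reassoc_of% G.FT_Δbot]
  FT_nabTop := by
    have eF := congrArg G.FT.map F.FT_nabTop
    simp only [Functor.map_comp] at eF
    simp only [LinFunctor.comp, Strong.comp, Lax.comp, Functor.comp_obj, Functor.comp_map,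
      SymMon.hom_comp, Category.assoc, reassoc_of% G.laxP.natural, eF,
      reassoc_of% G.FT_nabTop]
  FT_mix := by
    have eF := congrArg G.FT.map F.FT_mix
    simp only [Functor.map_comp] at eF
    simp only [LinFunctor.comp, Strong.comp, Lax.comp, Functor.comp_obj, Functor.comp_map,
      Category.assoc, ← eF, reassoc_of% G.FT_mix]
  FT_med A B X Y := by
    have eF := congrArg G.FT.map (F.FT_med A B X Y)
    simp only [Functor.map_comp] at eF
    simp only [LinFunctor.comp, Strong.comp, Lax.comp, Functor.comp_obj, Functor.comp_map,
      SymMon.hom_comp, Category.assoc, reassoc_of% G.laxP.natural, reassoc_of% G.strT.natural, eF,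
      reassoc_of% G.FT_med]
  FP_Δbot := by
    have eF := congrArg G.FP.map F.FP_Δbot
    simp only [Functor.map_comp] at eF
    simp only [LinFunctor.comp, Strong.comp, Oplax.comp, Functor.comp_obj, Functor.comp_map,
      SymMon.hom_comp, Category.assoc, ← reassoc_of% G.oplaxT.natural, reassoc_of% eF,
      G.FP_Δbot]
  FP_nabTop := by
    have eF := congrArg G.FP.map F.FP_nabTop
    simp only [Functor.map_comp] at eF
    simp only [LinFunctor.comp, Strong.comp, Oplax.comp, Functor.comp_obj, Functor.comp_map,
      SymMon.hom_comp, Category.assoc, reassoc_of% G.strP.inv_natural, ← reassoc_of% eF,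
      G.FP_nabTop]
  FP_mix := by
    have eF := congrArg G.FP.map F.FP_mix
    simp only [Functor.map_comp] at eF
    simp only [LinFunctor.comp, Strong.comp, Oplax.comp, Functor.comp_obj, Functor.comp_map,
      Category.assoc, ← reassoc_of% eF, G.FP_mix]
  FP_med A B X Y := by
    have eF := congrArg G.FP.map (F.FP_med A B X Y)
    simp only [Functor.map_comp] at eF
    simp only [LinFunctor.comp, Strong.comp, Oplax.comp, Functor.comp_obj, Functor.comp_map,
      SymMon.hom_comp, Category.assoc, ← reassoc_of% G.oplaxT.natural,
      reassoc_of% G.strP.inv_natural, reassoc_of% eF, G.FP_med]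
  vRP_Δbot := by
    have eF := congrArg G.FP.map F.vRP_Δbot
    simp only [Functor.map_comp, G.vRP_Δbot, Category.assoc] at eF
    simp only [LinFunctor.comp, Strong.comp, Lax.comp, Functor.comp_obj, Functor.comp_map,
      SymMon.hom_comp, Category.assoc, reassoc_of% G.vRP_natural, eF]
  vRT_nabTop := by
    have eF := congrArg G.FT.map F.vRT_nabTop
    simp only [Functor.map_comp, G.vRT_nabTop, Category.assoc] at eF
    simp only [LinFunctor.comp, Strong.comp, Lax.comp, Oplax.comp, Functor.comp_obj,
      Functor.comp_map, SymMon.hom_comp, Category.assoc, ← reassoc_of% G.vRT_natural, eF]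
  vRT_med A B X Y := by
    have eF := congrArg G.FT.map (F.vRT_med A B X Y)
    simp only [Functor.map_comp] at eF
    simp only [LinFunctor.comp, Strong.comp, Oplax.comp, Functor.comp_obj, Functor.comp_map,
      SymMon.hom_comp, Category.assoc, reassoc_of% G.strT.inv_natural, reassoc_of% eF,
      ← reassoc_of% G.vRT_natural, G.vRT_med]
  vRP_med A B X Y := by
    have eF := congrArg G.FP.map (F.vRP_med A B X Y)
    simp only [Functor.map_comp] at eF
    simp only [LinFunctor.comp, Strong.comp, Lax.comp, Functor.comp_obj, Functor.comp_map,
      SymMon.hom_comp, Category.assoc, reassoc_of% G.strP.natural, eF,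
      reassoc_of% G.vRP_natural, reassoc_of% G.vRP_med]
  vRT_laxP A B X := by
    have eF := congrArg G.FT.map (F.vRT_laxP A B X)
    simp only [Functor.map_comp] at eF
    simp only [LinFunctor.comp, Lax.comp, Functor.comp_obj, Functor.comp_map,
      hom_comp_id, id_hom_comp, Category.assoc, reassoc_of% eF, ← reassoc_of% G.vRT_laxP,
      reassoc_of% G.laxP.natural_left, G.vRT_right]
  vRP_oplaxT A B X := by
    have eF := congrArg G.FP.map (F.vRP_oplaxT A B X)
    simp only [Functor.map_comp] at eF
    simp only [LinFunctor.comp, Oplax.comp, Functor.comp_obj, Functor.comp_map,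
      hom_comp_id, id_hom_comp, Category.assoc, reassoc_of% eF, ← reassoc_of% G.vRP_oplaxT,
      reassoc_of% G.vRP_right, G.oplaxT.natural_left]

end MedialFunctor

namespace LinTrans

section

variable [SLDC C] [SLDC D]

/-- The identity linear transformation. -/
def id (F : LinFunctor C D) : LinTrans F F where
  τT := 𝟙 _
  τP := 𝟙 _
  τT_unit := by simp
  τT_prod := by simp [SymMon.hom_id]
  τP_unit := by simp
  τP_prod := by simp [SymMon.hom_id]
  τ_vRT := by simp
  τ_vLT := by simp
  τ_vLP := by simp
  τ_vRP := by simp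

/-- The vertical composite of linear transformations. -/
def vcomp {F G H : LinFunctor C D} (α : LinTrans F G) (β : LinTrans G H) : LinTrans F H where
  τT := α.τT ≫ β.τT
  τP := β.τP ≫ α.τP
  τT_unit := by simp [reassoc_of% α.τT_unit, β.τT_unit]
  τT_prod A B := by
    simp only [NatTrans.comp_app, SymMon.hom_comp, Category.assoc, reassoc_of% α.τT_prod,
      β.τT_prod]
  τP_unit := by simp [α.τP_unit, β.τP_unit]
  τP_prod A B := by
    simp only [NatTrans.comp_app, SymMon.hom_comp, Category.assoc, α.τP_prod,
      reassoc_of% β.τP_prod]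
  τ_vRT A B := by
    have e₁ : (𝟙 (G.FP.obj A) ⅋ₘ β.τT.app B) ≫ (α.τP.app A ⅋ₘ 𝟙 (H.FT.obj B)) =
        (α.τP.app A ⅋ₘ 𝟙 (G.FT.obj B)) ≫ (𝟙 (F.FP.obj A) ⅋ₘ β.τT.app B) := by
      simp only [← SymMon.hom_comp, Category.id_comp, Category.comp_id]
    simp only [NatTrans.comp_app, hom_comp_id, id_hom_comp, Category.assoc,
      reassoc_of% β.τ_vRT, e₁, reassoc_of% α.τ_vRT]
  τ_vLT A B := by
    have e₁ : (β.τT.app A ⅋ₘ 𝟙 (G.FP.obj B)) ≫ (𝟙 (H.FT.obj A) ⅋ₘ α.τP.app B) =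
        (𝟙 (G.FT.obj A) ⅋ₘ α.τP.app B) ≫ (β.τT.app A ⅋ₘ 𝟙 (F.FP.obj B)) := by
      simp only [← SymMon.hom_comp, Category.id_comp, Category.comp_id]
    simp only [NatTrans.comp_app, hom_comp_id, id_hom_comp, Category.assoc,
      reassoc_of% β.τ_vLT, e₁, reassoc_of% α.τ_vLT]
  τ_vLP A B := by
    have e₁ : (𝟙 (H.FP.obj A) ⨂ₘ α.τT.app B) ≫ (β.τP.app A ⨂ₘ 𝟙 (G.FT.obj B)) =
        (β.τP.app A ⨂ₘ 𝟙 (F.FT.obj B)) ≫ (𝟙 (G.FP.obj A) ⨂ₘ α.τT.app B) := by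
      simp only [← SymMon.hom_comp, Category.id_comp, Category.comp_id]
    simp only [NatTrans.comp_app, hom_comp_id, id_hom_comp, Category.assoc,
      reassoc_of% β.τ_vLP, reassoc_of% e₁, α.τ_vLP]
  τ_vRP A B := by
    have e₁ : (α.τT.app A ⨂ₘ 𝟙 (H.FP.obj B)) ≫ (𝟙 (G.FT.obj A) ⨂ₘ β.τP.app B) =
        (𝟙 (F.FT.obj A) ⨂ₘ β.τP.app B) ≫ (α.τT.app A ⨂ₘ 𝟙 (G.FP.obj B)) := by
      simp only [← SymMon.hom_comp, Category.id_comp, Category.comp_id]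
    simp only [NatTrans.comp_app, hom_comp_id, id_hom_comp, Category.assoc,
      reassoc_of% β.τ_vRP, reassoc_of% e₁, α.τ_vRP]

end

variable [SLDC C] [SLDC D] [SLDC E]

/-- Precomposition of a linear transformation with a linear functor. -/
def whiskerLeft (F : LinFunctor C D) {G H : LinFunctor D E} (α : LinTrans G H) :
    LinTrans (F.comp G) (F.comp H) where
  τT := Functor.whiskerLeft F.FT α.τT
  τP := Functor.whiskerLeft F.FP α.τP
  τT_unit := by
    simp only [LinFunctor.comp, Strong.comp, Lax.comp, Functor.whiskerLeft_app, Category.assoc,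
      α.τT.naturality, reassoc_of% α.τT_unit]
  τT_prod A B := by
    simp only [LinFunctor.comp, Strong.comp, Lax.comp, Functor.comp_obj,
      Functor.whiskerLeft_app, Category.assoc, α.τT.naturality, reassoc_of% α.τT_prod]
  τP_unit := by
    simp only [LinFunctor.comp, Strong.comp, Functor.whiskerLeft_app,
      ← α.τP.naturality_assoc, α.τP_unit]
  τP_prod A B := by
    simp only [LinFunctor.comp, Strong.comp, Functor.comp_obj,
      Functor.whiskerLeft_app, Category.assoc, ← α.τP.naturality_assoc, α.τP_prod]
  τ_vRT A B := by
    simp only [LinFunctor.comp, Functor.comp_obj,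
      Functor.whiskerLeft_app, Category.assoc, ← α.τT.naturality_assoc, α.τ_vRT]
  τ_vLT A B := by
    simp only [LinFunctor.comp, Functor.comp_obj,
      Functor.whiskerLeft_app, Category.assoc, ← α.τT.naturality_assoc, α.τ_vLT]
  τ_vLP A B := by
    simp only [LinFunctor.comp, Functor.comp_obj,
      Functor.whiskerLeft_app, Category.assoc, α.τP.naturality, reassoc_of% α.τ_vLP]
  τ_vRP A B := by
    simp only [LinFunctor.comp, Functor.comp_obj,
      Functor.whiskerLeft_app, Category.assoc, α.τP.naturality, reassoc_of% α.τ_vRP]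

/-- Postcomposition of a linear transformation with a linear functor. -/
def whiskerRight {F G : LinFunctor C D} (α : LinTrans F G) (H : LinFunctor D E) :
    LinTrans (F.comp H) (G.comp H) where
  τT := Functor.whiskerRight α.τT H.FT
  τP := Functor.whiskerRight α.τP H.FP
  τT_unit := by
    simp only [LinFunctor.comp, Strong.comp, Lax.comp, Functor.whiskerRight_app, Category.assoc,
      ← H.FT.map_comp, α.τT_unit]
  τT_prod A B := by
    simp only [LinFunctor.comp, Strong.comp, Lax.comp, Functor.comp_obj, Functor.whiskerRight_app,
      Category.assoc, reassoc_of% H.strT.natural]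
    simp only [← H.FT.map_comp, α.τT_prod]
  τP_unit := by
    simp only [LinFunctor.comp, Strong.comp, Functor.whiskerRight_app,
      ← H.FP.map_comp_assoc, α.τP_unit]
  τP_prod A B := by
    simp only [LinFunctor.comp, Strong.comp, Functor.comp_obj, Functor.whiskerRight_app,
      Category.assoc, H.strP.inv_natural]
    simp only [← H.FP.map_comp_assoc, α.τP_prod]
  τ_vRT A B := by
    simp only [LinFunctor.comp, Functor.comp_obj, Functor.whiskerRight_app,
      Category.assoc, H.vRT_left, H.vRT_right]
    simp only [← H.FT.map_comp_assoc, Category.assoc, α.τ_vRT]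
  τ_vLT A B := by
    simp only [LinFunctor.comp, Functor.comp_obj, Functor.whiskerRight_app,
      Category.assoc, H.vLT_left, H.vLT_right]
    simp only [← H.FT.map_comp_assoc, Category.assoc, α.τ_vLT]
  τ_vLP A B := by
    simp only [LinFunctor.comp, Functor.comp_obj, Functor.whiskerRight_app,
      Category.assoc, reassoc_of% H.vLP_left, reassoc_of% H.vLP_right]
    simp only [← H.FP.map_comp, α.τ_vLP]
  τ_vRP A B := by
    simp only [LinFunctor.comp, Functor.comp_obj, Functor.whiskerRight_app,
      Category.assoc, reassoc_of% H.vRP_left, reassoc_of% H.vRP_right]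
    simp only [← H.FP.map_comp, α.τ_vRP]

end LinTrans

namespace MedialTrans

section

variable [SMLDC C] [SMLDC D]

theorem ext' {F G : MedialFunctor C D} {α β : MedialTrans F G}
    (h : α.toLinTrans = β.toLinTrans) : α = β :=
  MedialTrans.ext (congrArg LinTrans.τT h) (congrArg LinTrans.τP h)

/-- The identity medial linear transformation. -/
def id (F : MedialFunctor C D) : MedialTrans F F where
  toLinTrans := LinTrans.id F.toLinFunctor
  τT_unitP := by simp [LinTrans.id]
  τT_prodP := by simp [LinTrans.id, SymMon.hom_id]
  τP_unitT := by simp [LinTrans.id]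
  τP_prodT := by simp [LinTrans.id, SymMon.hom_id]

/-- The vertical composite of medial linear transformations. -/
def vcomp {F G H : MedialFunctor C D} (α : MedialTrans F G) (β : MedialTrans G H) :
    MedialTrans F H where
  toLinTrans := α.toLinTrans.vcomp β.toLinTrans
  τT_unitP := by simp [LinTrans.vcomp, reassoc_of% α.τT_unitP, β.τT_unitP]
  τT_prodP A B := by
    simp only [LinTrans.vcomp, NatTrans.comp_app, SymMon.hom_comp, Category.assoc,
      reassoc_of% α.τT_prodP, β.τT_prodP]
  τP_unitT := by simp [LinTrans.vcomp, α.τP_unitT, β.τP_unitT]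
  τP_prodT A B := by
    simp only [LinTrans.vcomp, NatTrans.comp_app, SymMon.hom_comp, Category.assoc, α.τP_prodT,
      reassoc_of% β.τP_prodT]

end

variable [SMLDC C] [SMLDC D] [SMLDC E]

/-- Precomposition of a medial linear transformation with a medial linear functor. -/
def whiskerLeft (F : MedialFunctor C D) {G H : MedialFunctor D E} (α : MedialTrans G H) :
    MedialTrans (F.comp G) (F.comp H) where
  toLinTrans := α.toLinTrans.whiskerLeft F.toLinFunctor
  τT_unitP := by
    simp only [LinTrans.whiskerLeft, MedialFunctor.comp, LinFunctor.comp, Lax.comp,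
      Functor.whiskerLeft_app, Category.assoc, α.τT.naturality, reassoc_of% α.τT_unitP]
  τT_prodP A B := by
    simp only [LinTrans.whiskerLeft, MedialFunctor.comp, LinFunctor.comp, Lax.comp,
      Functor.comp_obj, Functor.whiskerLeft_app, Category.assoc, α.τT.naturality,
      reassoc_of% α.τT_prodP]
  τP_unitT := by
    simp only [LinTrans.whiskerLeft, MedialFunctor.comp, LinFunctor.comp, Oplax.comp,
      Functor.whiskerLeft_app, ← α.τP.naturality_assoc, α.τP_unitT]
  τP_prodT A B := by
    simp only [LinTrans.whiskerLeft, MedialFunctor.comp, LinFunctor.comp, Oplax.comp,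
      Functor.comp_obj, Functor.whiskerLeft_app, Category.assoc, ← α.τP.naturality_assoc,
      α.τP_prodT]

/-- Postcomposition of a medial linear transformation with a medial linear functor. -/
def whiskerRight {F G : MedialFunctor C D} (α : MedialTrans F G) (H : MedialFunctor D E) :
    MedialTrans (F.comp H) (G.comp H) where
  toLinTrans := α.toLinTrans.whiskerRight H.toLinFunctor
  τT_unitP := by
    simp only [LinTrans.whiskerRight, MedialFunctor.comp, LinFunctor.comp, Lax.comp,
      Functor.whiskerRight_app, Category.assoc, ← H.FT.map_comp, α.τT_unitP]
  τT_prodP A B := by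
    simp only [LinTrans.whiskerRight, MedialFunctor.comp, LinFunctor.comp, Lax.comp,
      Functor.comp_obj, Functor.whiskerRight_app, Category.assoc, reassoc_of% H.laxP.natural]
    simp only [← H.FT.map_comp, α.τT_prodP]
  τP_unitT := by
    simp only [LinTrans.whiskerRight, MedialFunctor.comp, LinFunctor.comp, Oplax.comp,
      Functor.whiskerRight_app, ← H.FP.map_comp_assoc, α.τP_unitT]
  τP_prodT A B := by
    simp only [LinTrans.whiskerRight, MedialFunctor.comp, LinFunctor.comp, Oplax.comp,
      Functor.comp_obj, Functor.whiskerRight_app, Category.assoc, ← H.oplaxT.natural]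
    simp only [← H.FP.map_comp_assoc, α.τP_prodT]

end MedialTrans

end Composition

section Bicategories

open SymMon

section

variable {C : Type u₁} [Category.{v₁} C] {D : Type u₂} [Category.{v₂} D] 

instance [SLDC C] [SLDC D] : Category (LinFunctor C D) where
  Hom F G := LinTrans F G
  id F := LinTrans.id F
  comp α β := α.vcomp β
  id_comp α := LinTrans.ext (Category.id_comp α.τT) (Category.comp_id α.τP)
  comp_id α := LinTrans.ext (Category.comp_id α.τT) (Category.id_comp α.τP)
  assoc α β γ := LinTrans.ext (Category.assoc α.τT β.τT γ.τT)
    (Category.assoc γ.τP β.τP α.τP).symm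

instance [SMLDC C] [SMLDC D] : Category (MedialFunctor C D) where
  Hom F G := MedialTrans F G
  id F := MedialTrans.id F
  comp α β := α.vcomp β
  id_comp α := MedialTrans.ext (Category.id_comp α.τT) (Category.comp_id α.τP)
  comp_id α := MedialTrans.ext (Category.comp_id α.τT) (Category.id_comp α.τP)
  assoc α β γ := MedialTrans.ext (Category.assoc α.τT β.τT γ.τT)
    (Category.assoc γ.τP β.τP α.τP).symm

theorem LinTrans.eqToHom_τT [SLDC C] [SLDC D] {F G : LinFunctor C D} (h : F = G) :
    LinTrans.τT (eqToHom h) = eqToHom (congrArg LinFunctor.FT h) := by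
  subst h
  rfl

theorem LinTrans.eqToHom_τP [SLDC C] [SLDC D] {F G : LinFunctor C D} (h : F = G) :
    LinTrans.τP (eqToHom h) = eqToHom (congrArg LinFunctor.FP h.symm) := by
  subst h
  rfl

theorem MedialTrans.eqToHom_toLinTrans [SMLDC C] [SMLDC D] {F G : MedialFunctor C D} (h : F = G) :
    MedialTrans.toLinTrans (eqToHom h) = eqToHom (congrArg MedialFunctor.toLinFunctor h) := by
  subst h
  rfl

end

namespace LinFunctor

variable {C : Type u₁} [Category.{v₁} C] [SLDC C] {D : Type u₂} [Category.{v₂} D] [SLDC D]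
  {E : Type u₃} [Category.{v₃} E] [SLDC E] {E' : Type u} [Category.{v} E'] [SLDC E']

theorem id_comp (F : LinFunctor C D) : (LinFunctor.id C).comp F = F :=
  LinFunctor.ext rfl rfl
    (heq_of_eq (Strong.ext' (by simp [comp, id, Strong.comp, Strong.id, Lax.comp, Lax.id])
      (fun A B => by simp [comp, id, Strong.comp, Strong.id, Lax.comp, Lax.id])))
    (heq_of_eq (Strong.ext' (by simp [comp, id, Strong.comp, Strong.id, Lax.comp, Lax.id])
      (fun A B => by simp [comp, id, Strong.comp, Strong.id, Lax.comp, Lax.id])))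
    (heq_of_eq (by funext A B; simp [comp, id]))
    (heq_of_eq (by funext A B; simp [comp, id]))
    (heq_of_eq (by funext A B; simp [comp, id]))
    (heq_of_eq (by funext A B; simp [comp, id]))

theorem comp_id (F : LinFunctor C D) : F.comp (LinFunctor.id D) = F :=
  LinFunctor.ext rfl rfl
    (heq_of_eq (Strong.ext' (by simp [comp, id, Strong.comp, Strong.id, Lax.comp, Lax.id])
      (fun A B => by simp [comp, id, Strong.comp, Strong.id, Lax.comp, Lax.id])))
    (heq_of_eq (Strong.ext' (by simp [comp, id, Strong.comp, Strong.id, Lax.comp, Lax.id])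
      (fun A B => by simp [comp, id, Strong.comp, Strong.id, Lax.comp, Lax.id])))
    (heq_of_eq (by funext A B; simp [comp, id]))
    (heq_of_eq (by funext A B; simp [comp, id]))
    (heq_of_eq (by funext A B; simp [comp, id]))
    (heq_of_eq (by funext A B; simp [comp, id]))

theorem comp_assoc (F : LinFunctor C D) (G : LinFunctor D E) (H : LinFunctor E E') :
    (F.comp G).comp H = F.comp (G.comp H) :=
  LinFunctor.ext rfl rfl
    (heq_of_eq (Strong.ext' (by simp [comp, Strong.comp, Lax.comp])
      (fun A B => by simp [comp, Strong.comp, Lax.comp])))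
    (heq_of_eq (Strong.ext' (by simp [comp, Strong.comp, Lax.comp])
      (fun A B => by simp [comp, Strong.comp, Lax.comp])))
    (heq_of_eq (by funext A B; simp [comp]))
    (heq_of_eq (by funext A B; simp [comp]))
    (heq_of_eq (by funext A B; simp [comp]))
    (heq_of_eq (by funext A B; simp [comp]))

end LinFunctor

namespace MedialFunctor

variable {C : Type u₁} [Category.{v₁} C] [SMLDC C] {D : Type u₂} [Category.{v₂} D] [SMLDC D]
  {E : Type u₃} [Category.{v₃} E] [SMLDC E] {E' : Type u} [Category.{v} E'] [SMLDC E']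

theorem ext' {F G : MedialFunctor C D} (h : F.toLinFunctor = G.toLinFunctor)
    (h₁ : HEq F.laxP G.laxP) (h₂ : HEq F.oplaxT G.oplaxT) : F = G := by
  cases F
  cases G
  obtain rfl := h
  obtain rfl := eq_of_heq h₁
  obtain rfl := eq_of_heq h₂
  rfl

theorem id_comp (F : MedialFunctor C D) : (MedialFunctor.id C).comp F = F :=
  ext' (LinFunctor.id_comp _)
    (heq_of_eq (Lax.ext' (by simp [comp, id, LinFunctor.comp, LinFunctor.id, Lax.comp, Lax.id])
      (fun A B => by simp [comp, id, LinFunctor.comp, LinFunctor.id, Lax.comp, Lax.id])))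
    (heq_of_eq (Oplax.ext'
      (by simp [comp, id, LinFunctor.comp, LinFunctor.id, Oplax.comp, Oplax.id])
      (fun A B => by simp [comp, id, LinFunctor.comp, LinFunctor.id, Oplax.comp, Oplax.id])))

theorem comp_id (F : MedialFunctor C D) : F.comp (MedialFunctor.id D) = F :=
  ext' (LinFunctor.comp_id _)
    (heq_of_eq (Lax.ext' (by simp [comp, id, LinFunctor.comp, LinFunctor.id, Lax.comp, Lax.id])
      (fun A B => by simp [comp, id, LinFunctor.comp, LinFunctor.id, Lax.comp, Lax.id])))
    (heq_of_eq (Oplax.ext'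
      (by simp [comp, id, LinFunctor.comp, LinFunctor.id, Oplax.comp, Oplax.id])
      (fun A B => by simp [comp, id, LinFunctor.comp, LinFunctor.id, Oplax.comp, Oplax.id])))

theorem comp_assoc (F : MedialFunctor C D) (G : MedialFunctor D E) (H : MedialFunctor E E') :
    (F.comp G).comp H = F.comp (G.comp H) :=
  ext' (LinFunctor.comp_assoc _ _ _)
    (heq_of_eq (Lax.ext' (by simp [comp, LinFunctor.comp, Lax.comp])
      (fun A B => by simp [comp, LinFunctor.comp, Lax.comp])))
    (heq_of_eq (Oplax.ext' (by simp [comp, LinFunctor.comp, Oplax.comp])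
      (fun A B => by simp [comp, LinFunctor.comp, Oplax.comp])))

end MedialFunctor

section

variable {C : Type u₁} [Category.{v₁} C] {D : Type u₂} [Category.{v₂} D]

/-- The isomorphism given by an equality of linear functors, with prescribed components. -/
def LinFunctor.isoOfEq [SLDC C] [SLDC D] {F G : LinFunctor C D} (h : F = G)
    (a : F.FT ⟶ G.FT) (b : G.FP ⟶ F.FP) (a' : G.FT ⟶ F.FT) (b' : F.FP ⟶ G.FP)
    (ha : a = eqToHom (congrArg LinFunctor.FT h))
    (hb : b = eqToHom (congrArg LinFunctor.FP h.symm))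
    (ha' : a' = eqToHom (congrArg LinFunctor.FT h.symm))
    (hb' : b' = eqToHom (congrArg LinFunctor.FP h)) : F ≅ G where
  hom := LinTrans.mk a b (by subst h ha hb; exact (LinTrans.id F).τT_unit)
    (by subst h ha hb; exact (LinTrans.id F).τT_prod)
    (by subst h ha hb; exact (LinTrans.id F).τP_unit)
    (by subst h ha hb; exact (LinTrans.id F).τP_prod)
    (by subst h ha hb; exact (LinTrans.id F).τ_vRT)
    (by subst h ha hb; exact (LinTrans.id F).τ_vLT)
    (by subst h ha hb; exact (LinTrans.id F).τ_vLP)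
    (by subst h ha hb; exact (LinTrans.id F).τ_vRP)
  inv := LinTrans.mk a' b' (by subst h ha' hb'; exact (LinTrans.id F).τT_unit)
    (by subst h ha' hb'; exact (LinTrans.id F).τT_prod)
    (by subst h ha' hb'; exact (LinTrans.id F).τP_unit)
    (by subst h ha' hb'; exact (LinTrans.id F).τP_prod)
    (by subst h ha' hb'; exact (LinTrans.id F).τ_vRT)
    (by subst h ha' hb'; exact (LinTrans.id F).τ_vLT)
    (by subst h ha' hb'; exact (LinTrans.id F).τ_vLP)
    (by subst h ha' hb'; exact (LinTrans.id F).τ_vRP)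
  hom_inv_id := by
    subst h ha hb ha' hb'
    exact LinTrans.ext (Category.id_comp _) (Category.id_comp _)
  inv_hom_id := by
    subst h ha hb ha' hb'
    exact LinTrans.ext (Category.id_comp _) (Category.id_comp _)

theorem LinFunctor.isoOfEq_eq [SLDC C] [SLDC D] {F G : LinFunctor C D} (h : F = G)
    (a : F.FT ⟶ G.FT) (b : G.FP ⟶ F.FP) (a' : G.FT ⟶ F.FT) (b' : F.FP ⟶ G.FP)
    (ha : a = eqToHom (congrArg LinFunctor.FT h))
    (hb : b = eqToHom (congrArg LinFunctor.FP h.symm))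
    (ha' : a' = eqToHom (congrArg LinFunctor.FT h.symm))
    (hb' : b' = eqToHom (congrArg LinFunctor.FP h)) :
    LinFunctor.isoOfEq h a b a' b' ha hb ha' hb' = eqToIso h := by
  subst h ha hb ha' hb'
  rfl

/-- The isomorphism given by an equality of medial linear functors, with prescribed components. -/
def MedialFunctor.isoOfEq [SMLDC C] [SMLDC D] {F G : MedialFunctor C D} (h : F = G)
    (a : F.FT ⟶ G.FT) (b : G.FP ⟶ F.FP) (a' : G.FT ⟶ F.FT) (b' : F.FP ⟶ G.FP)
    (ha : a = eqToHom (congrArg (fun H : MedialFunctor C D => H.FT) h))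
    (hb : b = eqToHom (congrArg (fun H : MedialFunctor C D => H.FP) h.symm))
    (ha' : a' = eqToHom (congrArg (fun H : MedialFunctor C D => H.FT) h.symm))
    (hb' : b' = eqToHom (congrArg (fun H : MedialFunctor C D => H.FP) h)) : F ≅ G where
  hom := MedialTrans.mk (LinFunctor.isoOfEq (congrArg MedialFunctor.toLinFunctor h) a b a' b' ha hb
      ha' hb').hom
    (by subst h ha hb; exact (MedialTrans.id F).τT_unitP)
    (by subst h ha hb; exact (MedialTrans.id F).τT_prodP)
    (by subst h ha hb; exact (MedialTrans.id F).τP_unitT)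
    (by subst h ha hb; exact (MedialTrans.id F).τP_prodT)
  inv := MedialTrans.mk (LinFunctor.isoOfEq (congrArg MedialFunctor.toLinFunctor h) a b a' b' ha hb
      ha' hb').inv
    (by subst h ha' hb'; exact (MedialTrans.id F).τT_unitP)
    (by subst h ha' hb'; exact (MedialTrans.id F).τT_prodP)
    (by subst h ha' hb'; exact (MedialTrans.id F).τP_unitT)
    (by subst h ha' hb'; exact (MedialTrans.id F).τP_prodT)
  hom_inv_id := by
    subst h ha hb ha' hb'
    exact MedialTrans.ext (Category.id_comp _) (Category.id_comp _)
  inv_hom_id := by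
    subst h ha hb ha' hb'
    exact MedialTrans.ext (Category.id_comp _) (Category.id_comp _)

theorem MedialFunctor.isoOfEq_eq [SMLDC C] [SMLDC D] {F G : MedialFunctor C D} (h : F = G)
    (a : F.FT ⟶ G.FT) (b : G.FP ⟶ F.FP) (a' : G.FT ⟶ F.FT) (b' : F.FP ⟶ G.FP)
    (ha : a = eqToHom (congrArg (fun H : MedialFunctor C D => H.FT) h))
    (hb : b = eqToHom (congrArg (fun H : MedialFunctor C D => H.FP) h.symm))
    (ha' : a' = eqToHom (congrArg (fun H : MedialFunctor C D => H.FT) h.symm))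
    (hb' : b' = eqToHom (congrArg (fun H : MedialFunctor C D => H.FP) h)) :
    MedialFunctor.isoOfEq h a b a' b' ha hb ha' hb' = eqToIso h := by
  subst h ha hb ha' hb'
  rfl

end

/-- The objects of the 2-category of cartesian linearly distributive categories. -/
structure CLDCat where
  carrier : Type u
  [cat : Category.{v} carrier]
  [str : CLDC carrier]

/-- The objects of the 2-category of symmetric medial linearly distributive categories. -/
structure SMLDCat where
  carrier : Type u
  [cat : Category.{v} carrier]
  [str : SMLDC carrier]

attribute [instance] CLDCat.cat CLDCat.str SMLDCat.cat SMLDCat.str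

/-- The 2-category of cartesian linearly distributive categories, (strong symmetric) linear
functors and linear transformations. -/
instance : Bicategory CLDCat.{v, u} where
  Hom X Y := LinFunctor X.carrier Y.carrier
  id X := LinFunctor.id X.carrier
  comp F G := F.comp G
  whiskerLeft F _ _ α := LinTrans.whiskerLeft F α
  whiskerRight α H := LinTrans.whiskerRight α H
  associator F G H := LinFunctor.isoOfEq (LinFunctor.comp_assoc F G H)
    (𝟙 (F.FT ⋙ G.FT ⋙ H.FT)) (𝟙 (F.FP ⋙ G.FP ⋙ H.FP)) (𝟙 (F.FT ⋙ G.FT ⋙ H.FT))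
    (𝟙 (F.FP ⋙ G.FP ⋙ H.FP)) rfl rfl rfl rfl
  leftUnitor F := LinFunctor.isoOfEq (LinFunctor.id_comp F)
    (𝟙 F.FT) (𝟙 F.FP) (𝟙 F.FT) (𝟙 F.FP) rfl rfl rfl rfl
  rightUnitor F := LinFunctor.isoOfEq (LinFunctor.comp_id F)
    (𝟙 F.FT) (𝟙 F.FP) (𝟙 F.FT) (𝟙 F.FP) rfl rfl rfl rfl
  whiskerLeft_id _ _ := rfl
  whiskerLeft_comp _ _ _ _ _ _ := rfl
  id_whiskerLeft _ := LinTrans.ext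
    (NatTrans.ext (funext fun _ => ((Category.id_comp _).trans (Category.comp_id _)).symm))
    (NatTrans.ext (funext fun _ =>
      ((Category.assoc _ _ _).trans ((Category.id_comp _).trans (Category.comp_id _))).symm))
  comp_whiskerLeft _ _ _ _ _ := LinTrans.ext
    (NatTrans.ext (funext fun _ => ((Category.id_comp _).trans (Category.comp_id _)).symm))
    (NatTrans.ext (funext fun _ =>
      ((Category.assoc _ _ _).trans ((Category.id_comp _).trans (Category.comp_id _))).symm))
  id_whiskerRight _ H := LinTrans.ext (NatTrans.ext (funext fun _ => H.FT.map_id _))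
    (NatTrans.ext (funext fun _ => H.FP.map_id _))
  comp_whiskerRight _ _ H := LinTrans.ext (NatTrans.ext (funext fun _ => H.FT.map_comp _ _))
    (NatTrans.ext (funext fun _ => H.FP.map_comp _ _))
  whiskerRight_id _ := LinTrans.ext
    (NatTrans.ext (funext fun _ => ((Category.id_comp _).trans (Category.comp_id _)).symm))
    (NatTrans.ext (funext fun _ =>
      ((Category.assoc _ _ _).trans ((Category.id_comp _).trans (Category.comp_id _))).symm))
  whiskerRight_comp _ _ _ := LinTrans.ext
    (NatTrans.ext (funext fun _ => ((Category.id_comp _).trans (Category.comp_id _)).symm))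
    (NatTrans.ext (funext fun _ =>
      ((Category.assoc _ _ _).trans ((Category.id_comp _).trans (Category.comp_id _))).symm))
  whisker_assoc _ _ _ _ _ := LinTrans.ext
    (NatTrans.ext (funext fun _ => ((Category.id_comp _).trans (Category.comp_id _)).symm))
    (NatTrans.ext (funext fun _ =>
      ((Category.assoc _ _ _).trans ((Category.id_comp _).trans (Category.comp_id _))).symm))
  whisker_exchange _ β := LinTrans.ext
    (NatTrans.ext (funext fun _ => ((LinTrans.τT β).naturality _).symm))
    (NatTrans.ext (funext fun _ => ((LinTrans.τP β).naturality _)))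
  pentagon F G H I := by
    refine LinTrans.ext (NatTrans.ext (funext fun A => ?_)) (NatTrans.ext (funext fun A => ?_))
    · have e := I.FT.map_id (H.FT.obj (G.FT.obj (F.FT.obj A)))
      exact (congrArg (· ≫ 𝟙 _ ≫ 𝟙 _) e).trans (Category.id_comp _)
    · have e := I.FP.map_id (H.FP.obj (G.FP.obj (F.FP.obj A)))
      exact (congrArg ((𝟙 _ ≫ 𝟙 _) ≫ ·) e).trans (Category.comp_id _)
  triangle _ G := LinTrans.ext
    (NatTrans.ext (funext fun _ => (Category.id_comp _).trans (G.FT.map_id _).symm))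
    (NatTrans.ext (funext fun _ => (Category.id_comp _).trans (G.FP.map_id _).symm))

instance : Bicategory.Strict CLDCat.{v, u} where
  id_comp F := LinFunctor.id_comp F
  comp_id F := LinFunctor.comp_id F
  assoc F G H := LinFunctor.comp_assoc F G H
  leftUnitor_eqToIso _ := LinFunctor.isoOfEq_eq _ _ _ _ _ _ _ _ _
  rightUnitor_eqToIso _ := LinFunctor.isoOfEq_eq _ _ _ _ _ _ _ _ _
  associator_eqToIso _ _ _ := LinFunctor.isoOfEq_eq _ _ _ _ _ _ _ _ _

/-- The 2-category of symmetric medial linearly distributive categories, (strong symmetric) medial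
linear functors and medial linear transformations. -/
instance : Bicategory SMLDCat.{v, u} where
  Hom X Y := MedialFunctor X.carrier Y.carrier
  id X := MedialFunctor.id X.carrier
  comp F G := F.comp G
  whiskerLeft F _ _ α := MedialTrans.whiskerLeft F α
  whiskerRight α H := MedialTrans.whiskerRight α H
  associator F G H := MedialFunctor.isoOfEq (MedialFunctor.comp_assoc F G H)
    (𝟙 (F.FT ⋙ G.FT ⋙ H.FT)) (𝟙 (F.FP ⋙ G.FP ⋙ H.FP)) (𝟙 (F.FT ⋙ G.FT ⋙ H.FT))
    (𝟙 (F.FP ⋙ G.FP ⋙ H.FP)) rfl rfl rfl rfl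
  leftUnitor F := MedialFunctor.isoOfEq (MedialFunctor.id_comp F)
    (𝟙 F.FT) (𝟙 F.FP) (𝟙 F.FT) (𝟙 F.FP) rfl rfl rfl rfl
  rightUnitor F := MedialFunctor.isoOfEq (MedialFunctor.comp_id F)
    (𝟙 F.FT) (𝟙 F.FP) (𝟙 F.FT) (𝟙 F.FP) rfl rfl rfl rfl
  whiskerLeft_id _ _ := rfl
  whiskerLeft_comp _ _ _ _ _ _ := rfl
  id_whiskerLeft _ := MedialTrans.ext
    (NatTrans.ext (funext fun _ => ((Category.id_comp _).trans (Category.comp_id _)).symm))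
    (NatTrans.ext (funext fun _ =>
      ((Category.assoc _ _ _).trans ((Category.id_comp _).trans (Category.comp_id _))).symm))
  comp_whiskerLeft _ _ _ _ _ := MedialTrans.ext
    (NatTrans.ext (funext fun _ => ((Category.id_comp _).trans (Category.comp_id _)).symm))
    (NatTrans.ext (funext fun _ =>
      ((Category.assoc _ _ _).trans ((Category.id_comp _).trans (Category.comp_id _))).symm))
  id_whiskerRight _ H := MedialTrans.ext (NatTrans.ext (funext fun _ => H.FT.map_id _))
    (NatTrans.ext (funext fun _ => H.FP.map_id _))
  comp_whiskerRight _ _ H := MedialTrans.ext (NatTrans.ext (funext fun _ => H.FT.map_comp _ _))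
    (NatTrans.ext (funext fun _ => H.FP.map_comp _ _))
  whiskerRight_id _ := MedialTrans.ext
    (NatTrans.ext (funext fun _ => ((Category.id_comp _).trans (Category.comp_id _)).symm))
    (NatTrans.ext (funext fun _ =>
      ((Category.assoc _ _ _).trans ((Category.id_comp _).trans (Category.comp_id _))).symm))
  whiskerRight_comp _ _ _ := MedialTrans.ext
    (NatTrans.ext (funext fun _ => ((Category.id_comp _).trans (Category.comp_id _)).symm))
    (NatTrans.ext (funext fun _ =>
      ((Category.assoc _ _ _).trans ((Category.id_comp _).trans (Category.comp_id _))).symm))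
  whisker_assoc _ _ _ _ _ := MedialTrans.ext
    (NatTrans.ext (funext fun _ => ((Category.id_comp _).trans (Category.comp_id _)).symm))
    (NatTrans.ext (funext fun _ =>
      ((Category.assoc _ _ _).trans ((Category.id_comp _).trans (Category.comp_id _))).symm))
  whisker_exchange _ β := MedialTrans.ext
    (NatTrans.ext (funext fun _ => ((MedialTrans.toLinTrans β).τT.naturality _).symm))
    (NatTrans.ext (funext fun _ => ((MedialTrans.toLinTrans β).τP.naturality _)))
  pentagon F G H I := by
    refine MedialTrans.ext (NatTrans.ext (funext fun A => ?_)) (NatTrans.ext (funext fun A => ?_))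
    · have e := I.FT.map_id (H.FT.obj (G.FT.obj (F.FT.obj A)))
      exact (congrArg (· ≫ 𝟙 _ ≫ 𝟙 _) e).trans (Category.id_comp _)
    · have e := I.FP.map_id (H.FP.obj (G.FP.obj (F.FP.obj A)))
      exact (congrArg ((𝟙 _ ≫ 𝟙 _) ≫ ·) e).trans (Category.comp_id _)
  triangle _ G := MedialTrans.ext
    (NatTrans.ext (funext fun _ => (Category.id_comp _).trans (G.FT.map_id _).symm))
    (NatTrans.ext (funext fun _ => (Category.id_comp _).trans (G.FP.map_id _).symm))

instance : Bicategory.Strict SMLDCat.{v, u} where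
  id_comp F := MedialFunctor.id_comp F
  comp_id F := MedialFunctor.comp_id F
  assoc F G H := MedialFunctor.comp_assoc F G H
  leftUnitor_eqToIso _ := MedialFunctor.isoOfEq_eq _ _ _ _ _ _ _ _ _
  rightUnitor_eqToIso _ := MedialFunctor.isoOfEq_eq _ _ _ _ _ _ _ _ _
  associator_eqToIso _ _ _ := MedialFunctor.isoOfEq_eq _ _ _ _ _ _ _ _ _

end Bicategories

section Bimonoids

/-- The data of a medial bimonoid: an object with maps `Δ`, `e`, `∇`, `u`. -/
structure MedBimonData (C : Type u) [Category.{v} C] [SMLDC C] where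
  X : C
  Δ : X ⟶ X ⨂ X
  e : X ⟶ ⊤[C]
  nab : X ⅋ X ⟶ X
  u : ⊥[C] ⟶ X

/-- Bicommutative medial bimonoids. -/
structure MedBimon (C : Type u) [Category.{v} C] [SMLDC C] extends MedBimonData C where
  comonoid : (T : SymMon C).IsCocommComonoid Δ e
  monoid : (P : SymMon C).IsCommMonoid nab u
  nab_Δ : nab ≫ Δ = (Δ ⅋ₘ Δ) ≫ med X X X X ≫ (nab ⨂ₘ nab)
  u_e : u ≫ e = mix
  nab_e : nab ≫ e = (e ⅋ₘ e) ≫ nabTop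
  u_Δ : u ≫ Δ = Δbot ≫ (u ⨂ₘ u)

variable {C : Type u₁} [Category.{v₁} C] [SMLDC C] {D : Type u₂} [Category.{v₂} D] [SMLDC D]

/-- Morphisms of medial bimonoids. -/
@[ext]
structure MedBimon.Hom (A B : MedBimon C) where
  hom : A.X ⟶ B.X
  hom_Δ : hom ≫ B.Δ = A.Δ ≫ (hom ⨂ₘ hom)
  hom_e : hom ≫ B.e = A.e
  nab_hom : A.nab ≫ hom = (hom ⅋ₘ hom) ≫ B.nab
  u_hom : A.u ≫ hom = B.u

/-- The category `B[C]` of bicommutative medial bimonoids. -/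
instance : Category (MedBimon C) where
  Hom := MedBimon.Hom
  id A :=
    { hom := 𝟙 A.X
      hom_Δ := by simp [SymMon.hom_id]
      hom_e := by simp
      nab_hom := by simp [SymMon.hom_id]
      u_hom := by simp }
  comp f g :=
    { hom := f.hom ≫ g.hom
      hom_Δ := by rw [Category.assoc, g.hom_Δ, reassoc_of% f.hom_Δ, SymMon.hom_comp]
      hom_e := by rw [Category.assoc, g.hom_e, f.hom_e]
      nab_hom := by rw [reassoc_of% f.nab_hom, g.nab_hom, SymMon.hom_comp, Category.assoc]
      u_hom := by rw [reassoc_of% f.u_hom, g.u_hom] }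
  id_comp f := MedBimon.Hom.ext (Category.id_comp f.hom)
  comp_id f := MedBimon.Hom.ext (Category.comp_id f.hom)
  assoc f g h := MedBimon.Hom.ext (Category.assoc f.hom g.hom h.hom)

namespace MedBimonData

variable (C) in
/-- The medial bimonoid structure on the tensor unit. -/
def top : MedBimonData C where
  X := ⊤[C]
  Δ := (rT ⊤[C]).hom
  e := 𝟙 _
  nab := nabTop
  u := mix

variable (C) in
/-- The medial bimonoid structure on the par unit. -/
def bot : MedBimonData C where
  X := ⊥[C]
  Δ := Δbot
  e := mix
  nab := (rP ⊥[C]).hom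
  u := 𝟙 _

/-- The tensor of medial bimonoids. -/
def ten (A B : MedBimonData C) : MedBimonData C where
  X := A.X ⨂ B.X
  Δ := (A.Δ ⨂ₘ B.Δ) ≫ (T : SymMon C).flip A.X A.X B.X B.X
  e := (A.e ⨂ₘ B.e) ≫ (rT ⊤[C]).inv
  nab := med A.X B.X A.X B.X ≫ (A.nab ⨂ₘ B.nab)
  u := Δbot ≫ (A.u ⨂ₘ B.u)

/-- The par of medial bimonoids. -/
def par (A B : MedBimonData C) : MedBimonData C where
  X := A.X ⅋ B.X
  Δ := (A.Δ ⅋ₘ B.Δ) ≫ med A.X A.X B.X B.X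
  e := (A.e ⅋ₘ B.e) ≫ nabTop
  nab := (P : SymMon C).flip A.X B.X A.X B.X ≫ (A.nab ⅋ₘ B.nab)
  u := (rP ⊥[C]).inv ≫ (A.u ⅋ₘ B.u)

/-- The image of a medial bimonoid under the tensor component of a medial linear functor. -/
def mapT (F : MedialFunctor C D) (A : MedBimonData C) : MedBimonData D where
  X := F.FT.obj A.X
  Δ := F.FT.map A.Δ ≫ F.strT.prodInv A.X A.X
  e := F.FT.map A.e ≫ F.strT.unitInv
  nab := F.laxP.prodMap A.X A.X ≫ F.FT.map A.nab
  u := F.laxP.unitMap ≫ F.FT.map A.u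

/-- The image of a medial bimonoid under the par component of a medial linear functor. -/
def mapP (F : MedialFunctor C D) (A : MedBimonData C) : MedBimonData D where
  X := F.FP.obj A.X
  Δ := F.FP.map A.Δ ≫ F.oplaxT.prodMap A.X A.X
  e := F.FP.map A.e ≫ F.oplaxT.unitMap
  nab := F.strP.prodMap A.X A.X ≫ F.FP.map A.nab
  u := F.strP.unitMap ≫ F.FP.map A.u

end MedBimonData

/-- `LiesOver f g`: the underlying morphism of the bimonoid morphism `f` is `g` (in particular
the objects underlying the source and target of `f` are those of `g`). -/
inductive LiesOver {A B : MedBimon C} (f : A ⟶ B) : ∀ {X Y : C}, (X ⟶ Y) → Prop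
  | intro : LiesOver f (MedBimon.Hom.hom f)

variable (C) in
/-- A linearly distributive structure on `B[C]` is the one inherited from `C`: units, tensors and
pars are those of medial bimonoids, and all structure morphisms are those of `C`. -/
structure IsBimonSLDC [SLDC (MedBimon C)] : Prop where
  top : (⊤[MedBimon C]).toMedBimonData = MedBimonData.top C
  bot : (⊥[MedBimon C]).toMedBimonData = MedBimonData.bot C
  ten (A B : MedBimon C) : (A ⨂ B).toMedBimonData = A.toMedBimonData.ten B.toMedBimonData
  par (A B : MedBimon C) : (A ⅋ B).toMedBimonData = A.toMedBimonData.par B.toMedBimonData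
  ten_hom {A A' B B' : MedBimon C} (f : A ⟶ A') (g : B ⟶ B') :
    LiesOver (f ⨂ₘ g) (MedBimon.Hom.hom f ⨂ₘ MedBimon.Hom.hom g)
  par_hom {A A' B B' : MedBimon C} (f : A ⟶ A') (g : B ⟶ B') :
    LiesOver (f ⅋ₘ g) (MedBimon.Hom.hom f ⅋ₘ MedBimon.Hom.hom g)
  αT_over (A B E : MedBimon C) : LiesOver (αT A B E).hom (αT A.X B.X E.X).hom
  lT_over (A : MedBimon C) : LiesOver (lT A).hom (lT A.X).hom
  rT_over (A : MedBimon C) : LiesOver (rT A).hom (rT A.X).hom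
  σT_over (A B : MedBimon C) : LiesOver (σT A B).hom (σT A.X B.X).hom
  αP_over (A B E : MedBimon C) : LiesOver (αP A B E).hom (αP A.X B.X E.X).hom
  lP_over (A : MedBimon C) : LiesOver (lP A).hom (lP A.X).hom
  rP_over (A : MedBimon C) : LiesOver (rP A).hom (rP A.X).hom
  σP_over (A B : MedBimon C) : LiesOver (σP A B).hom (σP A.X B.X).hom
  δL_over (A B E : MedBimon C) : LiesOver (δL A B E) (δL A.X B.X E.X)
  δR_over (A B E : MedBimon C) : LiesOver (δR A B E) (δR A.X B.X E.X)

/-- A linear functor `G` between categories of medial bimonoids is `B[F]`. -/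
structure IsBimonFunctor [SLDC (MedBimon C)] [SLDC (MedBimon D)] (F : MedialFunctor C D)
    (G : LinFunctor (MedBimon C) (MedBimon D)) : Prop where
  objT (A : MedBimon C) : (G.FT.obj A).toMedBimonData = A.toMedBimonData.mapT F
  objP (A : MedBimon C) : (G.FP.obj A).toMedBimonData = A.toMedBimonData.mapP F
  mapT {A B : MedBimon C} (f : A ⟶ B) : LiesOver (G.FT.map f) (F.FT.map (MedBimon.Hom.hom f))
  mapP {A B : MedBimon C} (f : A ⟶ B) : LiesOver (G.FP.map f) (F.FP.map (MedBimon.Hom.hom f))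
  unitT : LiesOver G.strT.unitMap F.strT.unitMap
  prodT (A B : MedBimon C) : LiesOver (G.strT.prodMap A B) (F.strT.prodMap A.X B.X)
  unitP : LiesOver G.strP.unitInv F.strP.unitInv
  prodP (A B : MedBimon C) : LiesOver (G.strP.prodInv A B) (F.strP.prodInv A.X B.X)
  vRT (A B : MedBimon C) : LiesOver (G.vRT A B) (F.vRT A.X B.X)
  vLT (A B : MedBimon C) : LiesOver (G.vLT A B) (F.vLT A.X B.X)
  vRP (A B : MedBimon C) : LiesOver (G.vRP A B) (F.vRP A.X B.X)
  vLP (A B : MedBimon C) : LiesOver (G.vLP A B) (F.vLP A.X B.X)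

/-- A linear transformation `β` between linear functors on medial bimonoids is `B[α]`. -/
structure IsBimonTrans [SLDC (MedBimon C)] [SLDC (MedBimon D)] {F F' : MedialFunctor C D}
    {G G' : LinFunctor (MedBimon C) (MedBimon D)} (α : MedialTrans F F') (β : LinTrans G G') :
    Prop where
  appT (A : MedBimon C) : LiesOver (β.τT.app A) (α.τT.app A.X)
  appP (A : MedBimon C) : LiesOver (β.τP.app A) (α.τP.app A.X)

/-- `B[X]` with a given cartesian linearly distributive structure, as an object of the
2-category of cartesian linearly distributive categories. -/
abbrev SMLDCat.bimon (X : SMLDCat.{v, u}) (S : CLDC (MedBimon X.carrier)) :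
    CLDCat.{v, max u v} where
  carrier := MedBimon X.carrier
  str := S

end Bimonoids

/-! ### Coherence at the monoidal unit. -/

section Monoidal

open MonoidalCategory

/-! A morphism of bimonoids is determined by its underlying morphism. Hence, once every structure
map of the base category (or of `F`, or of `α`) is known to be a morphism of bimonoids, every
coherence equation upstairs is the corresponding equation downstairs. What remains is to show that
bimonoids are closed under the operations, that the structure maps preserve Δ, e, ∇ and u, that ⊗
and ⊕ have their universal properties, and that the construction is strictly functorial.

Objects. The medial axioms say that ⊗ : C × C ⥤ C is a symmetric lax monoidal functor for ⊕
(`medLax`) and that ⊕ is a symmetric oplax monoidal functor for ⊗ (`medOplax`); each product is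
moreover monoidal and comonoidal for itself through the flip (`tensorLax`, `tensorOplax`). Lax
symmetric functors carry commutative monoids to commutative monoids, and oplax ones carry
cocommutative comonoids to such (`Lax.map_isCommMonoid`, `Oplax.map_isCocommComonoid`). Applied to
pairs of bimonoids this gives the monoid and comonoid laws of A ⊗ B and A ⊕ B; applied to the
components of a medial functor it gives those of F_⊗ A and F_⊕ A. The law relating ∇ and Δ on A ⊗ B
and A ⊕ B comes from the compatibility of μ with the flips (`med_flipT`, `med_flipP`).

Structure maps. For associators, unitors and symmetries the required equations are the coherence of
the functors just listed, together with the (co)monoid laws of ⊤ and ⊥. For δL the two substantial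
equations are `δL_flipT` and `δL_flipP`: a medial axiom treats one of the two factors, its conjugate
by the symmetries treats the other, and the two are glued by the compatibility of δL with
associativity. The linear strengths follow the same pattern (`laxP_flip_vRT`, `vRP_flip_oplaxT`).
The maps δR, v^L_⊗ and v^L_⊕ are composites of these with symmetries.

Universal properties. This is Fox's theorem and its dual. Cocommutativity makes Δ a comonoid
morphism, and the bimonoid laws make Δ and e monoid morphisms, so both live in the category of
bimonoids (`diag`, `counit`). They supply pairings and projections, and the counit laws give
uniqueness (`lift_fst_snd`). Dually, ∇ and u make ⊕ a coproduct and ⊥ initial.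

Strictness. Lying over `F` determines a linear functor between bimonoid categories uniquely, and
lying over `α` determines a linear transformation (`IsBimonFunctor.unique`, `IsBimonTrans.unique`).
Identities, composites and whiskerings are therefore preserved on the nose as soon as both sides are
seen to lie over the same thing. -/

theorem rightUnitor_unit_assoc {C : Type u₁} [Category.{v₁} C] [MonoidalCategory C] :
    (𝟙 (𝟙_ C) ⊗ₘ (ρ_ (𝟙_ C)).hom) ≫ (ρ_ (𝟙_ C)).hom =
    (α_ (𝟙_ C) (𝟙_ C) (𝟙_ C)).inv ≫ ((ρ_ (𝟙_ C)).hom ⊗ₘ 𝟙 (𝟙_ C)) ≫ (ρ_ (𝟙_ C)).hom := by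
  monoidal

end Monoidal

/-! ### The flip (A ⊗ B) ⊗ (X ⊗ Y) → (A ⊗ X) ⊗ (B ⊗ Y) in a symmetric monoidal category. -/

section Symmetric

open MonoidalCategory

variable {C : Type u₁} [Category.{v₁} C] [MonoidalCategory C] [SymmetricCategory C]

theorem tensorμ_eq_slide (A B X Y : C) : tensorμ A B X Y = (α_ A B (X ⊗ Y)).hom ≫
    (𝟙 A ⊗ₘ ((α_ B X Y).inv ≫ ((β_ B X).hom ⊗ₘ 𝟙 Y) ≫ (α_ X B Y).hom)) ≫
      (α_ A X (B ⊗ Y)).inv := by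
  simp [tensorμ]

/-- Expanding the braiding of A ⊗ X past B produces a swap of X and B, which the first factor undoes
by symmetry. Exchanging two neighbours thus becomes a braiding past a whole tensor, the form in
which the symmetry axioms for μ apply. -/
theorem slide_eq_braiding (A B X : C) :
    (α_ A B X).inv ≫ ((β_ A B).hom ⊗ₘ 𝟙 X) ≫ (α_ B A X).hom =
      (𝟙 A ⊗ₘ (β_ B X).hom) ≫ (α_ A X B).inv ≫ (β_ (A ⊗ X) B).hom := by
  simp [BraidedCategory.braiding_tensor_left_hom, ← whiskerLeft_comp_assoc]

theorem tensorμ_eq_exchange (A B X Y : C) : tensorμ A B X Y = (α_ (A ⊗ B) X Y).inv ≫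
    (((β_ (A ⊗ B) X).hom ≫ (α_ X A B).inv ≫ ((β_ X A).hom ⊗ₘ 𝟙 B)) ⊗ₘ 𝟙 Y) ≫
      (α_ (A ⊗ X) B Y).hom := by
  simp [tensorμ, BraidedCategory.braiding_tensor_left_hom,
    SymmetricCategory.braiding_swap_eq_inv_braiding A X]

theorem tensorμ_braiding (A B X Y : C) :
    ((β_ A B).hom ⊗ₘ (β_ X Y).hom) ≫ tensorμ B A Y X =
      tensorμ A B X Y ≫ (β_ (A ⊗ X) (B ⊗ Y)).hom := by
  simp [tensorμ, SymmetricCategory.braiding_swap_eq_inv_braiding B X,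
    MonoidalCategory.tensorHom_def]

theorem tensorμ_braiding_tensor (A B X Y : C) :
    tensorμ A B X Y ≫ ((β_ A X).hom ⊗ₘ (β_ B Y).hom) =
      (β_ (A ⊗ B) (X ⊗ Y)).hom ≫ tensorμ X Y A B := by
  simp [tensorμ, SymmetricCategory.braiding_swap_eq_inv_braiding Y A,
    MonoidalCategory.tensorHom_def]

theorem leftUnitor_inv_tensor (A B : C) :
    ((λ_ A).inv ⊗ₘ (λ_ B).inv) ≫ tensorμ (𝟙_ C) A (𝟙_ C) B ≫ ((ρ_ (𝟙_ C)).hom ⊗ₘ 𝟙 (A ⊗ B)) =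
      (λ_ (A ⊗ B)).inv := by
  rw [← cancel_mono (λ_ (A ⊗ B)).hom, Iso.inv_hom_id, Category.assoc, Category.assoc, tensorHom_id,
    ← unitors_equal, ← leftUnitor_monoidal, tensorHom_comp_tensorHom, Iso.inv_hom_id,
    Iso.inv_hom_id, id_tensorHom_id]

theorem rightUnitor_inv_tensor (A B : C) :
    ((ρ_ A).inv ⊗ₘ (ρ_ B).inv) ≫ tensorμ A (𝟙_ C) B (𝟙_ C) ≫ (𝟙 (A ⊗ B) ⊗ₘ (ρ_ (𝟙_ C)).hom) =
      (ρ_ (A ⊗ B)).inv := by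
  rw [← cancel_mono (ρ_ (A ⊗ B)).hom, Iso.inv_hom_id, Category.assoc, Category.assoc, id_tensorHom,
    ← unitors_equal, ← rightUnitor_monoidal, tensorHom_comp_tensorHom, Iso.inv_hom_id,
    Iso.inv_hom_id, id_tensorHom_id]

end Symmetric

/-! ### Coherence laws for an explicitly given symmetric monoidal structure. -/

section SymMonLemmas

variable {C : Type u₁} [Category.{v₁} C] {D : Type u₂} [Category.{v₂} D]

namespace SymMon

variable (M : SymMon C) (N : SymMon D)

theorem hom_comp_left {A A' A'' B B' : C} (f : A ⟶ A') (f' : A' ⟶ A'') (g : B ⟶ B') :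
    M.hom (f ≫ f') g = M.hom f g ≫ M.hom f' (𝟙 B') := by
  rw [← M.hom_comp, Category.comp_id]

theorem hom_comp_right {A A' B B' B'' : C} (f : A ⟶ A') (g : B ⟶ B') (g' : B' ⟶ B'') :
    M.hom f (g ≫ g') = M.hom f g ≫ M.hom (𝟙 A') g' := by
  rw [← M.hom_comp, Category.comp_id]

theorem comp_hom_left {A A' A'' B B' : C} (f : A ⟶ A') (f' : A' ⟶ A'') (g : B ⟶ B') :
    M.hom (f ≫ f') g = M.hom f (𝟙 B) ≫ M.hom f' g := by
  rw [← M.hom_comp, Category.id_comp]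

theorem comp_hom_right {A A' B B' B'' : C} (f : A ⟶ A') (g : B ⟶ B') (g' : B' ⟶ B'') :
    M.hom f (g ≫ g') = M.hom (𝟙 A) g ≫ M.hom f g' := by
  rw [← M.hom_comp, Category.id_comp]

theorem hom_def {A A' B B' : C} (f : A ⟶ A') (g : B ⟶ B') :
    M.hom f g = M.hom f (𝟙 B) ≫ M.hom (𝟙 A') g := by
  rw [← M.hom_comp, Category.id_comp, Category.comp_id]

theorem hom_def' {A A' B B' : C} (f : A ⟶ A') (g : B ⟶ B') :
    M.hom f g = M.hom (𝟙 A) g ≫ M.hom f (𝟙 B') := by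
  rw [← M.hom_comp, Category.id_comp, Category.comp_id]

theorem assoc_natural {A A' B B' X X' : C} (f : A ⟶ A') (g : B ⟶ B') (h : X ⟶ X') :
    M.hom (M.hom f g) h ≫ (M.assoc A' B' X').hom =
      (M.assoc A B X).hom ≫ M.hom f (M.hom g h) :=
  @MonoidalCategory.associator_naturality C _ M.mon _ _ _ _ _ _ f g h

theorem assoc_inv_natural {A A' B B' X X' : C} (f : A ⟶ A') (g : B ⟶ B') (h : X ⟶ X') :
    M.hom f (M.hom g h) ≫ (M.assoc A' B' X').inv =
      (M.assoc A B X).inv ≫ M.hom (M.hom f g) h :=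
  @MonoidalCategory.associator_inv_naturality C _ M.mon _ _ _ _ _ _ f g h

theorem left_natural {A A' : C} (f : A ⟶ A') :
    M.hom (𝟙 M.unit) f ≫ (M.left A').hom = (M.left A).hom ≫ f := by
  let := M.mon
  exact (congrArg (· ≫ _) (MonoidalCategory.id_tensorHom _ f)).trans
    (MonoidalCategory.leftUnitor_naturality f)

theorem right_natural {A A' : C} (f : A ⟶ A') :
    M.hom f (𝟙 M.unit) ≫ (M.right A').hom = (M.right A).hom ≫ f := by
  let := M.mon
  exact (congrArg (· ≫ _) (MonoidalCategory.tensorHom_id f _)).trans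
    (MonoidalCategory.rightUnitor_naturality f)

theorem left_inv_natural {A A' : C} (f : A ⟶ A') :
    (M.left A).inv ≫ M.hom (𝟙 M.unit) f = f ≫ (M.left A').inv := by
  rw [Iso.inv_comp_eq, ← Category.assoc, Iso.eq_comp_inv, left_natural]

theorem right_inv_natural {A A' : C} (f : A ⟶ A') :
    (M.right A).inv ≫ M.hom f (𝟙 M.unit) = f ≫ (M.right A').inv := by
  rw [Iso.inv_comp_eq, ← Category.assoc, Iso.eq_comp_inv, right_natural]

theorem braid_natural {A A' B B' : C} (f : A ⟶ A') (g : B ⟶ B') :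
    M.hom f g ≫ (M.braid A' B').hom = (M.braid A B).hom ≫ M.hom g f := by
  let := M.mon
  let := M.sym
  exact BraidedCategory.braiding_naturality f g

theorem braid_braid (A B : C) : (M.braid A B).hom ≫ (M.braid B A).hom = 𝟙 _ :=
  @SymmetricCategory.symmetry C _ M.mon M.sym A B

theorem left_unit : M.left M.unit = M.right M.unit :=
  Iso.ext (@MonoidalCategory.unitors_equal C _ M.mon)

theorem braid_left (A : C) : (M.braid A M.unit).hom ≫ (M.left A).hom = (M.right A).hom := by
  let := M.mon
  let := M.sym
  exact braiding_leftUnitor A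

/-- Exchange of the first two factors of `A ⊗ (B ⊗ X)`. -/
def slide (A B X : C) : M.obj A (M.obj B X) ⟶ M.obj B (M.obj A X) :=
  (M.assoc A B X).inv ≫ M.hom (M.braid A B).hom (𝟙 X) ≫ (M.assoc B A X).hom

theorem flip_eq (A B X Y : C) : M.flip A B X Y =
    (M.assoc A B (M.obj X Y)).hom ≫ M.hom (𝟙 A) (M.slide B X Y) ≫
      (M.assoc A X (M.obj B Y)).inv :=
  @tensorμ_eq_slide C _ M.mon M.sym A B X Y

theorem slide_eq_braid (A B X : C) : M.slide A B X =
    M.hom (𝟙 A) (M.braid B X).hom ≫ (M.assoc A X B).inv ≫ (M.braid (M.obj A X) B).hom :=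
  @slide_eq_braiding C _ M.mon M.sym A B X

/-- Exchange of the last two factors of `(A ⊗ B) ⊗ X`. -/
def exchange (A B X : C) : M.obj (M.obj A B) X ⟶ M.obj (M.obj A X) B :=
  (M.braid (M.obj A B) X).hom ≫ (M.assoc X A B).inv ≫ M.hom (M.braid X A).hom (𝟙 B)

theorem flip_eq_exchange (A B X Y : C) : M.flip A B X Y =
    (M.assoc (M.obj A B) X Y).inv ≫ M.hom (M.exchange A B X) (𝟙 Y) ≫
      (M.assoc (M.obj A X) B Y).hom :=
  @tensorμ_eq_exchange C _ M.mon M.sym A B X Y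

theorem pentagon (A B X Y : C) : M.hom (M.assoc A B X).hom (𝟙 Y) ≫
    (M.assoc A (M.obj B X) Y).hom ≫ M.hom (𝟙 A) (M.assoc B X Y).hom =
      (M.assoc (M.obj A B) X Y).hom ≫ (M.assoc A B (M.obj X Y)).hom := by
  let := M.mon
  have e := MonoidalCategory.pentagon A B X Y
  rw [← MonoidalCategory.tensorHom_id, ← MonoidalCategory.id_tensorHom] at e
  exact e

theorem triangle (A B : C) : (M.assoc A M.unit B).hom ≫ M.hom (𝟙 A) (M.left B).hom =
    M.hom (M.right A).hom (𝟙 B) := by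
  let := M.mon
  have e := MonoidalCategory.triangle A B
  rw [← MonoidalCategory.tensorHom_id, ← MonoidalCategory.id_tensorHom] at e
  exact e

theorem hexagon_forward (A B X : C) : (M.assoc A B X).hom ≫ (M.braid A (M.obj B X)).hom ≫
    (M.assoc B X A).hom = M.hom (M.braid A B).hom (𝟙 X) ≫ (M.assoc B A X).hom ≫
      M.hom (𝟙 B) (M.braid A X).hom := by
  let := M.mon
  let := M.sym
  have e := BraidedCategory.hexagon_forward A B X
  rw [← MonoidalCategory.tensorHom_id, ← MonoidalCategory.id_tensorHom] at e
  exact e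

theorem hexagon_reverse (A B X : C) : (M.assoc A B X).inv ≫ (M.braid (M.obj A B) X).hom ≫
    (M.assoc X A B).inv = M.hom (𝟙 A) (M.braid B X).hom ≫ (M.assoc A X B).inv ≫
      M.hom (M.braid A X).hom (𝟙 B) := by
  let := M.mon
  let := M.sym
  have e := BraidedCategory.hexagon_reverse A B X
  rw [← MonoidalCategory.tensorHom_id, ← MonoidalCategory.id_tensorHom] at e
  exact e

theorem slide_eq_braid' (A B X : C) : M.slide A B X =
    (M.braid A (M.obj B X)).hom ≫ (M.assoc B X A).hom ≫ M.hom (𝟙 B) (M.braid X A).hom := by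
  have e := M.hexagon_forward A B X
  rw [← Iso.eq_inv_comp] at e
  rw [slide, reassoc_of% e, ← M.id_hom_comp, M.braid_braid, M.hom_id, Category.comp_id]

theorem braid_unit : (M.braid M.unit M.unit).hom = 𝟙 _ := by
  rw [← cancel_mono (M.left M.unit).hom, M.braid_left, M.left_unit, Category.id_comp]

/-- The only nontrivial ingredient of this flip is the braiding of the unit with itself, which is
the identity. In Fox's argument this is what collapses the flip in the comultiplication of A ⊗ B
once the outer copies have been discarded. -/
theorem flip_unit (A B : C) : M.flip A M.unit M.unit B = 𝟙 _ := by
  rw [flip_eq, slide, braid_unit, hom_id, Category.id_comp, Iso.inv_hom_id, hom_id,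
    Category.id_comp, Iso.hom_inv_id]

theorem flip_natural {A A' B B' X X' Y Y' : C} (f : A ⟶ A') (g : B ⟶ B') (h : X ⟶ X')
    (k : Y ⟶ Y') : M.hom (M.hom f g) (M.hom h k) ≫ M.flip A' B' X' Y' =
      M.flip A B X Y ≫ M.hom (M.hom f h) (M.hom g k) := by
  let := M.mon
  let := M.sym
  exact MonoidalCategory.tensorμ_natural f g h k

theorem flip_braid (A B X Y : C) :
    M.hom (M.braid A B).hom (M.braid X Y).hom ≫ M.flip B A Y X =
      M.flip A B X Y ≫ (M.braid (M.obj A X) (M.obj B Y)).hom :=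
  @tensorμ_braiding C _ M.mon M.sym A B X Y

end SymMon
end SymMonLemmas

/-! ### Monoidal functors, transport of (co)monoids, and the tensor product as a monoidal functor.
-/

section LaxLemmas

open Opposite

variable {C : Type u₁} [Category.{v₁} C] {D : Type u₂} [Category.{v₂} D]

namespace SymMon

/-- The opposite symmetric monoidal structure. -/
def op (M : SymMon C) : SymMon Cᵒᵖ :=
  letI := M.mon
  letI := M.sym
  { mon := inferInstance
    sym := { symmetry := fun X Y => Quiver.Hom.unop_inj
               (SymmetricCategory.symmetry (unop X) (unop Y)) } }

/-- The componentwise symmetric monoidal structure on a product of categories. -/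
def prod (M : SymMon C) (N : SymMon D) : SymMon (C × D) :=
  letI := M.mon
  letI := M.sym
  letI := N.mon
  letI := N.sym
  { mon := inferInstance
    sym :=
      { braiding := fun X Y => Iso.prod (BraidedCategory.braiding X.1 Y.1) (BraidedCategory.braiding X.2 Y.2) } }

/-- The tensor product as a functor of two variables. -/
def tensor (M : SymMon C) : C × C ⥤ C where
  obj X := M.obj X.1 X.2
  map f := M.hom f.1 f.2
  map_id X := M.hom_id X.1 X.2
  map_comp f g := M.hom_comp f.1 g.1 f.2 g.2

variable {M : SymMon C} {N : SymMon D}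

/-- The associator of the opposite structure is the opposite of the inverse associator, so the
comonoid laws become the monoid laws verbatim. Together with the converse, this reduces statements
on comonoids to statements on monoids. -/
theorem IsCocommComonoid.op {A : C} {Δ : A ⟶ M.obj A A} {e : A ⟶ M.unit}
    (h : M.IsCocommComonoid Δ e) : M.op.IsCommMonoid (A := Opposite.op A) Δ.op e.op where
  assoc := Quiver.Hom.unop_inj (h.coassoc.trans (Category.assoc _ _ _).symm)
  unit_right := Quiver.Hom.unop_inj ((Category.assoc _ _ _).trans h.counit_right)
  unit_left := Quiver.Hom.unop_inj ((Category.assoc _ _ _).trans h.counit_left)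
  comm := Quiver.Hom.unop_inj h.cocomm

theorem IsCocommComonoid.of_op {A : C} {Δ : A ⟶ M.obj A A} {e : A ⟶ M.unit}
    (h : M.op.IsCommMonoid (A := Opposite.op A) Δ.op e.op) : M.IsCocommComonoid Δ e where
  coassoc := Quiver.Hom.op_inj (h.assoc.trans (Category.assoc _ _ _).symm)
  counit_right := Quiver.Hom.op_inj ((Category.assoc _ _ _).trans h.unit_right)
  counit_left := Quiver.Hom.op_inj ((Category.assoc _ _ _).trans h.unit_left)
  cocomm := Quiver.Hom.op_inj h.comm

/-- Reversing arrows exchanges source and target of the flip, hence its two middle arguments. -/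
theorem flip_op (A B X Y : C) :
    M.op.flip (Opposite.op A) (Opposite.op B) (Opposite.op X) (Opposite.op Y) =
      (M.flip A X B Y).op :=
  let := M.mon
  let := M.sym
  (BraidedCategory.op_tensorμ A B X Y).symm

/-- A comonoidal structure is a monoidal structure on the opposite functor. -/
def Oplax.op {F : C ⥤ D} (h : M.Oplax N F) : M.op.Lax N.op F.op where
  unitMap := h.unitMap.op
  prodMap A B := (h.prodMap (unop A) (unop B)).op
  natural f g := Quiver.Hom.unop_inj (h.natural f.unop g.unop).symm
  assoc A B X := Quiver.Hom.unop_inj (by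
    -- The associators of `M.op` and `N.op` are inverse to those of `M` and `N`, so the oplax
    -- associativity has to be carried across both of them.
    have e := h.assoc (unop A) (unop B) (unop X)
    change (F.map (M.assoc _ _ _).inv ≫ h.prodMap _ _) ≫ N.hom (h.prodMap _ _) (𝟙 _) =
      (h.prodMap _ _ ≫ N.hom (𝟙 _) (h.prodMap _ _)) ≫ (N.assoc _ _ _).inv
    rw [← cancel_epi (F.map (M.assoc (unop A) (unop B) (unop X)).hom),
      ← Category.assoc _ _ (N.assoc _ _ _).inv, Iso.eq_comp_inv,
      Category.assoc, Category.assoc, Category.assoc, e, ← F.map_comp_assoc, Iso.hom_inv_id,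
      F.map_id, Category.id_comp])
  unit_left A := Quiver.Hom.unop_inj ((Category.assoc _ _ _).trans (h.unit_left (unop A)))
  unit_right A := Quiver.Hom.unop_inj ((Category.assoc _ _ _).trans (h.unit_right (unop A)))
  braided A B := Quiver.Hom.unop_inj (h.braided (unop B) (unop A))

/-- The mate of the structure maps of a strong monoidal functor. -/
def Strong.oplax {F : C ⥤ D} (h : M.Strong N F) : M.Oplax N F where
  unitMap := h.unitInv
  prodMap := h.prodInv
  natural f g := (h.inv_natural f g).symm
  assoc A B X := by
    -- The lax associativity law, solved for the image of the associator; inserting it makes all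
    -- structure maps cancel in pairs.
    have e : F.map (M.assoc A B X).hom = h.prodInv (M.obj A B) X ≫
        N.hom (h.prodInv A B) (𝟙 (F.obj X)) ≫ (N.assoc (F.obj A) (F.obj B) (F.obj X)).hom ≫
          N.hom (𝟙 (F.obj A)) (h.prodMap B X) ≫ h.prodMap A (M.obj B X) := by
      rw [← h.assoc A B X, ← reassoc_of% N.hom_comp, h.prodInv_prodMap, Category.comp_id,
        N.hom_id, Category.id_comp, reassoc_of% h.prodInv_prodMap]
    rw [e]
    simp only [Category.assoc, reassoc_of% h.prodMap_prodInv, ← N.hom_comp, h.prodMap_prodInv,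
      N.hom_id, Category.comp_id]
  unit_left A := by
    rw [← Category.comp_id (N.left _).inv, Iso.eq_inv_comp, ← h.unit_left]
    simp only [Category.assoc, ← F.map_comp_assoc, Iso.hom_inv_id, F.map_id, Category.id_comp,
      reassoc_of% h.prodMap_prodInv, ← N.hom_comp, h.unitMap_unitInv, N.hom_id]
  unit_right A := by
    rw [← Category.comp_id (N.right _).inv, Iso.eq_inv_comp, ← h.unit_right]
    simp only [Category.assoc, ← F.map_comp_assoc, Iso.hom_inv_id, F.map_id, Category.id_comp,
      reassoc_of% h.prodMap_prodInv, ← N.hom_comp, h.unitMap_unitInv, N.hom_id]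
  braided A B := by
    have e : h.prodMap A B ≫ F.map (M.braid A B).hom ≫ h.prodInv B A =
        (N.braid (F.obj A) (F.obj B)).hom := by
      rw [reassoc_of% h.braided A B, h.prodMap_prodInv, Category.comp_id]
    rw [← e, reassoc_of% h.prodInv_prodMap]

/-- The flip is built from associators and one braiding, and a symmetric lax structure respects
both; the data are packaged as `Functor.LaxBraided` to obtain this. Applied to `medLax`, it becomes
the compatibility of μ with the flip of ⊕. -/
theorem Lax.flip {F : C ⥤ D} (h : M.Lax N F) (A B X Y : C) :
    N.hom (h.prodMap A B) (h.prodMap X Y) ≫ h.prodMap (M.obj A B) (M.obj X Y) ≫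
        F.map (M.flip A B X Y) =
      N.flip (F.obj A) (F.obj B) (F.obj X) (F.obj Y) ≫
        N.hom (h.prodMap A X) (h.prodMap B Y) ≫ h.prodMap (M.obj A X) (M.obj B Y) := by
  let := M.mon
  let := M.sym
  let := N.mon
  let := N.sym
  let i : F.LaxMonoidal := Functor.LaxMonoidal.ofTensorHom h.unitMap h.prodMap
    h.natural h.assoc (fun A => (h.unit_left A).symm) (fun A => (h.unit_right A).symm)
  let : F.LaxBraided := { i with braided := h.braided }
  exact (MonoidalCategory.tensorμ_comp_μ_tensorHom_μ_comp_μ F A B X Y).symm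

theorem Oplax.flip {F : C ⥤ D} (h : M.Oplax N F) (A B X Y : C) :
    F.map (M.flip A B X Y) ≫ h.prodMap (M.obj A X) (M.obj B Y) ≫
        N.hom (h.prodMap A X) (h.prodMap B Y) =
      h.prodMap (M.obj A B) (M.obj X Y) ≫ N.hom (h.prodMap A B) (h.prodMap X Y) ≫
        N.flip (F.obj A) (F.obj B) (F.obj X) (F.obj Y) := by
  -- The middle arguments are swapped in advance because `flip_op` swaps them back. The second
  -- rewrite works only up to unfolding, since there the objects are values of `F.op`.
  have e := h.op.flip (Opposite.op A) (Opposite.op X) (Opposite.op B) (Opposite.op Y)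
  rw [flip_op] at e
  erw [flip_op] at e
  exact (Category.assoc _ _ _).symm.trans ((congrArg Quiver.Hom.unop e).trans (Category.assoc _ _ _))

/-- Each law follows by naturality of the structure maps, then the coherence law of the lax
structure of the same shape, then the law of A under `F`. This single statement provides the monoid
laws of A ⊗ B, A ⊕ B, F_⊗ A and F_⊕ A. -/
theorem Lax.map_isCommMonoid {F : C ⥤ D} (h : M.Lax N F) {A : C} {nab : M.obj A A ⟶ A}
    {u : M.unit ⟶ A} (hA : M.IsCommMonoid nab u) :
    N.IsCommMonoid (h.prodMap A A ≫ F.map nab) (h.unitMap ≫ F.map u) where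
  assoc := by
    have e := h.assoc A A A
    rw [← Iso.inv_comp_eq] at e
    rw [id_hom_comp, hom_comp_id, Category.assoc, Category.assoc, reassoc_of% h.natural_right,
      reassoc_of% h.natural_left, ← F.map_comp, ← F.map_comp, hA.assoc, F.map_comp,
      ← reassoc_of% e, ← F.map_comp, ← F.map_comp, Iso.hom_inv_id_assoc]
  unit_right := by
    rw [id_hom_comp, Category.assoc, reassoc_of% h.natural_right, ← F.map_comp, Iso.inv_comp_eq,
      Category.comp_id, ← h.unit_right, (Iso.inv_comp_eq _).1 hA.unit_right, Category.comp_id]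
  unit_left := by
    rw [hom_comp_id, Category.assoc, reassoc_of% h.natural_left, ← F.map_comp, Iso.inv_comp_eq,
      Category.comp_id, ← h.unit_left, (Iso.inv_comp_eq _).1 hA.unit_left, Category.comp_id]
  comm := by
    rw [← reassoc_of% h.braided, ← F.map_comp, hA.comm]

theorem Oplax.map_isCocommComonoid {F : C ⥤ D} (h : M.Oplax N F) {A : C} {Δ : A ⟶ M.obj A A}
    {e : A ⟶ M.unit} (hA : M.IsCocommComonoid Δ e) :
    N.IsCocommComonoid (F.map Δ ≫ h.prodMap A A) (F.map e ≫ h.unitMap) :=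
  .of_op (h.op.map_isCommMonoid hA.op)

theorem IsCommMonoid.prod {A : C} {nab : M.obj A A ⟶ A} {u : M.unit ⟶ A}
    (hA : M.IsCommMonoid nab u) {B : D} {nab' : N.obj B B ⟶ B} {u' : N.unit ⟶ B}
    (hB : N.IsCommMonoid nab' u') :
    (M.prod N).IsCommMonoid (A := (A, B)) (Prod.mkHom nab nab') (Prod.mkHom u u') where
  assoc := Prod.ext hA.assoc hB.assoc
  unit_right := Prod.ext hA.unit_right hB.unit_right
  unit_left := Prod.ext hA.unit_left hB.unit_left
  comm := Prod.ext hA.comm hB.comm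

theorem IsCocommComonoid.prod {A : C} {Δ : A ⟶ M.obj A A} {e : A ⟶ M.unit}
    (hA : M.IsCocommComonoid Δ e) {B : D} {Δ' : B ⟶ N.obj B B} {e' : B ⟶ N.unit}
    (hB : N.IsCocommComonoid Δ' e') :
    (M.prod N).IsCocommComonoid (A := (A, B)) (Prod.mkHom Δ Δ') (Prod.mkHom e e') where
  coassoc := Prod.ext hA.coassoc hB.coassoc
  counit_right := Prod.ext hA.counit_right hB.counit_right
  counit_left := Prod.ext hA.counit_left hB.counit_left
  cocomm := Prod.ext hA.cocomm hB.cocomm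

variable (M)

/-- The tensor product is a symmetric monoidal functor. -/
def tensorLax : (M.prod M).Lax M M.tensor where
  unitMap := (M.right M.unit).inv
  prodMap X Y := M.flip X.1 X.2 Y.1 Y.2
  natural f g := M.flip_natural f.1 f.2 g.1 g.2
  assoc X Y Z := by
    let := M.mon
    let := M.sym
    have e := MonoidalCategory.tensor_associativity X.1 X.2 Y.1 Y.2 Z.1 Z.2
    rw [← MonoidalCategory.tensorHom_id, ← MonoidalCategory.id_tensorHom] at e
    exact e
  unit_left X := by
    let := M.mon
    let := M.sym
    have e := MonoidalCategory.tensor_left_unitality X.1 X.2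
    rw [← MonoidalCategory.tensorHom_id, MonoidalCategory.unitors_inv_equal] at e
    exact e.symm
  unit_right X := by
    let := M.mon
    let := M.sym
    have e := MonoidalCategory.tensor_right_unitality X.1 X.2
    rw [← MonoidalCategory.id_tensorHom, MonoidalCategory.unitors_inv_equal] at e
    exact e.symm
  braided X Y := @tensorμ_braiding_tensor C _ M.mon M.sym X.1 X.2 Y.1 Y.2

/-- The tensor product is a symmetric comonoidal functor. -/
def tensorOplax : (M.prod M).Oplax M M.tensor where
  unitMap := (M.right M.unit).hom
  prodMap X Y := M.flip X.1 Y.1 X.2 Y.2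
  natural f g := M.flip_natural f.1 g.1 f.2 g.2
  assoc X Y Z := by
    let := M.mon
    let := M.sym
    have e := MonoidalCategory.associator_monoidal X.1 Y.1 Z.1 X.2 Y.2 Z.2
    rw [← MonoidalCategory.tensorHom_id, ← MonoidalCategory.id_tensorHom] at e
    exact e.symm
  unit_left X := @leftUnitor_inv_tensor C _ M.mon M.sym X.1 X.2
  unit_right X := @rightUnitor_inv_tensor C _ M.mon M.sym X.1 X.2
  braided X Y := M.flip_braid X.1 Y.1 X.2 Y.2

theorem flip_assoc (A A' B B' X X' : C) :
    M.hom (M.flip A A' B B') (𝟙 (M.obj X X')) ≫ M.flip (M.obj A B) (M.obj A' B') X X' ≫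
        M.hom (M.assoc A B X).hom (M.assoc A' B' X').hom =
      (M.assoc (M.obj A A') (M.obj B B') (M.obj X X')).hom ≫
        M.hom (𝟙 (M.obj A A')) (M.flip B B' X X') ≫ M.flip A A' (M.obj B X) (M.obj B' X') :=
  M.tensorLax.assoc (A, A') (B, B') (X, X')

theorem flip_left (A A' : C) :
    M.hom (M.right M.unit).inv (𝟙 (M.obj A A')) ≫ M.flip M.unit M.unit A A' ≫
      M.hom (M.left A).hom (M.left A').hom = (M.left (M.obj A A')).hom :=
  M.tensorLax.unit_left (A, A')

theorem flip_right (A A' : C) :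
    M.hom (𝟙 (M.obj A A')) (M.right M.unit).inv ≫ M.flip A A' M.unit M.unit ≫
      M.hom (M.right A).hom (M.right A').hom = (M.right (M.obj A A')).hom :=
  M.tensorLax.unit_right (A, A')

theorem flip_braid_braid (A A' B B' : C) :
    M.flip A A' B B' ≫ M.hom (M.braid A B).hom (M.braid A' B').hom =
      (M.braid (M.obj A A') (M.obj B B')).hom ≫ M.flip B B' A A' :=
  M.tensorLax.braided (A, A') (B, B')

theorem assoc_flip (A A' B B' X X' : C) :
    M.hom (M.assoc A B X).hom (M.assoc A' B' X').hom ≫ M.flip A (M.obj B X) A' (M.obj B' X') ≫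
        M.hom (𝟙 (M.obj A A')) (M.flip B X B' X') =
      M.flip (M.obj A B) X (M.obj A' B') X' ≫ M.hom (M.flip A B A' B') (𝟙 (M.obj X X')) ≫
        (M.assoc (M.obj A A') (M.obj B B') (M.obj X X')).hom :=
  M.tensorOplax.assoc (A, A') (B, B') (X, X')

theorem left_flip (A A' : C) :
    M.flip M.unit A M.unit A' ≫ M.hom (M.right M.unit).hom (𝟙 (M.obj A A')) ≫
      (M.left (M.obj A A')).hom = M.hom (M.left A).hom (M.left A').hom := by
  let := M.mon
  let := M.sym
  have e := MonoidalCategory.leftUnitor_monoidal A A'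
  rw [← MonoidalCategory.tensorHom_id, MonoidalCategory.unitors_equal] at e
  exact e.symm

theorem right_flip (A A' : C) :
    M.flip A M.unit A' M.unit ≫ M.hom (𝟙 (M.obj A A')) (M.right M.unit).hom ≫
      (M.right (M.obj A A')).hom = M.hom (M.right A).hom (M.right A').hom := by
  let := M.mon
  let := M.sym
  have e := MonoidalCategory.rightUnitor_monoidal A A'
  rw [← MonoidalCategory.id_tensorHom, MonoidalCategory.unitors_equal] at e
  exact e.symm

variable {M}

/-- In a commutative monoid (ab)(xy) = (ax)(by), so the multiplication is itself a homomorphism.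
This is the Eckmann–Hilton ingredient of Fox's theorem: it turns ∇ into a morphism of bimonoids, and
its dual does the same for Δ. -/
theorem IsCommMonoid.flip {A : C} {nab : M.obj A A ⟶ A} {u : M.unit ⟶ A}
    (h : M.IsCommMonoid nab u) :
    M.flip A A A A ≫ M.hom nab nab ≫ nab = M.hom nab nab ≫ nab := by
  let := M.mon
  let := M.sym
  let i : MonObj A :=
    { one := u
      mul := nab
      one_mul := (congrArg (· ≫ nab) (MonoidalCategory.tensorHom_id u A).symm).trans
        (((Iso.inv_comp_eq _).1 h.unit_left).trans (Category.comp_id _))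
      mul_one := (congrArg (· ≫ nab) (MonoidalCategory.id_tensorHom A u).symm).trans
        (((Iso.inv_comp_eq _).1 h.unit_right).trans (Category.comp_id _))
      mul_assoc := (congrArg (· ≫ nab) (MonoidalCategory.tensorHom_id nab A).symm).trans
        (((Iso.eq_inv_comp _).1 h.assoc).symm.trans
          (congrArg (fun f => _ ≫ f ≫ nab) (MonoidalCategory.id_tensorHom A nab))) }
  have : IsCommMonObj A := ⟨h.comm⟩
  exact MonObj.mul_mul_mul_comm A

theorem IsCocommComonoid.flip {A : C} {Δ : A ⟶ M.obj A A} {e : A ⟶ M.unit}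
    (h : M.IsCocommComonoid Δ e) :
    Δ ≫ M.hom Δ Δ ≫ M.flip A A A A = Δ ≫ M.hom Δ Δ := by
  have e := h.op.flip
  rw [flip_op] at e
  exact (Category.assoc _ _ _).symm.trans (congrArg Quiver.Hom.unop e)

/-- The counit law after naturality of the unitor: copying, then discarding one copy, leaves `f`.
This is the computation of a pairing followed by a projection; with `mix` in place of `f` it also
yields laws for the units. -/
theorem IsCocommComonoid.hom_counit {A X : C} {Δ : A ⟶ M.obj A A} {e : A ⟶ M.unit}
    (h : M.IsCocommComonoid Δ e) (f : A ⟶ X) : Δ ≫ M.hom f e ≫ (M.right X).hom = f := by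
  rw [M.hom_def', Category.assoc, M.right_natural, reassoc_of% h.counit_right]

theorem IsCocommComonoid.counit_hom {A X : C} {Δ : A ⟶ M.obj A A} {e : A ⟶ M.unit}
    (h : M.IsCocommComonoid Δ e) (f : A ⟶ X) : Δ ≫ M.hom e f ≫ (M.left X).hom = f := by
  rw [M.hom_def, Category.assoc, M.left_natural, reassoc_of% h.counit_left]

theorem IsCommMonoid.hom_unit {A X : C} {nab : M.obj A A ⟶ A} {u : M.unit ⟶ A}
    (h : M.IsCommMonoid nab u) (f : X ⟶ A) : (M.right X).inv ≫ M.hom f u ≫ nab = f := by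
  rw [M.hom_def, Category.assoc, reassoc_of% M.right_inv_natural, h.unit_right, Category.comp_id]

theorem IsCommMonoid.unit_hom {A X : C} {nab : M.obj A A ⟶ A} {u : M.unit ⟶ A}
    (h : M.IsCommMonoid nab u) (f : X ⟶ A) : (M.left X).inv ≫ M.hom u f ≫ nab = f := by
  rw [M.hom_def', Category.assoc, reassoc_of% M.left_inv_natural, h.unit_left, Category.comp_id]

theorem isCommMonoid_unit (M : SymMon C) :
    M.IsCommMonoid (M.right M.unit).hom (𝟙 M.unit) where
  assoc := @rightUnitor_unit_assoc C _ M.mon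
  unit_right := by rw [M.hom_id, Category.id_comp, Iso.inv_hom_id]
  unit_left := by rw [M.hom_id, Category.id_comp, M.left_unit, Iso.inv_hom_id]
  comm := by rw [← M.left_unit, M.braid_left, M.left_unit]

theorem isCocommComonoid_unit (M : SymMon C) :
    M.IsCocommComonoid (M.right M.unit).inv (𝟙 M.unit) :=
  .of_op M.op.isCommMonoid_unit

end SymMon

end LaxLemmas

/-! ### Bimonoids are closed under units, tensor and par. -/

section MedialObjects

open SymMon

variable {C : Type u₁} [Category.{v₁} C] [SMLDC C]

variable (C) in
/-- The medial maps make the tensor a symmetric monoidal functor for the par. -/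
def medLax : ((P : SymMon C).prod P).Lax P (T : SymMon C).tensor where
  unitMap := Δbot
  prodMap X Y := med X.1 X.2 Y.1 Y.2
  natural f g := med_natural f.1 f.2 g.1 g.2
  assoc X Y Z := by
    have e := med_αP X.1 X.2 Y.1 Y.2 Z.1 Z.2
    -- `αP` is inverse to the associator of `P`, so `med_αP` is solved for the other bracketing
    -- before it becomes lax associativity.
    rw [← Iso.eq_inv_comp] at e
    refine (Category.assoc _ _ _).symm.trans
      ((congrArg (· ≫ ((αP X.1 Y.1 Z.1).inv ⨂ₘ (αP X.2 Y.2 Z.2).inv)) e).trans ?_)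
    simp only [Category.assoc, ← (T : SymMon C).hom_comp, Iso.hom_inv_id, (T : SymMon C).hom_id,
      Category.comp_id]
    rfl
  unit_left X := med_lP X.1 X.2
  unit_right X := med_rP X.1 X.2
  braided X Y := med_σP X.1 X.2 Y.1 Y.2

variable (C) in
/-- The medial maps make the par a symmetric comonoidal functor for the tensor. -/
def medOplax : ((T : SymMon C).prod T).Oplax T (P : SymMon C).tensor where
  unitMap := nabTop
  prodMap X Y := med X.1 Y.1 X.2 Y.2
  natural f g := med_natural f.1 g.1 f.2 g.2
  assoc X Y Z := (med_αT X.1 Y.1 Z.1 X.2 Y.2 Z.2).symm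
  unit_left X := med_lT X.1 X.2
  unit_right X := med_rT X.1 X.2
  braided X Y := (med_σT X.1 Y.1 X.2 Y.2).symm

/-- An oplax symmetric functor respects flips, and by `medOplax` the par is one. This interchange
drives the law for ∇ followed by Δ on A ⊗ B; its companion from `medLax` does so on A ⊕ B. -/
theorem med_flipT (A A' B B' X X' Y Y' : C) :
    ((T : SymMon C).flip A A' B B' ⅋ₘ (T : SymMon C).flip X X' Y Y') ≫
        med (A ⨂ B) (A' ⨂ B') (X ⨂ Y) (X' ⨂ Y') ≫ (med A B X Y ⨂ₘ med A' B' X' Y') =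
      med (A ⨂ A') (B ⨂ B') (X ⨂ X') (Y ⨂ Y') ≫ (med A A' X X' ⨂ₘ med B B' Y Y') ≫
        (T : SymMon C).flip (A ⅋ X) (A' ⅋ X') (B ⅋ Y) (B' ⅋ Y') :=
  (medOplax C).flip (A, X) (A', X') (B, Y) (B', Y')

theorem med_flipP (A A' B B' X X' Y Y' : C) :
    (med A B A' B' ⅋ₘ med X Y X' Y') ≫ med (A ⅋ A') (B ⅋ B') (X ⅋ X') (Y ⅋ Y') ≫
        ((P : SymMon C).flip A A' X X' ⨂ₘ (P : SymMon C).flip B B' Y Y') =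
      (P : SymMon C).flip (A ⨂ B) (A' ⨂ B') (X ⨂ Y) (X' ⨂ Y') ≫
        (med A B X Y ⅋ₘ med A' B' X' Y') ≫ med (A ⅋ X) (B ⅋ Y) (A' ⅋ X') (B' ⅋ Y') :=
  (medLax C).flip (A, B) (A', B') (X, Y) (X', Y')

/-- Factor the tensor of two copies of `nabTop` into a map on the right followed by one on the left:
the first is absorbed by the unit law `med_rT`, the second slides through the right unitor. The
result gives the law for ∇ followed by Δ on ⊤ and the law for ∇ followed by e on A ⊗ B. -/
theorem med_nabTop : med ⊤[C] ⊤[C] ⊤[C] ⊤[C] ≫ (nabTop ⨂ₘ nabTop) ≫ (rT ⊤[C]).inv =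
    ((rT ⊤[C]).inv ⅋ₘ (rT ⊤[C]).inv) ≫ nabTop := by
  have e : (nabTop ⨂ₘ nabTop : _ ⟶ ⊤[C] ⨂ ⊤[C]) = (𝟙 _ ⨂ₘ nabTop) ≫ (nabTop ⨂ₘ 𝟙 _) := by
    rw [← SymMon.hom_comp, Category.id_comp, Category.comp_id]
  have e₁ : (nabTop ⨂ₘ 𝟙 ⊤[C]) ≫ (rT ⊤[C]).inv = (rT (⊤[C] ⅋ ⊤[C])).inv ≫ nabTop :=
    (T : SymMon C).right_natural nabTop
  have e₂ := med_rT ⊤[C] ⊤[C]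
  have e₃ : ((rT ⊤[C]).inv ⅋ₘ (rT ⊤[C]).inv) ≫ ((rT ⊤[C]).hom ⅋ₘ (rT ⊤[C]).hom) = 𝟙 _ := by
    rw [← SymMon.hom_comp, Iso.inv_hom_id, SymMon.hom_id]
  rw [e, Category.assoc, e₁, ← Category.id_comp (med _ _ _ _), ← e₃]
  simp only [Category.assoc]
  rw [reassoc_of% e₂, Iso.hom_inv_id_assoc]

/-- Dual of `med_nabTop`, with `med_rP` absorbing one copy of `Δbot`. It serves the bimonoid ⊥ and
the unit of A ⊕ B. -/
theorem Δbot_med : (rP ⊥[C]).inv ≫ (Δbot ⅋ₘ Δbot) ≫ med ⊥[C] ⊥[C] ⊥[C] ⊥[C] =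
    Δbot ≫ ((rP ⊥[C]).inv ⨂ₘ (rP ⊥[C]).inv) := by
  have e : (Δbot ⅋ₘ Δbot : ⊥[C] ⅋ ⊥[C] ⟶ _) = (Δbot ⅋ₘ 𝟙 _) ≫ (𝟙 _ ⅋ₘ Δbot) := by
    rw [← SymMon.hom_comp, Category.id_comp, Category.comp_id]
  have e₁ : (rP ⊥[C]).inv ≫ (Δbot ⅋ₘ 𝟙 ⊥[C]) = Δbot ≫ (rP (⊥[C] ⨂ ⊥[C])).inv :=
    (P : SymMon C).right_inv_natural Δbot
  have e₂ := med_rP ⊥[C] ⊥[C]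
  have e₃ : ((rP ⊥[C]).hom ⨂ₘ (rP ⊥[C]).hom) ≫ ((rP ⊥[C]).inv ⨂ₘ (rP ⊥[C]).inv) = 𝟙 _ := by
    rw [← SymMon.hom_comp, Iso.hom_inv_id, SymMon.hom_id]
  rw [e, Category.assoc, reassoc_of% e₁, ← Category.comp_id (med _ _ _ _), ← e₃, reassoc_of% e₂,
    Iso.inv_hom_id_assoc]

theorem Δbot_mix : Δbot ≫ (mix ⨂ₘ mix) ≫ (rT ⊤[C]).inv = mix :=
  bot_comonoid.hom_counit mix

theorem mix_nabTop : (rP ⊥[C]).inv ≫ (mix ⅋ₘ mix) ≫ nabTop = mix :=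
  top_monoid.hom_unit mix

namespace MedBimon

variable (C) in
/-- The tensor unit as a medial bimonoid. -/
def top : MedBimon C where
  toMedBimonData := MedBimonData.top C
  comonoid := isCocommComonoid_unit T
  monoid := top_monoid
  nab_Δ := by
    change nabTop ≫ (rT ⊤[C]).hom = ((rT ⊤[C]).hom ⅋ₘ (rT ⊤[C]).hom) ≫ med _ _ _ _ ≫
      (nabTop ⨂ₘ nabTop)
    rw [← cancel_mono (rT ⊤[C]).inv]
    simp only [Category.assoc]
    rw [med_nabTop, ← reassoc_of% (P : SymMon C).hom_comp, Iso.hom_inv_id,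
      SymMon.hom_id, Category.id_comp, Category.comp_id]
  u_e := Category.comp_id _
  nab_e := by
    change nabTop ≫ 𝟙 _ = (𝟙 _ ⅋ₘ 𝟙 _) ≫ nabTop
    rw [SymMon.hom_id, Category.id_comp, Category.comp_id]
  u_Δ := by
    change mix ≫ (rT ⊤[C]).hom = Δbot ≫ (mix ⨂ₘ mix)
    rw [← Iso.eq_comp_inv, Category.assoc, Δbot_mix]

variable (C) in
/-- The par unit as a medial bimonoid. -/
def bot : MedBimon C where
  toMedBimonData := MedBimonData.bot C
  comonoid := bot_comonoid
  monoid := isCommMonoid_unit P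
  nab_Δ := by
    change (rP ⊥[C]).hom ≫ Δbot = (Δbot ⅋ₘ Δbot) ≫ med _ _ _ _ ≫
      ((rP ⊥[C]).hom ⨂ₘ (rP ⊥[C]).hom)
    rw [← Iso.eq_inv_comp, reassoc_of% Δbot_med, ← SymMon.hom_comp, Iso.inv_hom_id, SymMon.hom_id,
      Category.comp_id]
  u_e := Category.id_comp _
  nab_e := by
    change (rP ⊥[C]).hom ≫ mix = (mix ⅋ₘ mix) ≫ nabTop
    rw [← Iso.eq_inv_comp, mix_nabTop]
  u_Δ := by
    change 𝟙 _ ≫ Δbot = Δbot ≫ (𝟙 _ ⨂ₘ 𝟙 _)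
    rw [SymMon.hom_id, Category.id_comp, Category.comp_id]

/-- The tensor of medial bimonoids. -/
def ten (A B : MedBimon C) : MedBimon C where
  toMedBimonData := A.toMedBimonData.ten B.toMedBimonData
  -- Pairs of bimonoids are (co)monoids in C × C. The comonoid laws use that ⊗ is comonoidal for
  -- itself, the monoid laws that μ makes it monoidal for ⊕; the transported structures unfold to
  -- those of `MedBimonData.ten`.
  comonoid := (tensorOplax T).map_isCocommComonoid (A.comonoid.prod B.comonoid)
  monoid := (medLax C).map_isCommMonoid (A.monoid.prod B.monoid)
  nab_Δ := by
    simp only [MedBimonData.ten, Category.assoc, SymMon.hom_comp]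
    rw [reassoc_of% med_flipT, ← flip_natural, ← reassoc_of% (T : SymMon C).hom_comp,
      A.nab_Δ, B.nab_Δ, (T : SymMon C).hom_comp, (T : SymMon C).hom_comp, reassoc_of% med_natural]
    simp only [Category.assoc]
  u_e := by
    simp only [MedBimonData.ten, Category.assoc]
    rw [← reassoc_of% (T : SymMon C).hom_comp, A.u_e, B.u_e, Δbot_mix]
  nab_e := by
    simp only [MedBimonData.ten, Category.assoc, SymMon.hom_comp]
    rw [← reassoc_of% (T : SymMon C).hom_comp, A.nab_e, B.nab_e, ← med_nabTop,
      reassoc_of% med_natural, SymMon.hom_comp, Category.assoc]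
  u_Δ := by
    simp only [MedBimonData.ten, Category.assoc, SymMon.hom_comp]
    -- The flip coming from the comultiplication of A ⊗ B acts on four copies of ⊥, where
    -- cocommutativity of `Δbot` absorbs it.
    rw [← reassoc_of% (T : SymMon C).hom_comp, A.u_Δ, B.u_Δ, SymMon.hom_comp, Category.assoc,
      flip_natural, reassoc_of% (bot_comonoid (C := C)).flip]

/-- The par of medial bimonoids. -/
def par (A B : MedBimon C) : MedBimon C where
  toMedBimonData := A.toMedBimonData.par B.toMedBimonData
  comonoid := (medOplax C).map_isCocommComonoid (A.comonoid.prod B.comonoid)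
  monoid := (tensorLax P).map_isCommMonoid (A.monoid.prod B.monoid)
  nab_Δ := by
    simp only [MedBimonData.par, Category.assoc, SymMon.hom_comp]
    rw [reassoc_of% med_flipP, ← med_natural, ← reassoc_of% (P : SymMon C).hom_comp,
      A.nab_Δ, B.nab_Δ, (P : SymMon C).hom_comp, (P : SymMon C).hom_comp,
      reassoc_of% flip_natural]
    simp only [Category.assoc]
  u_e := by
    simp only [MedBimonData.par, Category.assoc]
    rw [← reassoc_of% (P : SymMon C).hom_comp, A.u_e, B.u_e, mix_nabTop]
  nab_e := by
    simp only [MedBimonData.par, Category.assoc, SymMon.hom_comp]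
    -- Here the flip lands on four copies of ⊤ and is absorbed by commutativity of `nabTop`.
    rw [← reassoc_of% (P : SymMon C).hom_comp, A.nab_e, B.nab_e, SymMon.hom_comp, Category.assoc,
      ← reassoc_of% (P : SymMon C).flip_natural, (top_monoid (C := C)).flip]
  u_Δ := by
    simp only [MedBimonData.par, Category.assoc, SymMon.hom_comp]
    rw [← reassoc_of% (P : SymMon C).hom_comp, A.u_Δ, B.u_Δ, SymMon.hom_comp, Category.assoc,
      med_natural, reassoc_of% Δbot_med]

end MedBimon

end MedialObjects

/-! ### Tensors, pars, associators, unitors and symmetries are morphisms of bimonoids. -/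

section MedialMorphisms

open SymMon

variable {C : Type u₁} [Category.{v₁} C] [SMLDC C]

namespace MedBimon

/-- The isomorphism of medial bimonoids given by an isomorphism of the underlying objects. -/
def isoMk {A B : MedBimon C} (f : A ⟶ B) (g : B.X ⟶ A.X) (h₁ : Hom.hom f ≫ g = 𝟙 _)
    (h₂ : g ≫ Hom.hom f = 𝟙 _) : A ≅ B where
  hom := f
  inv :=
    { hom := g
      hom_Δ := by
        have e := Hom.hom_Δ f
        -- Since `f` preserves Δ and is invertible, the comultiplication of A is that of B
        -- conjugated by `f`; hence the inverse preserves it too.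
        have e' : A.Δ = Hom.hom f ≫ B.Δ ≫ (g ⨂ₘ g) := by
          rw [reassoc_of% e, ← SymMon.hom_comp, h₁, SymMon.hom_id, Category.comp_id]
        rw [e', reassoc_of% h₂]
      hom_e := by rw [← Hom.hom_e f, reassoc_of% h₂]
      nab_hom := by
        have e := Hom.nab_hom f
        have e' : B.nab = (g ⅋ₘ g) ≫ A.nab ≫ Hom.hom f := by
          rw [e, ← reassoc_of% (P : SymMon C).hom_comp, h₂, SymMon.hom_id, Category.id_comp]
        rw [e', Category.assoc, Category.assoc, h₁, Category.comp_id]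
      u_hom := by rw [← Hom.u_hom f, Category.assoc, h₁, Category.comp_id] }
  hom_inv_id := Hom.ext h₁
  inv_hom_id := Hom.ext h₂

/-- The tensor of morphisms of medial bimonoids. -/
def tenHom {A A' B B' : MedBimon C} (f : A ⟶ A') (g : B ⟶ B') : ten A B ⟶ ten A' B' where
  hom := Hom.hom f ⨂ₘ Hom.hom g
  hom_Δ := by
    simp only [ten, MedBimonData.ten, Category.assoc]
    rw [← flip_natural, ← reassoc_of% (T : SymMon C).hom_comp, Hom.hom_Δ f, Hom.hom_Δ g,
      SymMon.hom_comp, Category.assoc]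
  hom_e := by
    simp only [ten, MedBimonData.ten]
    rw [← reassoc_of% (T : SymMon C).hom_comp, Hom.hom_e f, Hom.hom_e g]
  nab_hom := by
    simp only [ten, MedBimonData.ten, Category.assoc]
    rw [reassoc_of% med_natural, ← SymMon.hom_comp, ← SymMon.hom_comp, Hom.nab_hom f,
      Hom.nab_hom g]
  u_hom := by
    simp only [ten, MedBimonData.ten, Category.assoc]
    rw [← SymMon.hom_comp, Hom.u_hom f, Hom.u_hom g]

/-- The par of morphisms of medial bimonoids. -/
def parHom {A A' B B' : MedBimon C} (f : A ⟶ A') (g : B ⟶ B') : par A B ⟶ par A' B' where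
  hom := Hom.hom f ⅋ₘ Hom.hom g
  hom_Δ := by
    simp only [par, MedBimonData.par, Category.assoc]
    rw [← med_natural, ← reassoc_of% (P : SymMon C).hom_comp, Hom.hom_Δ f, Hom.hom_Δ g,
      SymMon.hom_comp, Category.assoc]
  hom_e := by
    simp only [par, MedBimonData.par]
    rw [← reassoc_of% (P : SymMon C).hom_comp, Hom.hom_e f, Hom.hom_e g]
  nab_hom := by
    simp only [par, MedBimonData.par, Category.assoc]
    rw [reassoc_of% flip_natural, ← SymMon.hom_comp, ← SymMon.hom_comp, Hom.nab_hom f,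
      Hom.nab_hom g]
  u_hom := by
    simp only [par, MedBimonData.par, Category.assoc]
    rw [← SymMon.hom_comp, Hom.u_hom f, Hom.u_hom g]

theorem med_assocP (A A' B B' X X' : C) :
    (med A A' B B' ⅋ₘ 𝟙 (X ⨂ X')) ≫ med (A ⅋ B) (A' ⅋ B') X X' ≫
        (((P : SymMon C).assoc A B X).hom ⨂ₘ ((P : SymMon C).assoc A' B' X').hom) =
      ((P : SymMon C).assoc (A ⨂ A') (B ⨂ B') (X ⨂ X')).hom ≫ (𝟙 (A ⨂ A') ⅋ₘ med B B' X X') ≫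
        med A A' (B ⅋ X) (B' ⅋ X') :=
  (medLax C).assoc (A, A') (B, B') (X, X')

/-- The axiom `med_lT` is phrased with inverse unitors; cancelling them gives the form needed for
left unitors to preserve ∇. -/
theorem med_leftT (A B : C) :
    med ⊤[C] A ⊤[C] B ≫ (nabTop ⨂ₘ 𝟙 (A ⅋ B)) ≫ ((T : SymMon C).left (A ⅋ B)).hom =
      ((T : SymMon C).left A).hom ⅋ₘ ((T : SymMon C).left B).hom := by
  have e : (((T : SymMon C).left A).inv ⅋ₘ ((T : SymMon C).left B).inv) ≫ _ ≫ _ =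
    ((T : SymMon C).left _).inv := med_lT A B
  rw [← cancel_mono ((T : SymMon C).left _).inv]
  simp only [Category.assoc, Iso.hom_inv_id, Category.comp_id]
  rw [← e, ← reassoc_of% (P : SymMon C).hom_comp, Iso.hom_inv_id, Iso.hom_inv_id, SymMon.hom_id,
    Category.id_comp]

theorem med_rightT (A B : C) :
    med A ⊤[C] B ⊤[C] ≫ (𝟙 (A ⅋ B) ⨂ₘ nabTop) ≫ ((T : SymMon C).right (A ⅋ B)).hom =
      ((T : SymMon C).right A).hom ⅋ₘ ((T : SymMon C).right B).hom := by
  have e : (((T : SymMon C).right A).inv ⅋ₘ ((T : SymMon C).right B).inv) ≫ _ ≫ _ =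
    ((T : SymMon C).right _).inv := med_rT A B
  rw [← cancel_mono ((T : SymMon C).right _).inv]
  simp only [Category.assoc, Iso.hom_inv_id, Category.comp_id]
  rw [← e, ← reassoc_of% (P : SymMon C).hom_comp, Iso.hom_inv_id, Iso.hom_inv_id, SymMon.hom_id,
    Category.id_comp]

/-- The associator of the tensor. -/
def tenAssoc (A B E : MedBimon C) : ten (ten A B) E ≅ ten A (ten B E) :=
  isoMk
    { hom := ((T : SymMon C).assoc A.X B.X E.X).hom
      hom_Δ := by
        simp only [ten, MedBimonData.ten, Category.assoc, SymMon.hom_comp_left,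
          SymMon.hom_comp_right]
        rw [flip_assoc, reassoc_of% assoc_natural]
      hom_e := by
        have e := (Iso.eq_inv_comp _).1 (T : SymMon C).isCommMonoid_unit.assoc
        simp only [ten, MedBimonData.ten, rT, Category.assoc, SymMon.hom_comp_left,
          SymMon.hom_comp_right]
        rw [← reassoc_of% (T : SymMon C).assoc_natural]
        exact congrArg (_ ≫ ·) e
      nab_hom := by
        have e := med_αT A.X B.X E.X A.X B.X E.X
        simp only [ten, MedBimonData.ten, Category.assoc, SymMon.comp_hom_left,
          SymMon.comp_hom_right, assoc_natural]
        exact (reassoc_of% e) _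
      u_hom := by
        have e := (bot_comonoid (C := C)).coassoc
        simp only [ten, MedBimonData.ten, Category.assoc, SymMon.comp_hom_left,
          SymMon.comp_hom_right, assoc_natural]
        rw [← reassoc_of% e] } _ (Iso.hom_inv_id _) (Iso.inv_hom_id _)

/-- The left unitor of the tensor. -/
def tenLeft (A : MedBimon C) : ten (top C) A ≅ A :=
  isoMk
    { hom := ((T : SymMon C).left A.X).hom
      hom_Δ := by
        simp only [ten, top, MedBimonData.ten, MedBimonData.top, rT, Iso.symm_hom, Category.assoc]
        rw [hom_def', Category.assoc, flip_left, left_natural]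
      hom_e := by
        simp only [ten, top, MedBimonData.ten, MedBimonData.top, rT]
        rw [← left_natural, left_unit]
        rfl
      nab_hom := by
        simp only [ten, top, MedBimonData.ten, MedBimonData.top, Category.assoc]
        rw [hom_def, Category.assoc, left_natural, reassoc_of% med_leftT]
      -- The unit of the bimonoid ⊤ is `mix`, which is also the counit of ⊥, so the counit law of ⊥
      -- applies.
      u_hom := (Category.assoc _ _ _).trans (bot_comonoid.counit_hom A.u) } _ (Iso.hom_inv_id _) (Iso.inv_hom_id _)

/-- The right unitor of the tensor. -/
def tenRight (A : MedBimon C) : ten A (top C) ≅ A :=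
  isoMk
    { hom := ((T : SymMon C).right A.X).hom
      hom_Δ := by
        simp only [ten, top, MedBimonData.ten, MedBimonData.top, rT, Iso.symm_hom, Category.assoc]
        rw [hom_def, Category.assoc, flip_right, right_natural]
      hom_e := by
        simp only [ten, top, MedBimonData.ten, MedBimonData.top, rT]
        rw [← right_natural]
        rfl
      nab_hom := by
        simp only [ten, top, MedBimonData.ten, MedBimonData.top, Category.assoc]
        rw [hom_def', Category.assoc, right_natural, reassoc_of% med_rightT]
      u_hom := (Category.assoc _ _ _).trans (bot_comonoid.hom_counit A.u) } _ (Iso.hom_inv_id _) (Iso.inv_hom_id _)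

/-- The symmetry of the tensor. -/
def tenBraid (A B : MedBimon C) : ten A B ≅ ten B A :=
  isoMk
    { hom := ((T : SymMon C).braid A.X B.X).hom
      hom_Δ := by
        simp only [ten, MedBimonData.ten, Category.assoc]
        rw [flip_braid_braid, reassoc_of% braid_natural]
      hom_e := by
        have e := (T : SymMon C).isCommMonoid_unit.comm
        simp only [ten, MedBimonData.ten, rT]
        rw [← reassoc_of% (T : SymMon C).braid_natural]
        exact congrArg (_ ≫ ·) e
      nab_hom := by
        have e := med_σT A.X B.X A.X B.X
        simp only [σT] at e
        simp only [ten, MedBimonData.ten, Category.assoc]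
        rw [braid_natural, reassoc_of% e]
      u_hom := by
        simp only [ten, MedBimonData.ten, Category.assoc]
        rw [braid_natural, reassoc_of% (bot_comonoid (C := C)).cocomm] }
    ((T : SymMon C).braid A.X B.X).inv (Iso.hom_inv_id _) (Iso.inv_hom_id _)

/-- The associator of the par. -/
def parAssoc (A B E : MedBimon C) : par (par A B) E ≅ par A (par B E) :=
  isoMk
    { hom := ((P : SymMon C).assoc A.X B.X E.X).hom
      hom_Δ := by
        simp only [par, MedBimonData.par, Category.assoc, SymMon.hom_comp_left,
          SymMon.hom_comp_right]
        rw [med_assocP, reassoc_of% assoc_natural]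
      hom_e := by
        have e := (Iso.eq_inv_comp _).1 (top_monoid (C := C)).assoc
        simp only [par, MedBimonData.par, Category.assoc, SymMon.hom_comp_left,
          SymMon.hom_comp_right]
        rw [← reassoc_of% (P : SymMon C).assoc_natural, e]
      nab_hom := by
        simp only [par, MedBimonData.par, Category.assoc, SymMon.comp_hom_left,
          SymMon.comp_hom_right, assoc_natural]
        rw [reassoc_of% assoc_flip]
      u_hom := by
        have e := (P : SymMon C).isCocommComonoid_unit.coassoc
        simp only [par, MedBimonData.par, rP, Category.assoc, SymMon.comp_hom_left,
          SymMon.comp_hom_right, assoc_natural]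
        rw [← reassoc_of% e] } _ (Iso.hom_inv_id _) (Iso.inv_hom_id _)

/-- The left unitor of the par. -/
def parLeft (A : MedBimon C) : par (bot C) A ≅ A :=
  isoMk
    { hom := ((P : SymMon C).left A.X).hom
      hom_Δ := by
        have e₁ : _ = ((P : SymMon C).left _).hom := med_lP A.X A.X
        simp only [par, bot, MedBimonData.par, MedBimonData.bot, Category.assoc]
        rw [hom_def', Category.assoc, ← left_natural, ← e₁]
        rfl
      hom_e := by
        -- The counit of the bimonoid ⊥ is `mix`, which is also the unit of the monoid ⊤.
        have e := (top_monoid (C := C)).unit_hom A.e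
        rw [Iso.inv_comp_eq] at e
        exact e.symm
      nab_hom := by
        simp only [par, bot, MedBimonData.par, MedBimonData.bot, rP, Category.assoc]
        rw [hom_def, Category.assoc, left_natural, reassoc_of% left_flip]
      u_hom := by
        simp only [par, bot, MedBimonData.par, MedBimonData.bot, rP, Category.assoc]
        rw [left_natural, left_unit, Iso.inv_hom_id_assoc] }
    _ (Iso.hom_inv_id _) (Iso.inv_hom_id _)

/-- The right unitor of the par. -/
def parRight (A : MedBimon C) : par A (bot C) ≅ A :=
  isoMk
    { hom := ((P : SymMon C).right A.X).hom
      hom_Δ := by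
        have e₁ : _ = ((P : SymMon C).right _).hom := med_rP A.X A.X
        simp only [par, bot, MedBimonData.par, MedBimonData.bot, Category.assoc]
        rw [hom_def, Category.assoc, ← right_natural, ← e₁]
        rfl
      hom_e := by
        have e := (top_monoid (C := C)).hom_unit A.e
        rw [Iso.inv_comp_eq] at e
        exact e.symm
      nab_hom := by
        simp only [par, bot, MedBimonData.par, MedBimonData.bot, rP, Category.assoc]
        rw [hom_def', Category.assoc, right_natural, reassoc_of% right_flip]
      u_hom := by
        simp only [par, bot, MedBimonData.par, MedBimonData.bot, rP, Category.assoc]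
        rw [right_natural, Iso.inv_hom_id_assoc] }
    _ (Iso.hom_inv_id _) (Iso.inv_hom_id _)

/-- The symmetry of the par. -/
def parBraid (A B : MedBimon C) : par A B ≅ par B A :=
  isoMk
    { hom := ((P : SymMon C).braid A.X B.X).hom
      hom_Δ := by
        have e := med_σP A.X A.X B.X B.X
        simp only [σP] at e
        simp only [par, MedBimonData.par, Category.assoc]
        rw [e, reassoc_of% braid_natural]
      hom_e := by
        simp only [par, MedBimonData.par]
        rw [← reassoc_of% (P : SymMon C).braid_natural, (top_monoid (C := C)).comm]
      nab_hom := by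
        simp only [par, MedBimonData.par, Category.assoc]
        rw [braid_natural, reassoc_of% flip_braid]
      u_hom := by
        have e := (P : SymMon C).isCocommComonoid_unit.cocomm
        simp only [par, MedBimonData.par, rP, Category.assoc]
        rw [braid_natural, reassoc_of% e] }
    ((P : SymMon C).braid A.X B.X).inv (Iso.hom_inv_id _) (Iso.inv_hom_id _)

end MedBimon

end MedialMorphisms

/-! ### Linear distributivities, diagonals and codiagonals as morphisms of bimonoids. -/

section MedialDistributivity

open SymMon

variable {C : Type u₁} [Category.{v₁} C] [SMLDC C]

/-- In `med_δL` the extra factor is distributed into the first component of the target of μ;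
conjugating by the symmetries through `med_σT` sends it into the second. The swap left over on X ⊗
X' is undone by a second swap. -/
theorem med_slide_δL (B B' X X' Z : C) :
    (𝟙 Z ⨂ₘ med B B' X X') ≫ (T : SymMon C).slide Z (B ⅋ X) (B' ⅋ X') ≫
        (𝟙 (B ⅋ X) ⨂ₘ δL Z B' X') =
      δL Z (B ⨂ B') (X ⨂ X') ≫ ((T : SymMon C).slide Z B B' ⅋ₘ 𝟙 (X ⨂ X')) ≫
        med B (Z ⨂ B') X X' := by
  have e := med_δL B' B X' X Z
  have e₁ := med_σT B B' X X'
  have e₂ := med_σT (Z ⨂ B') B X' X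
  have e₃ := (T : SymMon C).braid_braid X X'
  simp only [αT, σT] at e e₁ e₂
  rw [slide_eq_braid, slide_eq_braid]
  simp only [Category.assoc]
  rw [← braid_natural, ← reassoc_of% (T : SymMon C).id_hom_comp, e₁, SymMon.id_hom_comp,
    Category.assoc, reassoc_of% e, e₂, reassoc_of% δL_natural, ← reassoc_of% (P : SymMon C).hom_comp,
    ← reassoc_of% (P : SymMon C).hom_comp, Category.comp_id, e₃, Category.assoc]

/-- Expand the flip through `slide`: the factor A' enters the second component by `med_slide_δL`,
then A enters the first by `med_δL`, and `δL_αT` merges the two distributivities into one. With both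
factors equal this is the preservation of Δ by δL. -/
theorem δL_flipT (A A' B B' X X' : C) :
    (𝟙 (A ⨂ A') ⨂ₘ med B B' X X') ≫ (T : SymMon C).flip A A' (B ⅋ X) (B' ⅋ X') ≫
        (δL A B X ⨂ₘ δL A' B' X') =
      δL (A ⨂ A') (B ⨂ B') (X ⨂ X') ≫ ((T : SymMon C).flip A A' B B' ⅋ₘ 𝟙 (X ⨂ X')) ≫
        med (A ⨂ B) (A' ⨂ B') X X' := by
  have e := med_δL B (A' ⨂ B') X X' A
  have e₁ := δL_αT A A' (B ⨂ B') (X ⨂ X')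
  have e₂ := (T : SymMon C).assoc_inv_natural (𝟙 A) (𝟙 (B ⅋ X)) (δL A' B' X')
  simp only [αT] at e e₁
  rw [SymMon.hom_id] at e₂
  rw [flip_eq, flip_eq, ← SymMon.hom_id, hom_def' _ (δL A B X)]
  simp only [Category.assoc, SymMon.hom_comp_id]
  rw [reassoc_of% assoc_natural, ← reassoc_of% e₂, ← reassoc_of% (T : SymMon C).id_hom_comp,
    ← reassoc_of% (T : SymMon C).id_hom_comp, Category.assoc, med_slide_δL]
  simp only [SymMon.id_hom_comp, Category.assoc]
  rw [e, reassoc_of% e₁, reassoc_of% δL_natural]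

/-- The variant of `δL_med` with the distributivity in the first summand instead of the second,
obtained by conjugating with `med_σP`. -/
theorem δL_exchange_med (A B X A' B' : C) :
    (δL A B X ⅋ₘ 𝟙 (A' ⨂ B')) ≫ (P : SymMon C).exchange (A ⨂ B) X (A' ⨂ B') ≫
        (med A B A' B' ⅋ₘ 𝟙 X) =
      med A (B ⅋ X) A' B' ≫ (𝟙 (A ⅋ A') ⨂ₘ (P : SymMon C).exchange B X B') ≫
        δL (A ⅋ A') (B ⅋ B') X := by
  have e := δL_med A' B' A B X
  have e₁ := med_σP A (B ⅋ X) A' B'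
  have e₂ := med_σP A' B' A B
  have e₃ := (P : SymMon C).braid_braid A A'
  simp only [αP, σP, Iso.symm_hom] at e e₁ e₂
  simp only [exchange, Category.assoc]
  rw [reassoc_of% braid_natural, ← SymMon.hom_comp_id, ← e₂, SymMon.hom_comp_id, reassoc_of% e,
    ← reassoc_of% e₁, ← δL_natural, ← reassoc_of% (T : SymMon C).hom_comp,
    ← reassoc_of% (T : SymMon C).hom_comp, Category.comp_id, e₃, Category.assoc]

/-- The par counterpart of `δL_flipT`: one summand is treated by `δL_exchange_med`, the other by
`δL_med`, and `δL_αP` merges them. It yields the preservation of ∇ by δL. -/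
theorem δL_flipP (A B X A' B' X' : C) :
    (δL A B X ⅋ₘ δL A' B' X') ≫ (P : SymMon C).flip (A ⨂ B) X (A' ⨂ B') X' ≫
        (med A B A' B' ⅋ₘ 𝟙 (X ⅋ X')) =
      med A (B ⅋ X) A' (B' ⅋ X') ≫ (𝟙 (A ⅋ A') ⨂ₘ (P : SymMon C).flip B X B' X') ≫
        δL (A ⅋ A') (B ⅋ B') (X ⅋ X') := by
  have e := δL_med A (B ⅋ X) A' B' X'
  have e₁ := δL_αP (A ⅋ A') (B ⅋ B') X X'
  have e₂ := (P : SymMon C).assoc_inv_natural (δL A B X) (𝟙 (A' ⨂ B')) (𝟙 X')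
  simp only [αP, Iso.symm_hom] at e e₁
  rw [SymMon.hom_id] at e₂
  have e₃ : (𝟙 (A ⅋ A') ⨂ₘ ((P : SymMon C).assoc (B ⅋ B') X X').hom) ≫
      δL (A ⅋ A') (B ⅋ B') (X ⅋ X') = δL (A ⅋ A') ((B ⅋ B') ⅋ X) X' ≫
      (δL (A ⅋ A') (B ⅋ B') X ⅋ₘ 𝟙 X') ≫
        ((P : SymMon C).assoc ((A ⅋ A') ⨂ (B ⅋ B')) X X').hom := by
    rw [← Category.assoc, ← Iso.comp_inv_eq, Category.assoc, e₁,
      ← reassoc_of% (T : SymMon C).id_hom_comp, Iso.hom_inv_id, SymMon.hom_id, Category.id_comp]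
  rw [flip_eq_exchange, flip_eq_exchange, ← SymMon.hom_id, hom_def']
  simp only [Category.assoc, SymMon.id_hom_comp]
  rw [← assoc_natural, reassoc_of% e₂, ← reassoc_of% (P : SymMon C).hom_comp_id,
    ← reassoc_of% (P : SymMon C).hom_comp_id, Category.assoc, δL_exchange_med, e₃]
  simp only [SymMon.hom_comp_id, Category.assoc]
  rw [reassoc_of% e, ← reassoc_of% δL_natural]

theorem δL_top (A B : C) : δL ⊤[C] A B ≫ (((T : SymMon C).left A).hom ⅋ₘ 𝟙 B) =
    ((T : SymMon C).left (A ⅋ B)).hom := by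
  have e : ((T : SymMon C).left (A ⅋ B)).inv ≫ δL ⊤[C] A B =
    ((T : SymMon C).left A).inv ⅋ₘ 𝟙 B := lT_δL A B
  rw [(Iso.inv_comp_eq _).1 e, Category.assoc, ← SymMon.hom_comp_id, Iso.inv_hom_id,
    SymMon.hom_id, Category.comp_id]

theorem δL_bot (A B : C) : (𝟙 A ⨂ₘ (rP B).inv) ≫ δL A B ⊥[C] = (rP (A ⨂ B)).inv := by
  rw [← cancel_mono (rP (A ⨂ B)).hom, Category.assoc, δL_rP, ← SymMon.id_hom_comp,
    Iso.inv_hom_id, Iso.inv_hom_id, SymMon.hom_id]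

namespace MedBimon

/-- The left linear distributivity. -/
def distL (A B E : MedBimon C) : ten A (par B E) ⟶ par (ten A B) E where
  hom := δL A.X B.X E.X
  hom_Δ := by
    simp only [ten, par, MedBimonData.ten, MedBimonData.par, Category.assoc, SymMon.hom_comp_left,
      SymMon.hom_comp_right]
    rw [δL_flipT, reassoc_of% δL_natural]
  hom_e := by
    simp only [ten, par, MedBimonData.ten, MedBimonData.par, rT, Iso.symm_inv, Category.assoc,
      SymMon.hom_comp_left, SymMon.hom_comp_right]
    -- The two unitors of ⊤ coincide; the left one is compatible with δL by `δL_top`.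
    rw [← reassoc_of% δL_natural, ← left_unit, reassoc_of% δL_top, left_natural]
  nab_hom := by
    simp only [ten, par, MedBimonData.ten, MedBimonData.par, Category.assoc, SymMon.comp_hom_left,
      SymMon.comp_hom_right]
    rw [reassoc_of% δL_flipP, δL_natural]
  u_hom := by
    simp only [ten, par, MedBimonData.ten, MedBimonData.par, Category.assoc, SymMon.comp_hom_left,
      SymMon.comp_hom_right]
    rw [δL_natural, reassoc_of% δL_bot]
    exact ((reassoc_of% (P : SymMon C).right_inv_natural Δbot) _).symm

/-- A morphism of medial bimonoids with a prescribed underlying morphism. -/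
def Hom.copy {A B : MedBimon C} (f : A ⟶ B) (g : A.X ⟶ B.X) (h : g = Hom.hom f) : A ⟶ B where
  hom := g
  hom_Δ := by rw [h, Hom.hom_Δ f]
  hom_e := by rw [h, Hom.hom_e f]
  nab_hom := by rw [h, Hom.nab_hom f]
  u_hom := by rw [h, Hom.u_hom f]

/-- The right linear distributivity. -/
def distR (A B E : MedBimon C) : ten (par A B) E ⟶ par A (ten B E) :=
  -- By `δR_σ` this composite of morphisms of bimonoids has δR as underlying map. Recording δR
  -- itself, rather than the composite, lets the axioms of the base category apply definitionally.
  Hom.copy ((tenBraid (par A B) E).hom ≫ tenHom (𝟙 E) (parBraid A B).hom ≫ distL E B A ≫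
    parHom (tenBraid E B).hom (𝟙 A) ≫ (parBraid (ten B E) A).hom)
    (δR A.X B.X E.X) (δR_σ A.X B.X E.X)

/-- The comultiplication is a morphism of medial bimonoids. -/
def diag (A : MedBimon C) : A ⟶ ten A A where
  hom := A.Δ
  -- Here cocommutativity enters: without it the comultiplication need not be a comonoid morphism.
  hom_Δ := A.comonoid.flip
  hom_e := A.comonoid.hom_counit A.e
  nab_hom := A.nab_Δ
  u_hom := A.u_Δ

/-- The counit is a morphism of medial bimonoids. -/
def counit (A : MedBimon C) : A ⟶ top C where
  hom := A.e
  hom_Δ := by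
    change A.e ≫ (rT ⊤[C]).hom = A.Δ ≫ (A.e ⨂ₘ A.e)
    rw [← Iso.eq_comp_inv, Category.assoc]
    exact (A.comonoid.hom_counit A.e).symm
  hom_e := Category.comp_id _
  nab_hom := A.nab_e
  u_hom := A.u_e

/-- The multiplication is a morphism of medial bimonoids. -/
def codiag (A : MedBimon C) : par A A ⟶ A where
  hom := A.nab
  hom_Δ := A.nab_Δ.trans (Category.assoc _ _ _).symm
  hom_e := A.nab_e
  nab_hom := (Category.assoc _ _ _).trans A.monoid.flip
  u_hom := (Category.assoc _ _ _).trans (A.monoid.hom_unit A.u)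

/-- The unit is a morphism of medial bimonoids. -/
def unit (A : MedBimon C) : bot C ⟶ A where
  hom := A.u
  hom_Δ := A.u_Δ
  hom_e := A.u_e
  nab_hom := ((Iso.inv_comp_eq _).1 (A.monoid.hom_unit A.u)).symm
  u_hom := Category.id_comp _

end MedBimon

end MedialDistributivity

/-! ### The category of bimonoids as a cartesian linearly distributive category. -/

section BimonoidCategory

open SymMon

variable {C : Type u₁} [Category.{v₁} C] [SMLDC C]

namespace MedBimon

variable (C) in
/-- The symmetric monoidal structure on medial bimonoids given by the tensor. -/
def tenSymMon : SymMon (MedBimon C) :=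
  letI := (T : SymMon C).mon
  letI := (T : SymMon C).sym
  letI : MonoidalCategory (MedBimon C) :=
    { tensorObj := ten
      tensorHom := tenHom
      whiskerLeft := fun A _ _ f => tenHom (𝟙 A) f
      whiskerRight := fun f A => tenHom f (𝟙 A)
      tensorUnit := top C
      associator := tenAssoc
      leftUnitor := tenLeft
      rightUnitor := tenRight
      -- Morphisms of bimonoids agree as soon as their underlying maps do, so each axiom from here
      -- on is the one of the base category.
      tensorHom_def := fun f g => Hom.ext ((T : SymMon C).hom_def (Hom.hom f) (Hom.hom g))
      id_tensorHom_id := fun A B => Hom.ext ((T : SymMon C).hom_id A.X B.X)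
      tensorHom_comp_tensorHom := fun f g f' g' => Hom.ext
        (MonoidalCategory.tensorHom_comp_tensorHom (Hom.hom f) (Hom.hom g) (Hom.hom f')
          (Hom.hom g'))
      whiskerLeft_id := fun A B => Hom.ext ((T : SymMon C).hom_id A.X B.X)
      id_whiskerRight := fun A B => Hom.ext ((T : SymMon C).hom_id A.X B.X)
      associator_naturality := fun f g h => Hom.ext
        ((T : SymMon C).assoc_natural (Hom.hom f) (Hom.hom g) (Hom.hom h))
      leftUnitor_naturality := fun f => Hom.ext ((T : SymMon C).left_natural (Hom.hom f))
      rightUnitor_naturality := fun f => Hom.ext ((T : SymMon C).right_natural (Hom.hom f))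
      pentagon := fun A B E F => Hom.ext ((T : SymMon C).pentagon A.X B.X E.X F.X)
      triangle := fun A B => Hom.ext ((T : SymMon C).triangle A.X B.X) }
  { mon := inferInstance
    sym :=
      { braiding := tenBraid
        braiding_naturality_right := fun A _ _ f =>
          Hom.ext ((T : SymMon C).braid_natural (𝟙 A.X) (Hom.hom f))
        braiding_naturality_left := fun f A =>
          Hom.ext ((T : SymMon C).braid_natural (Hom.hom f) (𝟙 A.X))
        hexagon_forward := fun A B E => Hom.ext ((T : SymMon C).hexagon_forward A.X B.X E.X)
        hexagon_reverse := fun A B E => Hom.ext ((T : SymMon C).hexagon_reverse A.X B.X E.X)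
        symmetry := fun A B => Hom.ext ((T : SymMon C).braid_braid A.X B.X) } }

variable (C) in
/-- The symmetric monoidal structure on medial bimonoids given by the par. -/
def parSymMon : SymMon (MedBimon C) :=
  letI := (P : SymMon C).mon
  letI := (P : SymMon C).sym
  letI : MonoidalCategory (MedBimon C) :=
    { tensorObj := par
      tensorHom := parHom
      whiskerLeft := fun A _ _ f => parHom (𝟙 A) f
      whiskerRight := fun f A => parHom f (𝟙 A)
      tensorUnit := bot C
      associator := parAssoc
      leftUnitor := parLeft
      rightUnitor := parRight
      tensorHom_def := fun f g => Hom.ext ((P : SymMon C).hom_def (Hom.hom f) (Hom.hom g))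
      id_tensorHom_id := fun A B => Hom.ext ((P : SymMon C).hom_id A.X B.X)
      tensorHom_comp_tensorHom := fun f g f' g' => Hom.ext
        (MonoidalCategory.tensorHom_comp_tensorHom (Hom.hom f) (Hom.hom g) (Hom.hom f')
          (Hom.hom g'))
      whiskerLeft_id := fun A B => Hom.ext ((P : SymMon C).hom_id A.X B.X)
      id_whiskerRight := fun A B => Hom.ext ((P : SymMon C).hom_id A.X B.X)
      associator_naturality := fun f g h => Hom.ext
        ((P : SymMon C).assoc_natural (Hom.hom f) (Hom.hom g) (Hom.hom h))
      leftUnitor_naturality := fun f => Hom.ext ((P : SymMon C).left_natural (Hom.hom f))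
      rightUnitor_naturality := fun f => Hom.ext ((P : SymMon C).right_natural (Hom.hom f))
      pentagon := fun A B E F => Hom.ext ((P : SymMon C).pentagon A.X B.X E.X F.X)
      triangle := fun A B => Hom.ext ((P : SymMon C).triangle A.X B.X) }
  { mon := inferInstance
    sym :=
      { braiding := parBraid
        braiding_naturality_right := fun A _ _ f =>
          Hom.ext ((P : SymMon C).braid_natural (𝟙 A.X) (Hom.hom f))
        braiding_naturality_left := fun f A =>
          Hom.ext ((P : SymMon C).braid_natural (Hom.hom f) (𝟙 A.X))
        hexagon_forward := fun A B E => Hom.ext ((P : SymMon C).hexagon_forward A.X B.X E.X)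
        hexagon_reverse := fun A B E => Hom.ext ((P : SymMon C).hexagon_reverse A.X B.X E.X)
        symmetry := fun A B => Hom.ext ((P : SymMon C).braid_braid A.X B.X) } }

/-- Forgetting to `C` is faithful and strictly preserves all the structure, so each coherence law is
inherited at the underlying objects. -/
instance : SLDC (MedBimon C) where
  T := tenSymMon C
  P := parSymMon C
  δL := distL
  δR := distR
  δL_natural f g h := Hom.ext (δL_natural (Hom.hom f) (Hom.hom g) (Hom.hom h))
  δR_natural f g h := Hom.ext (δR_natural (Hom.hom f) (Hom.hom g) (Hom.hom h))
  lT_δL A B := Hom.ext (lT_δL A.X B.X)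
  rT_δR A B := Hom.ext (rT_δR A.X B.X)
  δR_lP A B := Hom.ext (δR_lP A.X B.X)
  δL_rP A B := Hom.ext (δL_rP A.X B.X)
  δL_αT A B X Y := Hom.ext (δL_αT A.X B.X X.X Y.X)
  αT_δR A B X Y := Hom.ext (αT_δR A.X B.X X.X Y.X)
  δL_αP A B X Y := Hom.ext (δL_αP A.X B.X X.X Y.X)
  αP_δR A B X Y := Hom.ext (αP_δR A.X B.X X.X Y.X)
  δL_δR A B X Y := Hom.ext (δL_δR A.X B.X X.X Y.X)
  δR_δL A B X Y := Hom.ext (δR_δL A.X B.X X.X Y.X)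
  δR_σ A B X := Hom.ext (δR_σ A.X B.X X.X)

/-- The first projection of the tensor. -/
def fst (A B : MedBimon C) : ten A B ⟶ A := tenHom (𝟙 A) (counit B) ≫ (tenRight A).hom

/-- The second projection of the tensor. -/
def snd (A B : MedBimon C) : ten A B ⟶ B := tenHom (counit A) (𝟙 B) ≫ (tenLeft B).hom

/-- The pairing of two morphisms. -/
def lift {Z A B : MedBimon C} (f : Z ⟶ A) (g : Z ⟶ B) : Z ⟶ ten A B := diag Z ≫ tenHom f g

theorem lift_fst {Z A B : MedBimon C} (f : Z ⟶ A) (g : Z ⟶ B) : lift f g ≫ fst A B = f := by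
  refine Hom.ext ?_
  change (Z.Δ ≫ (Hom.hom f ⨂ₘ Hom.hom g)) ≫ (𝟙 A.X ⨂ₘ B.e) ≫
    ((T : SymMon C).right A.X).hom = Hom.hom f
  rw [Category.assoc, ← reassoc_of% (T : SymMon C).hom_comp, Category.comp_id, Hom.hom_e g,
    Z.comonoid.hom_counit]

theorem lift_snd {Z A B : MedBimon C} (f : Z ⟶ A) (g : Z ⟶ B) : lift f g ≫ snd A B = g := by
  refine Hom.ext ?_
  change (Z.Δ ≫ (Hom.hom f ⨂ₘ Hom.hom g)) ≫ (A.e ⨂ₘ 𝟙 B.X) ≫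
    ((T : SymMon C).left B.X).hom = Hom.hom g
  rw [Category.assoc, ← reassoc_of% (T : SymMon C).hom_comp, Category.comp_id, Hom.hom_e f,
    Z.comonoid.counit_hom]

/-- Naturality moves the two counits to the inner positions before the flip, which is then a flip of
units and hence trivial (`flip_unit`). What remains is one counit law in A and one in B. Uniqueness
of pairings follows by precomposition. -/
theorem lift_fst_snd (A B : MedBimon C) : lift (fst A B) (snd A B) = 𝟙 _ := by
  refine Hom.ext ?_
  change ((A.Δ ⨂ₘ B.Δ) ≫ (T : SymMon C).flip A.X A.X B.X B.X) ≫
    (((𝟙 A.X ⨂ₘ B.e) ≫ ((T : SymMon C).right A.X).hom) ⨂ₘ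
      ((A.e ⨂ₘ 𝟙 B.X) ≫ ((T : SymMon C).left B.X).hom)) = 𝟙 _
  rw [Category.assoc, SymMon.hom_comp, ← reassoc_of% flip_natural, flip_unit, Category.id_comp,
    ← SymMon.hom_comp, ← SymMon.hom_comp, A.comonoid.counit_right, B.comonoid.counit_left,
    SymMon.hom_id]

/-- This is naturality of the diagonal: `h` commutes with comultiplications. -/
theorem comp_lift {Z Z' A B : MedBimon C} (h : Z' ⟶ Z) (f : Z ⟶ A) (g : Z ⟶ B) :
    h ≫ lift f g = lift (h ≫ f) (h ≫ g) := by
  refine Hom.ext ?_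
  change Hom.hom h ≫ Z.Δ ≫ (Hom.hom f ⨂ₘ Hom.hom g) =
    Z'.Δ ≫ ((Hom.hom h ≫ Hom.hom f) ⨂ₘ (Hom.hom h ≫ Hom.hom g))
  rw [SymMon.hom_comp, reassoc_of% Hom.hom_Δ h]

theorem lift_unique {Z A B : MedBimon C} (m : Z ⟶ ten A B) :
    m = lift (m ≫ fst A B) (m ≫ snd A B) := by
  rw [← comp_lift, lift_fst_snd, Category.comp_id]

variable (C) in
/-- The tensor unit is terminal. -/
def isTerminalTop : Limits.IsTerminal (top C) :=
  Limits.IsTerminal.ofUniqueHom counit fun _ f =>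
    -- The counit of ⊤ is the identity, so preservation of counits already determines the map.
    Hom.ext ((Category.comp_id _).symm.trans (Hom.hom_e f))

theorem isCartesian : (tenSymMon C).IsCartesian where
  terminal := ⟨isTerminalTop C⟩
  product t A B := by
    -- Witnesses of terminality are unique, so the projections in question are those built from the
    -- counits.
    obtain rfl : t = isTerminalTop C := Subsingleton.elim _ _
    exact ⟨Limits.BinaryFan.isLimitMk (fun s => lift s.fst s.snd) (fun s => lift_fst _ _)
      (fun s => lift_snd _ _) (fun s m h₁ h₂ => by rw [← h₁, ← h₂]; exact lift_unique m)⟩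

/-- The first injection of the par. -/
def inl (A B : MedBimon C) : A ⟶ par A B := (parRight A).inv ≫ parHom (𝟙 A) (unit B)

/-- The second injection of the par. -/
def inr (A B : MedBimon C) : B ⟶ par A B := (parLeft B).inv ≫ parHom (unit A) (𝟙 B)

/-- The copairing of two morphisms. -/
def desc {Z A B : MedBimon C} (f : A ⟶ Z) (g : B ⟶ Z) : par A B ⟶ Z := parHom f g ≫ codiag Z

theorem inl_desc {Z A B : MedBimon C} (f : A ⟶ Z) (g : B ⟶ Z) : inl A B ≫ desc f g = f := by
  refine Hom.ext ?_
  change (((P : SymMon C).right A.X).inv ≫ (𝟙 A.X ⅋ₘ B.u)) ≫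
    (Hom.hom f ⅋ₘ Hom.hom g) ≫ Z.nab = Hom.hom f
  rw [Category.assoc, ← reassoc_of% (P : SymMon C).hom_comp, Category.id_comp, Hom.u_hom g,
    Z.monoid.hom_unit]

theorem inr_desc {Z A B : MedBimon C} (f : A ⟶ Z) (g : B ⟶ Z) : inr A B ≫ desc f g = g := by
  refine Hom.ext ?_
  change (((P : SymMon C).left B.X).inv ≫ (A.u ⅋ₘ 𝟙 B.X)) ≫
    (Hom.hom f ⅋ₘ Hom.hom g) ≫ Z.nab = Hom.hom g
  rw [Category.assoc, ← reassoc_of% (P : SymMon C).hom_comp, Category.id_comp, Hom.u_hom f,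
    Z.monoid.unit_hom]

/-- Dual to `lift_fst_snd`: the units reach the inner positions of the flip, which disappears, and
the unit laws of A and B finish. -/
theorem desc_inl_inr (A B : MedBimon C) : desc (inl A B) (inr A B) = 𝟙 _ := by
  refine Hom.ext ?_
  change ((((P : SymMon C).right A.X).inv ≫ (𝟙 A.X ⅋ₘ B.u)) ⅋ₘ
    (((P : SymMon C).left B.X).inv ≫ (A.u ⅋ₘ 𝟙 B.X))) ≫
      (P : SymMon C).flip A.X B.X A.X B.X ≫ (A.nab ⅋ₘ B.nab) = 𝟙 _
  rw [SymMon.hom_comp, Category.assoc, reassoc_of% flip_natural, flip_unit, Category.id_comp,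
    ← SymMon.hom_comp, ← SymMon.hom_comp, A.monoid.unit_right, B.monoid.unit_left,
    SymMon.hom_id]

theorem desc_comp {Z Z' A B : MedBimon C} (f : A ⟶ Z) (g : B ⟶ Z) (h : Z ⟶ Z') :
    desc f g ≫ h = desc (f ≫ h) (g ≫ h) := by
  refine Hom.ext ?_
  change ((Hom.hom f ⅋ₘ Hom.hom g) ≫ Z.nab) ≫ Hom.hom h =
    ((Hom.hom f ≫ Hom.hom h) ⅋ₘ (Hom.hom g ≫ Hom.hom h)) ≫ Z'.nab
  rw [SymMon.hom_comp, Category.assoc, Category.assoc, Hom.nab_hom h]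

theorem desc_unique {Z A B : MedBimon C} (m : par A B ⟶ Z) :
    m = desc (inl A B ≫ m) (inr A B ≫ m) := by
  rw [← desc_comp, desc_inl_inr, Category.id_comp]

variable (C) in
/-- The par unit is initial. -/
def isInitialBot : Limits.IsInitial (bot C) :=
  Limits.IsInitial.ofUniqueHom unit fun _ f =>
    Hom.ext ((Category.id_comp _).symm.trans (Hom.u_hom f))

theorem isCocartesian : (parSymMon C).IsCocartesian where
  initial := ⟨isInitialBot C⟩
  coproduct t A B := by
    obtain rfl : t = isInitialBot C := Subsingleton.elim _ _
    exact ⟨Limits.BinaryCofan.isColimitMk (fun s => desc s.inl s.inr) (fun s => inl_desc _ _)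
      (fun s => inr_desc _ _) (fun s m h₁ h₂ => by rw [← h₁, ← h₂]; exact desc_unique m)⟩

instance : CLDC (MedBimon C) where
  cartesian := isCartesian
  cocartesian := isCocartesian

end MedBimon

variable (C) in
theorem isBimonSLDC : IsBimonSLDC C where
  top := rfl
  bot := rfl
  ten _ _ := rfl
  par _ _ := rfl
  ten_hom _ _ := .intro
  par_hom _ _ := .intro
  αT_over _ _ _ := .intro
  lT_over _ := .intro
  rT_over _ := .intro
  σT_over _ _ := .intro
  αP_over _ _ _ := .intro
  lP_over _ := .intro
  rP_over _ := .intro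
  σP_over _ _ := .intro
  δL_over _ _ _ := .intro
  δR_over _ _ _ := .intro

end BimonoidCategory

/-! ### The action on medial linear functors and medial linear transformations. -/

section BimonoidFunctors

open SymMon

variable {C : Type u₁} [Category.{v₁} C] {D : Type u₂} [Category.{v₂} D]

theorem SymMon.Lax.unitMap_right {M : SymMon C} {N : SymMon D} {F : C ⥤ D} (h : M.Lax N F) :
    N.hom h.unitMap h.unitMap ≫ h.prodMap M.unit M.unit ≫ F.map (M.right M.unit).hom =
      (N.right N.unit).hom ≫ h.unitMap := by
  rw [SymMon.hom_def, Category.assoc, h.unit_right, right_natural]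

theorem SymMon.Lax.unitMap_right_inv {M : SymMon C} {N : SymMon D} {F : C ⥤ D} (h : M.Lax N F) :
    (N.right N.unit).inv ≫ N.hom h.unitMap h.unitMap ≫ h.prodMap M.unit M.unit =
      h.unitMap ≫ F.map (M.right M.unit).inv := by
  have e := (N.right N.unit).inv ≫= h.unitMap_right =≫ F.map (M.right M.unit).inv
  simp only [Category.assoc, Iso.inv_hom_id_assoc] at e
  rwa [← F.map_comp, Iso.hom_inv_id, F.map_id, Category.comp_id] at e

theorem SymMon.Strong.unitInv_right {M : SymMon C} {N : SymMon D} {F : C ⥤ D} (h : M.Strong N F) :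
    h.prodMap M.unit M.unit ≫ F.map (M.right M.unit).hom ≫ h.unitInv =
      N.hom h.unitInv h.unitInv ≫ (N.right N.unit).hom := by
  have e := N.hom h.unitInv h.unitInv ≫= h.unitMap_right =≫ h.unitInv
  simp only [Category.assoc, h.unitMap_unitInv, Category.comp_id] at e
  rwa [← reassoc_of% N.hom_comp, h.unitInv_unitMap, SymMon.hom_id, Category.id_comp] at e

theorem SymMon.Strong.flip_prodInv {M : SymMon C} {N : SymMon D} {F : C ⥤ D} (h : M.Strong N F)
    (A B X Y : C) : F.map (M.flip A B X Y) ≫ h.prodInv (M.obj A X) (M.obj B Y) =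
      h.prodInv (M.obj A B) (M.obj X Y) ≫ N.hom (h.prodInv A B) (h.prodInv X Y) ≫
        N.flip (F.obj A) (F.obj B) (F.obj X) (F.obj Y) ≫ N.hom (h.prodMap A X) (h.prodMap B Y) := by
  have e := h.oplax.flip A B X Y =≫ N.hom (h.prodMap A X) (h.prodMap B Y)
  simp only [Category.assoc] at e
  refine Eq.trans ?_ e
  change _ = F.map _ ≫ h.prodInv _ _ ≫ N.hom (h.prodInv _ _) (h.prodInv _ _) ≫ _
  rw [← SymMon.hom_comp, h.prodInv_prodMap, h.prodInv_prodMap, SymMon.hom_id, Category.comp_id]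

variable [SMLDC C] [SMLDC D]

/-- The left strength is the right one conjugated by symmetries, so only right strengths have to be
checked to preserve the bimonoid structure. -/
theorem LinFunctor.vLT_eq (F : LinFunctor C D) (A B : C) :
    F.vLT A B = F.FT.map (σP A B).hom ≫ F.vRT B A ≫ (σP (F.FP.obj B) (F.FT.obj A)).hom := by
  have e : (σP A B).hom ≫ (σP B A).hom = 𝟙 _ := (P : SymMon C).braid_braid A B
  rw [F.vT_braid, ← F.FT.map_comp_assoc, e, F.FT.map_id, Category.id_comp]

theorem LinFunctor.vLP_eq (F : LinFunctor C D) (A B : C) :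
    F.vLP A B = (σT (F.FP.obj A) (F.FT.obj B)).hom ≫ F.vRP B A ≫ F.FP.map (σT B A).hom := by
  have e : (σT (F.FP.obj A) (F.FT.obj B)).hom ≫ (σT (F.FT.obj B) (F.FP.obj A)).hom = 𝟙 _ :=
    (T : SymMon D).braid_braid _ _
  rw [F.vP_braid, reassoc_of% e]

namespace LinTrans

variable {F G : LinFunctor C D} (α : LinTrans F G)

/-- The comonoid structure on F_⊗ A involves the inverses of the strong structure maps, whereas the
axioms of a transformation concern the maps themselves; this and its three companions pass from one
to the other. -/
theorem unitInv_τT : α.τT.app ⊤[C] ≫ G.strT.unitInv = F.strT.unitInv := by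
  have e := F.strT.unitInv ≫= α.τT_unit =≫ G.strT.unitInv
  simpa only [Category.assoc, reassoc_of% F.strT.unitInv_unitMap, G.strT.unitMap_unitInv,
    Category.comp_id] using e

theorem prodInv_τT (A B : C) : α.τT.app (A ⨂ B) ≫ G.strT.prodInv A B =
    F.strT.prodInv A B ≫ (α.τT.app A ⨂ₘ α.τT.app B) := by
  have e := F.strT.prodInv A B ≫= α.τT_prod A B =≫ G.strT.prodInv A B
  simpa only [Category.assoc, reassoc_of% F.strT.prodInv_prodMap, G.strT.prodMap_prodInv,
    Category.comp_id] using e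

theorem unitMap_τP : G.strP.unitMap ≫ α.τP.app ⊥[C] = F.strP.unitMap := by
  have e := G.strP.unitMap ≫= α.τP_unit =≫ F.strP.unitMap
  simpa only [Category.assoc, F.strP.unitInv_unitMap, reassoc_of% G.strP.unitMap_unitInv,
    Category.comp_id] using e

theorem prodMap_τP (A B : C) : G.strP.prodMap A B ≫ α.τP.app (A ⅋ B) =
    (α.τP.app A ⅋ₘ α.τP.app B) ≫ F.strP.prodMap A B := by
  have e := G.strP.prodMap A B ≫= α.τP_prod A B =≫ F.strP.prodMap A B
  simpa only [Category.assoc, F.strP.prodInv_prodMap, reassoc_of% G.strP.prodMap_prodInv,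
    Category.comp_id] using e

end LinTrans

variable (C) in
theorem rP_bot : rP ⊥[C] = lP ⊥[C] := (P : SymMon C).left_unit.symm

variable (C) in
theorem rT_top : rT ⊤[C] = lT ⊤[C] := congrArg Iso.symm (T : SymMon C).left_unit.symm

namespace MedialFunctor

variable (F : MedialFunctor C D)

/-- `FT_med` with the invertible tensor constraints moved across, the form in which F_⊗ A satisfies
the law for ∇ followed by Δ. -/
theorem laxP_med (A B X Y : C) :
    F.laxP.prodMap (A ⨂ B) (X ⨂ Y) ≫ F.FT.map (med A B X Y) ≫ F.strT.prodInv (A ⅋ X) (B ⅋ Y) =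
      (F.strT.prodInv A B ⅋ₘ F.strT.prodInv X Y) ≫
        med (F.FT.obj A) (F.FT.obj B) (F.FT.obj X) (F.FT.obj Y) ≫
          (F.laxP.prodMap A X ⨂ₘ F.laxP.prodMap B Y) := by
  have e : med (F.FT.obj A) (F.FT.obj B) (F.FT.obj X) (F.FT.obj Y) ≫
      (F.laxP.prodMap A X ⨂ₘ F.laxP.prodMap B Y) =
    (F.strT.prodMap A B ⅋ₘ F.strT.prodMap X Y) ≫ F.laxP.prodMap (A ⨂ B) (X ⨂ Y) ≫
      F.FT.map (med A B X Y) ≫ F.strT.prodInv (A ⅋ X) (B ⅋ Y) := by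
    rw [reassoc_of% F.FT_med, F.strT.prodMap_prodInv, Category.comp_id]
  rw [e, ← reassoc_of% (P : SymMon D).hom_comp, F.strT.prodInv_prodMap, F.strT.prodInv_prodMap,
    SymMon.hom_id, Category.id_comp]

theorem laxP_nabTop :
    F.laxP.prodMap ⊤[C] ⊤[C] ≫ F.FT.map nabTop ≫ F.strT.unitInv =
      (F.strT.unitInv ⅋ₘ F.strT.unitInv) ≫ nabTop := by
  have e : (nabTop : _ ⟶ ⊤[D]) = (F.strT.unitMap ⅋ₘ F.strT.unitMap) ≫
      F.laxP.prodMap ⊤[C] ⊤[C] ≫ F.FT.map nabTop ≫ F.strT.unitInv := by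
    rw [reassoc_of% F.FT_nabTop, F.strT.unitMap_unitInv, Category.comp_id]
  rw [e, ← reassoc_of% (P : SymMon D).hom_comp, F.strT.unitInv_unitMap, SymMon.hom_id,
    Category.id_comp]

theorem oplaxT_med (A B X Y : C) :
    F.strP.prodMap (A ⨂ B) (X ⨂ Y) ≫ F.FP.map (med A B X Y) ≫ F.oplaxT.prodMap (A ⅋ X) (B ⅋ Y) =
      (F.oplaxT.prodMap A B ⅋ₘ F.oplaxT.prodMap X Y) ≫
        med (F.FP.obj A) (F.FP.obj B) (F.FP.obj X) (F.FP.obj Y) ≫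
          (F.strP.prodMap A X ⨂ₘ F.strP.prodMap B Y) := by
  have e : F.FP.map (med A B X Y) ≫ F.oplaxT.prodMap (A ⅋ X) (B ⅋ Y) =
      F.strP.prodInv (A ⨂ B) (X ⨂ Y) ≫ (F.oplaxT.prodMap A B ⅋ₘ F.oplaxT.prodMap X Y) ≫
        med (F.FP.obj A) (F.FP.obj B) (F.FP.obj X) (F.FP.obj Y) ≫
          (F.strP.prodMap A X ⨂ₘ F.strP.prodMap B Y) := by
    rw [← reassoc_of% F.FP_med, ← SymMon.hom_comp, F.strP.prodInv_prodMap, F.strP.prodInv_prodMap,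
      SymMon.hom_id, Category.comp_id]
  rw [e, reassoc_of% F.strP.prodMap_prodInv]

theorem oplaxT_Δbot :
    F.strP.unitMap ≫ F.FP.map Δbot ≫ F.oplaxT.prodMap ⊥[C] ⊥[C] =
      Δbot ≫ (F.strP.unitMap ⨂ₘ F.strP.unitMap) := by
  have e : F.FP.map Δbot ≫ F.oplaxT.prodMap ⊥[C] ⊥[C] =
      F.strP.unitInv ≫ Δbot ≫ (F.strP.unitMap ⨂ₘ F.strP.unitMap) := by
    rw [← reassoc_of% F.FP_Δbot, ← SymMon.hom_comp, F.strP.unitInv_unitMap, SymMon.hom_id,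
      Category.comp_id]
  rw [e, reassoc_of% F.strP.unitMap_unitInv]

/-- The axiom `vRT_laxP` has the strength in the first summand; conjugating by the braidings moves
it to the second. -/
theorem laxP_slide_vRT (A B X : C) :
    F.laxP.prodMap B (A ⅋ X) ≫ F.FT.map ((P : SymMon C).slide B A X) ≫ F.vRT A (B ⅋ X) =
      (𝟙 (F.FT.obj B) ⅋ₘ F.vRT A X) ≫
        (P : SymMon D).slide (F.FT.obj B) (F.FP.obj A) (F.FT.obj X) ≫
          (𝟙 (F.FP.obj A) ⅋ₘ F.laxP.prodMap B X) := by
  have e := F.vRT_laxP A X B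
  simp only [αP, Iso.symm_inv] at e
  rw [slide_eq_braid', slide_eq_braid']
  simp only [F.FT.map_comp, Category.assoc]
  rw [reassoc_of% F.laxP.braided, ← F.vRT_right, reassoc_of% e, ← SymMon.id_hom_comp,
    F.laxP.braided, SymMon.id_hom_comp, reassoc_of% braid_natural]

/-- Split the flip through `slide`: `vRT_laxP` handles one strength and `laxP_slide_vRT` the other,
while `vRT_assoc` combines two successive strengths into one. This is why v^R_⊗ preserves ∇. -/
theorem laxP_flip_vRT (A B A' B' : C) :
    F.laxP.prodMap (A ⅋ B) (A' ⅋ B') ≫ F.FT.map ((P : SymMon C).flip A B A' B') ≫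
        F.vRT (A ⅋ A') (B ⅋ B') =
      (F.vRT A B ⅋ₘ F.vRT A' B') ≫
        (P : SymMon D).flip (F.FP.obj A) (F.FT.obj B) (F.FP.obj A') (F.FT.obj B') ≫
          (F.strP.prodMap A A' ⅋ₘ F.laxP.prodMap B B') := by
  have e := F.vRT_laxP A B (A' ⅋ B')
  have e₁ := F.vRT_assoc A A' (B ⅋ B')
  have e₂ := (P : SymMon D).assoc_natural (𝟙 (F.FP.obj A)) (𝟙 (F.FT.obj B)) (F.vRT A' B')
  have e₃ := (P : SymMon D).assoc_inv_natural (𝟙 (F.FP.obj A)) (𝟙 (F.FP.obj A'))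
    (F.laxP.prodMap B B')
  simp only [αP, Iso.symm_inv, Iso.symm_hom] at e e₁
  rw [SymMon.hom_id] at e₂ e₃
  have e₄ : F.FT.map ((P : SymMon C).assoc A A' (B ⅋ B')).inv ≫ F.vRT (A ⅋ A') (B ⅋ B') =
      F.vRT A (A' ⅋ (B ⅋ B')) ≫ (𝟙 (F.FP.obj A) ⅋ₘ F.vRT A' (B ⅋ B')) ≫
        ((P : SymMon D).assoc _ _ _).inv ≫ (F.strP.prodMap A A' ⅋ₘ 𝟙 _) := by
    rw [reassoc_of% e₁, ← SymMon.hom_comp_id, F.strP.prodInv_prodMap, SymMon.hom_id,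
      Category.comp_id]
  rw [flip_eq, flip_eq, hom_def' _ (F.strP.prodMap A A'), hom_def _ (F.vRT A B)]
  simp only [F.FT.map_comp, Category.assoc]
  rw [e₄, ← reassoc_of% F.vRT_right, reassoc_of% e, ← reassoc_of% (P : SymMon D).id_hom_comp,
    ← reassoc_of% (P : SymMon D).id_hom_comp, Category.assoc, laxP_slide_vRT]
  simp only [SymMon.id_hom_comp, Category.assoc]
  rw [reassoc_of% e₃, reassoc_of% e₂]

theorem laxP_unit_vRT :
    F.laxP.unitMap ≫ F.FT.map (rP ⊥[C]).inv ≫ F.vRT ⊥[C] ⊥[C] =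
      (rP ⊥[D]).inv ≫ (F.strP.unitMap ⅋ₘ F.laxP.unitMap) := by
  have e := F.vRT_unit ⊥[C]
  -- The unit law of the strength, at ⊥, determines the strength there because the comparison map
  -- for ⊥ is invertible.
  have e₁ : F.vRT ⊥[C] ⊥[C] = F.FT.map (lP ⊥[C]).hom ≫ (lP (F.FT.obj ⊥[C])).inv ≫
      (F.strP.unitMap ⅋ₘ 𝟙 _) := by
    rw [← e]
    simp only [Category.assoc, Iso.hom_inv_id_assoc]
    rw [← SymMon.hom_comp_id, F.strP.unitInv_unitMap, SymMon.hom_id, Category.comp_id]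
  have e₂ : F.laxP.unitMap ≫ (lP (F.FT.obj ⊥[C])).inv = _ :=
    ((P : SymMon D).left_inv_natural F.laxP.unitMap).symm
  rw [e₁, rP_bot, rP_bot, ← F.FT.map_comp_assoc, Iso.inv_hom_id, F.FT.map_id, Category.id_comp,
    reassoc_of% e₂, hom_def' _ F.strP.unitMap F.laxP.unitMap]
  rfl

theorem vRP_slide_oplaxT (A B X : C) :
    F.vRP A (B ⨂ X) ≫ F.FP.map ((T : SymMon C).slide A B X) ≫ F.oplaxT.prodMap B (A ⨂ X) =
      (𝟙 (F.FT.obj A) ⨂ₘ F.oplaxT.prodMap B X) ≫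
        (T : SymMon D).slide (F.FT.obj A) (F.FP.obj B) (F.FP.obj X) ≫
          (𝟙 (F.FP.obj B) ⨂ₘ F.vRP A X) := by
  have e := F.vRP_oplaxT A X B
  simp only [αT] at e
  rw [slide_eq_braid, slide_eq_braid]
  simp only [F.FP.map_comp, Category.assoc]
  rw [F.oplaxT.braided, ← reassoc_of% F.vRP_right, reassoc_of% e,
    ← reassoc_of% (T : SymMon D).id_hom_comp, F.oplaxT.braided, SymMon.id_hom_comp, braid_natural,
    Category.assoc]

/-- Dual of `laxP_flip_vRT`, with `vRP_oplaxT`, its conjugate by the symmetries and `vRP_assoc` as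
ingredients. This is why v^R_⊕ preserves Δ. -/
theorem vRP_flip_oplaxT (A A' B B' : C) :
    F.vRP (A ⨂ A') (B ⨂ B') ≫ F.FP.map ((T : SymMon C).flip A A' B B') ≫
        F.oplaxT.prodMap (A ⨂ B) (A' ⨂ B') =
      (F.strT.prodInv A A' ⨂ₘ F.oplaxT.prodMap B B') ≫
        (T : SymMon D).flip (F.FT.obj A) (F.FT.obj A') (F.FP.obj B) (F.FP.obj B') ≫
          (F.vRP A B ⨂ₘ F.vRP A' B') := by
  have e := F.vRP_oplaxT A B (A' ⨂ B')
  have e₁ := F.vRP_assoc A A' (B ⨂ B')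
  have e₂ := (T : SymMon D).assoc_natural (𝟙 (F.FT.obj A)) (𝟙 (F.FT.obj A'))
    (F.oplaxT.prodMap B B')
  have e₃ := (T : SymMon D).assoc_inv_natural (𝟙 (F.FT.obj A)) (𝟙 (F.FP.obj B))
    (F.vRP A' B')
  simp only [αT] at e e₁
  rw [SymMon.hom_id] at e₂ e₃
  have e₄ : F.vRP (A ⨂ A') (B ⨂ B') ≫ F.FP.map ((T : SymMon C).assoc A A' (B ⨂ B')).hom =
      (F.strT.prodInv A A' ⨂ₘ 𝟙 _) ≫ ((T : SymMon D).assoc _ _ _).hom ≫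
        (𝟙 (F.FT.obj A) ⨂ₘ F.vRP A' (B ⨂ B')) ≫ F.vRP A (A' ⨂ (B ⨂ B')) := by
    rw [e₁, ← reassoc_of% (T : SymMon D).hom_comp_id, F.strT.prodInv_prodMap, SymMon.hom_id,
      Category.id_comp]
  rw [flip_eq, flip_eq, hom_def' _ (F.vRP A B), hom_def _ (F.strT.prodInv A A')]
  simp only [F.FP.map_comp, Category.assoc]
  rw [reassoc_of% e₄, ← reassoc_of% F.vRP_right, e, ← reassoc_of% (T : SymMon D).id_hom_comp,
    ← reassoc_of% (T : SymMon D).id_hom_comp, Category.assoc, vRP_slide_oplaxT]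
  simp only [SymMon.id_hom_comp, Category.assoc]
  rw [reassoc_of% e₂, reassoc_of% e₃]

theorem vRP_unit_oplaxT :
    F.vRP ⊤[C] ⊤[C] ≫ F.FP.map (rT ⊤[C]).inv ≫ F.oplaxT.unitMap =
      (F.strT.unitInv ⨂ₘ F.oplaxT.unitMap) ≫ (rT ⊤[D]).inv := by
  have e := F.vRP_unit ⊤[C]
  have e₁ : F.vRP ⊤[C] ⊤[C] = (F.strT.unitInv ⨂ₘ 𝟙 _) ≫ (lT (F.FP.obj ⊤[C])).inv ≫
      F.FP.map (lT ⊤[C]).hom := by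
    rw [← e, Iso.inv_hom_id_assoc, ← reassoc_of% (T : SymMon D).hom_comp_id,
      F.strT.unitInv_unitMap, SymMon.hom_id, Category.id_comp]
  have e₂ : (lT (F.FP.obj ⊤[C])).inv ≫ F.oplaxT.unitMap = _ :=
    ((T : SymMon D).left_natural F.oplaxT.unitMap).symm
  rw [e₁, rT_top, rT_top]
  simp only [Category.assoc]
  rw [← F.FP.map_comp_assoc, Iso.hom_inv_id, F.FP.map_id, Category.id_comp, e₂,
    hom_def _ F.strT.unitInv F.oplaxT.unitMap, Category.assoc]
  rfl

end MedialFunctor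

namespace MedBimon

variable (F : MedialFunctor C D)

/-- The image of a medial bimonoid under the tensor component of a medial linear functor. -/
def mapT (A : MedBimon C) : MedBimon D where
  toMedBimonData := A.toMedBimonData.mapT F
  comonoid := F.strT.oplax.map_isCocommComonoid A.comonoid
  monoid := F.laxP.map_isCommMonoid A.monoid
  nab_Δ := by
    simp only [MedBimonData.mapT, SymMon.hom_comp, Category.assoc]
    rw [← reassoc_of% F.laxP_med, F.strT.inv_natural, reassoc_of% F.laxP.natural,
      ← F.FT.map_comp_assoc, A.nab_Δ]
    simp only [F.FT.map_comp, Category.assoc]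
  u_e := by
    simp only [MedBimonData.mapT, Category.assoc]
    rw [← F.FT.map_comp_assoc, A.u_e, ← reassoc_of% F.FT_mix, F.strT.unitMap_unitInv,
      Category.comp_id]
  nab_e := by
    simp only [MedBimonData.mapT, SymMon.hom_comp, Category.assoc]
    rw [← F.laxP_nabTop, reassoc_of% F.laxP.natural, ← F.FT.map_comp_assoc, A.nab_e,
      F.FT.map_comp, Category.assoc]
  u_Δ := by
    simp only [MedBimonData.mapT, SymMon.hom_comp, Category.assoc]
    rw [← F.FT.map_comp_assoc, A.u_Δ, F.FT.map_comp, Category.assoc, ← F.strT.inv_natural,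
      ← reassoc_of% F.FT_Δbot, reassoc_of% F.strT.prodMap_prodInv]

/-- The image of a medial bimonoid under the par component of a medial linear functor. -/
def mapP (A : MedBimon C) : MedBimon D where
  toMedBimonData := A.toMedBimonData.mapP F
  comonoid := F.oplaxT.map_isCocommComonoid A.comonoid
  monoid := F.strP.toLax.map_isCommMonoid A.monoid
  nab_Δ := by
    simp only [MedBimonData.mapP, SymMon.hom_comp, Category.assoc]
    rw [← reassoc_of% F.oplaxT_med, ← F.oplaxT.natural, reassoc_of% F.strP.natural,
      ← F.FP.map_comp_assoc, A.nab_Δ]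
    simp only [F.FP.map_comp, Category.assoc]
  u_e := by
    simp only [MedBimonData.mapP, Category.assoc]
    rw [← F.FP.map_comp_assoc, A.u_e, ← F.FP_mix, reassoc_of% F.strP.unitMap_unitInv]
  nab_e := by
    simp only [MedBimonData.mapP, SymMon.hom_comp, Category.assoc]
    rw [← F.FP.map_comp_assoc, A.nab_e, F.FP.map_comp, Category.assoc, ← F.FP_nabTop,
      ← reassoc_of% F.strP.natural, reassoc_of% F.strP.prodMap_prodInv]
  u_Δ := by
    simp only [MedBimonData.mapP, SymMon.hom_comp, Category.assoc]
    rw [← F.FP.map_comp_assoc, A.u_Δ, F.FP.map_comp, Category.assoc, F.oplaxT.natural,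
      reassoc_of% F.oplaxT_Δbot]

/-- The action on morphisms of the tensor component of a medial linear functor. -/
def mapTHom {A B : MedBimon C} (f : A ⟶ B) : mapT F A ⟶ mapT F B where
  hom := F.FT.map (Hom.hom f)
  hom_Δ := by
    simp only [mapT, MedBimonData.mapT, Category.assoc]
    rw [F.strT.inv_natural, ← F.FT.map_comp_assoc, ← F.FT.map_comp_assoc, Hom.hom_Δ f]
  hom_e := by
    simp only [mapT, MedBimonData.mapT]
    rw [← F.FT.map_comp_assoc, Hom.hom_e f]
  nab_hom := by
    simp only [mapT, MedBimonData.mapT, Category.assoc]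
    rw [reassoc_of% F.laxP.natural, ← F.FT.map_comp, ← F.FT.map_comp, Hom.nab_hom f]
  u_hom := by
    simp only [mapT, MedBimonData.mapT, Category.assoc]
    rw [← F.FT.map_comp, Hom.u_hom f]

/-- The action on morphisms of the par component of a medial linear functor. -/
def mapPHom {A B : MedBimon C} (f : A ⟶ B) : mapP F A ⟶ mapP F B where
  hom := F.FP.map (Hom.hom f)
  hom_Δ := by
    simp only [mapP, MedBimonData.mapP, Category.assoc]
    rw [← F.oplaxT.natural, ← F.FP.map_comp_assoc, ← F.FP.map_comp_assoc, Hom.hom_Δ f]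
  hom_e := by
    simp only [mapP, MedBimonData.mapP]
    rw [← F.FP.map_comp_assoc, Hom.hom_e f]
  nab_hom := by
    simp only [mapP, MedBimonData.mapP, Category.assoc]
    rw [reassoc_of% F.strP.natural, ← F.FP.map_comp, ← F.FP.map_comp, Hom.nab_hom f]
  u_hom := by
    simp only [mapP, MedBimonData.mapP, Category.assoc]
    rw [← F.FP.map_comp, Hom.u_hom f]

/-- The functor on medial bimonoids induced by the tensor component of a medial linear functor. -/
def functorT : MedBimon C ⥤ MedBimon D where
  obj := mapT F
  map := mapTHom F
  map_id A := Hom.ext (F.FT.map_id A.X)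
  map_comp f g := Hom.ext (F.FT.map_comp (Hom.hom f) (Hom.hom g))

/-- The functor on medial bimonoids induced by the par component of a medial linear functor. -/
def functorP : MedBimon C ⥤ MedBimon D where
  obj := mapP F
  map := mapPHom F
  map_id A := Hom.ext (F.FP.map_id A.X)
  map_comp f g := Hom.ext (F.FP.map_comp (Hom.hom f) (Hom.hom g))

/-- The tensor component preserves the tensor unit. -/
def mapTTop : top D ≅ mapT F (top C) :=
  isoMk
    { hom := F.strT.unitMap
      hom_Δ := by
        have e := F.strT.unitMap_right_inv =≫ F.strT.prodInv ⊤[C] ⊤[C]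
        simp only [Category.assoc] at e
        rw [F.strT.prodMap_prodInv, Category.comp_id] at e
        exact e.symm
      hom_e := by
        simp only [mapT, top, MedBimonData.mapT, MedBimonData.top]
        rw [F.FT.map_id, Category.id_comp, F.strT.unitMap_unitInv]
      nab_hom := by
        simp only [mapT, top, MedBimonData.mapT, MedBimonData.top]
        rw [F.FT_nabTop]
      u_hom := F.FT_mix }
    F.strT.unitInv F.strT.unitMap_unitInv F.strT.unitInv_unitMap

/-- The tensor component preserves tensors. -/
def mapTTen (A B : MedBimon C) : ten (mapT F A) (mapT F B) ≅ mapT F (ten A B) :=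
  isoMk
    { hom := F.strT.prodMap A.X B.X
      hom_Δ := by
        simp only [mapT, ten, MedBimonData.mapT, MedBimonData.ten, SymMon.hom_comp, F.FT.map_comp,
          Category.assoc]
        rw [F.strT.flip_prodInv, ← reassoc_of% F.strT.natural,
          reassoc_of% F.strT.prodMap_prodInv]
      hom_e := by
        simp only [mapT, ten, MedBimonData.mapT, MedBimonData.ten, SymMon.hom_comp, F.FT.map_comp,
          Category.assoc]
        rw [← reassoc_of% F.strT.natural]
        exact congrArg (_ ≫ ·) F.strT.unitInv_right
      nab_hom := by
        simp only [mapT, ten, MedBimonData.mapT, MedBimonData.ten, SymMon.hom_comp, F.FT.map_comp,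
          Category.assoc]
        rw [F.strT.natural, reassoc_of% F.FT_med]
      u_hom := by
        simp only [mapT, ten, MedBimonData.mapT, MedBimonData.ten, SymMon.hom_comp, F.FT.map_comp,
          Category.assoc]
        rw [F.strT.natural, reassoc_of% F.FT_Δbot] }
    (F.strT.prodInv A.X B.X) (F.strT.prodMap_prodInv _ _) (F.strT.prodInv_prodMap _ _)

/-- The par component preserves the par unit. -/
def mapPBot : bot D ≅ mapP F (bot C) :=
  isoMk
    { hom := F.strP.unitMap
      hom_Δ := F.oplaxT_Δbot
      hom_e := by
        simp only [mapP, bot, MedBimonData.mapP, MedBimonData.bot]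
        rw [← F.FP_mix, reassoc_of% F.strP.unitMap_unitInv]
      nab_hom := F.strP.unitMap_right.symm
      u_hom := by
        simp only [mapP, bot, MedBimonData.mapP, MedBimonData.bot]
        rw [F.FP.map_id, Category.id_comp, Category.comp_id] }
    F.strP.unitInv F.strP.unitMap_unitInv F.strP.unitInv_unitMap

/-- The par component preserves pars. -/
def mapPPar (A B : MedBimon C) : par (mapP F A) (mapP F B) ≅ mapP F (par A B) :=
  isoMk
    { hom := F.strP.prodMap A.X B.X
      hom_Δ := by
        simp only [mapP, par, MedBimonData.mapP, MedBimonData.par, SymMon.hom_comp, F.FP.map_comp,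
          Category.assoc]
        rw [← reassoc_of% F.strP.natural, F.oplaxT_med]
      hom_e := by
        simp only [mapP, par, MedBimonData.mapP, MedBimonData.par, SymMon.hom_comp, F.FP.map_comp,
          Category.assoc]
        rw [← reassoc_of% F.strP.natural, ← F.FP_nabTop, reassoc_of% F.strP.prodMap_prodInv]
      nab_hom := by
        simp only [mapP, par, MedBimonData.mapP, MedBimonData.par, SymMon.hom_comp, F.FP.map_comp,
          Category.assoc]
        rw [F.strP.natural, reassoc_of% F.strP.flip]
      u_hom := by
        simp only [mapP, par, MedBimonData.mapP, MedBimonData.par, SymMon.hom_comp, F.FP.map_comp,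
          Category.assoc]
        rw [F.strP.natural]
        exact (reassoc_of% F.strP.unitMap_right_inv) _ }
    (F.strP.prodInv A.X B.X) (F.strP.prodMap_prodInv _ _) (F.strP.prodInv_prodMap _ _)

/-- The right linear strength of the tensor component. -/
def strengthRT (A B : MedBimon C) : mapT F (par A B) ⟶ par (mapP F A) (mapT F B) where
  hom := F.vRT A.X B.X
  -- Preservation of Δ and e rests on the axioms `vRT_med` and `vRT_nabTop`; that of ∇ and u on the
  -- derived lemmas about `laxP`.
  hom_Δ := by
    simp only [mapT, mapP, par, MedBimonData.mapT, MedBimonData.mapP, MedBimonData.par,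
      SymMon.hom_comp, F.FT.map_comp, Category.assoc]
    rw [F.vRT_med, reassoc_of% F.vRT_natural]
  hom_e := by
    simp only [mapT, mapP, par, MedBimonData.mapT, MedBimonData.mapP, MedBimonData.par,
      SymMon.hom_comp, F.FT.map_comp, Category.assoc]
    rw [F.vRT_nabTop]
    simp only [Category.assoc]
    rw [F.strT.unitMap_unitInv, Category.comp_id, reassoc_of% F.vRT_natural]
  nab_hom := by
    simp only [mapT, mapP, par, MedBimonData.mapT, MedBimonData.mapP, MedBimonData.par,
      SymMon.hom_comp, F.FT.map_comp, Category.assoc]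
    rw [F.vRT_natural, reassoc_of% F.laxP_flip_vRT]
  u_hom := by
    simp only [mapT, mapP, par, MedBimonData.mapT, MedBimonData.mapP, MedBimonData.par,
      SymMon.hom_comp, F.FT.map_comp, Category.assoc]
    rw [F.vRT_natural, reassoc_of% F.laxP_unit_vRT]

/-- The left linear strength of the tensor component. -/
def strengthLT (A B : MedBimon C) : mapT F (par A B) ⟶ par (mapT F A) (mapP F B) :=
  Hom.copy (mapTHom F (parBraid A B).hom ≫ strengthRT F B A ≫ (parBraid (mapP F B) (mapT F A)).hom)
    (F.vLT A.X B.X) (F.vLT_eq A.X B.X)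

/-- The right linear strength of the par component. -/
def strengthRP (A B : MedBimon C) : ten (mapT F A) (mapP F B) ⟶ mapP F (ten A B) where
  hom := F.vRP A.X B.X
  -- The roles are exchanged here: Δ and e need the derived lemmas about `oplaxT`, while ∇ and u
  -- come from the axioms `vRP_med` and `vRP_Δbot`.
  hom_Δ := by
    simp only [mapT, mapP, ten, MedBimonData.mapT, MedBimonData.mapP, MedBimonData.ten,
      SymMon.hom_comp, F.FP.map_comp, Category.assoc]
    rw [← reassoc_of% F.vRP_natural, F.vRP_flip_oplaxT]
  hom_e := by
    simp only [mapT, mapP, ten, MedBimonData.mapT, MedBimonData.mapP, MedBimonData.ten,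
      SymMon.hom_comp, F.FP.map_comp, Category.assoc]
    rw [← reassoc_of% F.vRP_natural, F.vRP_unit_oplaxT]
  nab_hom := by
    simp only [mapT, mapP, ten, MedBimonData.mapT, MedBimonData.mapP, MedBimonData.ten,
      SymMon.hom_comp, F.FP.map_comp, Category.assoc]
    rw [F.vRP_natural, reassoc_of% F.vRP_med]
  u_hom := by
    simp only [mapT, mapP, ten, MedBimonData.mapT, MedBimonData.mapP, MedBimonData.ten,
      SymMon.hom_comp, F.FP.map_comp, Category.assoc]
    rw [F.vRP_natural, F.vRP_Δbot]
    simp only [Category.assoc]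
    rw [reassoc_of% F.strP.unitMap_unitInv]

/-- The left linear strength of the par component. -/
def strengthLP (A B : MedBimon C) : ten (mapP F A) (mapT F B) ⟶ mapP F (ten A B) :=
  Hom.copy ((tenBraid (mapP F A) (mapT F B)).hom ≫ strengthRP F B A ≫ mapPHom F (tenBraid B A).hom)
    (F.vLP A.X B.X) (F.vLP_eq A.X B.X)

/-- The cartesian linear functor on medial bimonoids induced by a medial linear functor. -/
def linFunctor : LinFunctor (MedBimon C) (MedBimon D) where
  FT := functorT F
  FP := functorP F
  strT :=
    { unitMap := (mapTTop F).hom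
      prodMap := fun A B => (mapTTen F A B).hom
      natural := fun f g => Hom.ext (F.strT.natural (Hom.hom f) (Hom.hom g))
      assoc := fun A B X => Hom.ext (F.strT.assoc A.X B.X X.X)
      unit_left := fun A => Hom.ext (F.strT.unit_left A.X)
      unit_right := fun A => Hom.ext (F.strT.unit_right A.X)
      braided := fun A B => Hom.ext (F.strT.braided A.X B.X)
      unitInv := (mapTTop F).inv
      prodInv := fun A B => (mapTTen F A B).inv
      unitMap_unitInv := (mapTTop F).hom_inv_id
      unitInv_unitMap := (mapTTop F).inv_hom_id
      prodMap_prodInv := fun A B => (mapTTen F A B).hom_inv_id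
      prodInv_prodMap := fun A B => (mapTTen F A B).inv_hom_id }
  strP :=
    { unitMap := (mapPBot F).hom
      prodMap := fun A B => (mapPPar F A B).hom
      natural := fun f g => Hom.ext (F.strP.natural (Hom.hom f) (Hom.hom g))
      assoc := fun A B X => Hom.ext (F.strP.assoc A.X B.X X.X)
      unit_left := fun A => Hom.ext (F.strP.unit_left A.X)
      unit_right := fun A => Hom.ext (F.strP.unit_right A.X)
      braided := fun A B => Hom.ext (F.strP.braided A.X B.X)
      unitInv := (mapPBot F).inv
      prodInv := fun A B => (mapPPar F A B).inv
      unitMap_unitInv := (mapPBot F).hom_inv_id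
      unitInv_unitMap := (mapPBot F).inv_hom_id
      prodMap_prodInv := fun A B => (mapPPar F A B).hom_inv_id
      prodInv_prodMap := fun A B => (mapPPar F A B).inv_hom_id }
  vRT := strengthRT F
  vLT := strengthLT F
  vRP := strengthRP F
  vLP := strengthLP F
  vRT_natural f g := Hom.ext (F.vRT_natural (Hom.hom f) (Hom.hom g))
  vLT_natural f g := Hom.ext (F.vLT_natural (Hom.hom f) (Hom.hom g))
  vRP_natural f g := Hom.ext (F.vRP_natural (Hom.hom f) (Hom.hom g))
  vLP_natural f g := Hom.ext (F.vLP_natural (Hom.hom f) (Hom.hom g))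
  vRT_unit A := Hom.ext (F.vRT_unit A.X)
  vLT_unit A := Hom.ext (F.vLT_unit A.X)
  vRP_unit A := Hom.ext (F.vRP_unit A.X)
  vLP_unit A := Hom.ext (F.vLP_unit A.X)
  vRT_assoc A B X := Hom.ext (F.vRT_assoc A.X B.X X.X)
  vLT_assoc A B X := Hom.ext (F.vLT_assoc A.X B.X X.X)
  vRP_assoc A B X := Hom.ext (F.vRP_assoc A.X B.X X.X)
  vLP_assoc A B X := Hom.ext (F.vLP_assoc A.X B.X X.X)
  vRT_dist A B X := Hom.ext (F.vRT_dist A.X B.X X.X)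
  vLT_dist A B X := Hom.ext (F.vLT_dist A.X B.X X.X)
  vRP_dist A B X := Hom.ext (F.vRP_dist A.X B.X X.X)
  vLP_dist A B X := Hom.ext (F.vLP_dist A.X B.X X.X)
  vRT_vLT A B X := Hom.ext (F.vRT_vLT A.X B.X X.X)
  vLP_vRP A B X := Hom.ext (F.vLP_vRP A.X B.X X.X)
  vRT_vRP A B X := Hom.ext (F.vRT_vRP A.X B.X X.X)
  vLT_vLP A B X := Hom.ext (F.vLT_vLP A.X B.X X.X)
  vRP_vRT A B X := Hom.ext (F.vRP_vRT A.X B.X X.X)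
  vLP_vLT A B X := Hom.ext (F.vLP_vLT A.X B.X X.X)
  vT_braid A B := Hom.ext (F.vT_braid A.X B.X)
  vP_braid A B := Hom.ext (F.vP_braid A.X B.X)

theorem isBimonFunctor_linFunctor : IsBimonFunctor F (linFunctor F) where
  objT _ := rfl
  objP _ := rfl
  mapT _ := .intro
  mapP _ := .intro
  unitT := .intro
  prodT _ _ := .intro
  unitP := .intro
  prodP _ _ := .intro
  vRT _ _ := .intro
  vLT _ _ := .intro
  vRP _ _ := .intro
  vLP _ _ := .intro

variable {F} {G : MedialFunctor C D}

/-- The tensor component of a medial linear transformation at a medial bimonoid. -/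
def transT (α : MedialTrans F G) (A : MedBimon C) : mapT F A ⟶ mapT G A where
  hom := α.τT.app A.X
  hom_Δ := by
    simp only [mapT, MedBimonData.mapT, Category.assoc]
    rw [← α.τT.naturality_assoc, α.prodInv_τT]
  hom_e := by
    simp only [mapT, MedBimonData.mapT]
    rw [← α.τT.naturality_assoc, α.unitInv_τT]
  nab_hom := by
    simp only [mapT, MedBimonData.mapT, Category.assoc]
    rw [α.τT.naturality, reassoc_of% α.τT_prodP]
  u_hom := by
    simp only [mapT, MedBimonData.mapT, Category.assoc]
    rw [α.τT.naturality, reassoc_of% α.τT_unitP]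

/-- The par component of a medial linear transformation at a medial bimonoid. -/
def transP (α : MedialTrans F G) (A : MedBimon C) : mapP G A ⟶ mapP F A where
  hom := α.τP.app A.X
  hom_Δ := by
    simp only [mapP, MedBimonData.mapP, Category.assoc]
    rw [← α.τP.naturality_assoc, α.τP_prodT]
  hom_e := by
    simp only [mapP, MedBimonData.mapP]
    rw [← α.τP.naturality_assoc, α.τP_unitT]
  nab_hom := by
    simp only [mapP, MedBimonData.mapP, Category.assoc]
    rw [α.τP.naturality, reassoc_of% α.prodMap_τP]
  u_hom := by
    simp only [mapP, MedBimonData.mapP, Category.assoc]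
    rw [α.τP.naturality, reassoc_of% α.unitMap_τP]

/-- The linear transformation on medial bimonoids induced by a medial linear transformation. -/
def linTrans (α : MedialTrans F G) : LinTrans (linFunctor F) (linFunctor G) where
  τT :=
    { app := transT α
      naturality := fun _ _ f => Hom.ext (α.τT.naturality (Hom.hom f)) }
  τP :=
    { app := transP α
      naturality := fun _ _ f => Hom.ext (α.τP.naturality (Hom.hom f)) }
  τT_unit := Hom.ext α.τT_unit
  τT_prod A B := Hom.ext (α.τT_prod A.X B.X)
  τP_unit := Hom.ext α.τP_unit
  τP_prod A B := Hom.ext (α.τP_prod A.X B.X)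
  τ_vRT A B := Hom.ext (α.τ_vRT A.X B.X)
  τ_vLT A B := Hom.ext (α.τ_vLT A.X B.X)
  τ_vLP A B := Hom.ext (α.τ_vLP A.X B.X)
  τ_vRP A B := Hom.ext (α.τ_vRP A.X B.X)

theorem isBimonTrans_linTrans (α : MedialTrans F G) : IsBimonTrans α (linTrans α) where
  appT _ := .intro
  appP _ := .intro

end MedBimon

end BimonoidFunctors

/-! ### Uniqueness over the base and strict 2-functoriality. -/

section BimonoidTwoFunctor

open SymMon

variable {C : Type u₁} [Category.{v₁} C] {D : Type u₂} [Category.{v₂} D] {E : Type u₃}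
  [Category.{v₃} E]

/-- Inverses are unique. `IsBimonFunctor` prescribes the par constraints in the comonoidal
direction, so equality has to be detected there. -/
theorem SymMon.Strong.ext_inv {M : SymMon C} {N : SymMon D} {F : C ⥤ D} {h k : M.Strong N F}
    (h₁ : h.unitInv = k.unitInv) (h₂ : ∀ A B, h.prodInv A B = k.prodInv A B) : h = k := by
  have h₃ : h.unitIso.symm = k.unitIso.symm := Iso.ext h₁
  have h₄ : ∀ A B, (h.prodIso A B).symm = (k.prodIso A B).symm := fun A B => Iso.ext (h₂ A B)
  exact Strong.ext' (congrArg Iso.inv h₃) fun A B => congrArg Iso.inv (h₄ A B)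

variable [SMLDC C] [SMLDC D] [SMLDC E]

theorem MedBimon.ext_data {A B : MedBimon C} (h : A.toMedBimonData = B.toMedBimonData) : A = B := by
  cases A
  cases B
  obtain rfl := h
  rfl

namespace LiesOver

variable {A B A' B' : MedBimon C}

theorem hom_heq {f : A ⟶ B} {X Y : C} {g : X ⟶ Y} (h : LiesOver f g) :
    HEq (MedBimon.Hom.hom f) g := by
  cases h
  rfl

theorem unique {f f' : A ⟶ B} {X Y : C} {g : X ⟶ Y} (h : LiesOver f g) (h' : LiesOver f' g) :
    f = f' :=
  MedBimon.Hom.ext (eq_of_heq (h.hom_heq.trans h'.hom_heq.symm))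

/-- Once sources and targets are identified, lying over the same map forces equality. The
heterogeneous form is needed because two functors are compared before their object maps are known to
agree definitionally. -/
theorem heq {f : A ⟶ B} {f' : A' ⟶ B'} {X Y : C} {g : X ⟶ Y} (h : LiesOver f g)
    (h' : LiesOver f' g) (hA : A = A') (hB : B = B') : HEq f f' := by
  subst hA
  subst hB
  exact heq_of_eq (h.unique h')

end LiesOver

/-- Objects agree because the bimonoid axioms are propositions, morphisms because they lie over the
same maps. All strictness statements on 1-cells reduce to this. -/
theorem IsBimonFunctor.unique {F : MedialFunctor C D}
    {G G' : LinFunctor (MedBimon C) (MedBimon D)} (h : IsBimonFunctor F G)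
    (h' : IsBimonFunctor F G') : G = G' := by
  have eT : ∀ A, G.FT.obj A = G'.FT.obj A := fun A =>
    MedBimon.ext_data ((h.objT A).trans (h'.objT A).symm)
  have eP : ∀ A, G.FP.obj A = G'.FP.obj A := fun A =>
    MedBimon.ext_data ((h.objP A).trans (h'.objP A).symm)
  have hT : G.FT = G'.FT := Functor.hext eT fun A B f =>
    (h.mapT f).heq (h'.mapT f) (eT A) (eT B)
  have hP : G.FP = G'.FP := Functor.hext eP fun A B f =>
    (h.mapP f).heq (h'.mapP f) (eP A) (eP B)
  clear eT eP
  cases G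
  cases G'
  obtain rfl := hT
  obtain rfl := hP
  -- With both functors identified, the remaining data have equal types and are compared
  -- componentwise over the base.
  obtain rfl := Strong.ext' (h.unitT.unique h'.unitT) fun A B => (h.prodT A B).unique (h'.prodT A B)
  obtain rfl := Strong.ext_inv (h.unitP.unique h'.unitP)
    fun A B => (h.prodP A B).unique (h'.prodP A B)
  obtain rfl := funext fun A => funext fun B => (h.vRT A B).unique (h'.vRT A B)
  obtain rfl := funext fun A => funext fun B => (h.vLT A B).unique (h'.vLT A B)
  obtain rfl := funext fun A => funext fun B => (h.vRP A B).unique (h'.vRP A B)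
  obtain rfl := funext fun A => funext fun B => (h.vLP A B).unique (h'.vLP A B)
  rfl

theorem IsBimonTrans.unique {F F' : MedialFunctor C D}
    {G G' : LinFunctor (MedBimon C) (MedBimon D)} {α : MedialTrans F F'} {β β' : LinTrans G G'}
    (h : IsBimonTrans α β) (h' : IsBimonTrans α β') : β = β' :=
  LinTrans.ext (NatTrans.ext (funext fun A => (h.appT A).unique (h'.appT A)))
    (NatTrans.ext (funext fun A => (h.appP A).unique (h'.appP A)))

/-- After substitution the transports along equalities are identities. The whiskering laws of the
strict 2-functor are stated with such transports, and this removes them. -/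
theorem IsBimonTrans.eqToHom_comp {F F' : MedialFunctor C D}
    {G G' H H' : LinFunctor (MedBimon C) (MedBimon D)} {α : MedialTrans F F'} {β : G ⟶ G'}
    (h : IsBimonTrans α β) (e : H = G) (e' : G' = H') :
    IsBimonTrans α (eqToHom e ≫ β ≫ eqToHom e') := by
  subst e
  subst e'
  simpa only [eqToHom_refl, Category.comp_id, Category.id_comp] using h

namespace MedBimon

variable (C) in
theorem isBimonFunctor_id : IsBimonFunctor (MedialFunctor.id C) (LinFunctor.id (MedBimon C)) where
  objT A := by
    simp [MedBimonData.mapT, MedialFunctor.id, LinFunctor.id, Strong.id, Lax.id]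
  objP A := by
    simp [MedBimonData.mapP, MedialFunctor.id, LinFunctor.id, Strong.id, Lax.id, Oplax.id]
  mapT _ := .intro
  mapP _ := .intro
  unitT := .intro
  prodT _ _ := .intro
  unitP := .intro
  prodP _ _ := .intro
  vRT _ _ := .intro
  vLT _ _ := .intro
  vRP _ _ := .intro
  vLP _ _ := .intro

/-- Only the bimonoid structures on objects need an argument, by functoriality and reassociation;
every structure map of the composite lies over the right one by definition. -/
theorem isBimonFunctor_comp (F : MedialFunctor C D) (G : MedialFunctor D E) :
    IsBimonFunctor (F.comp G) ((linFunctor F).comp (linFunctor G)) where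
  objT A := by
    change (A.toMedBimonData.mapT F).mapT G = _
    simp [MedBimonData.mapT, MedialFunctor.comp, LinFunctor.comp, Strong.comp, Lax.comp]
  objP A := by
    change (A.toMedBimonData.mapP F).mapP G = _
    simp [MedBimonData.mapP, MedialFunctor.comp, LinFunctor.comp, Strong.comp, Lax.comp,
      Oplax.comp]
  mapT _ := .intro
  mapP _ := .intro
  unitT := .intro
  prodT _ _ := .intro
  unitP := .intro
  prodP _ _ := .intro
  vRT _ _ := .intro
  vLT _ _ := .intro
  vRP _ _ := .intro
  vLP _ _ := .intro

variable (C) in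
theorem linFunctor_id : linFunctor (MedialFunctor.id C) = LinFunctor.id (MedBimon C) :=
  (isBimonFunctor_linFunctor _).unique (isBimonFunctor_id C)

theorem linFunctor_comp (F : MedialFunctor C D) (G : MedialFunctor D E) :
    linFunctor (F.comp G) = (linFunctor F).comp (linFunctor G) :=
  (isBimonFunctor_linFunctor _).unique (isBimonFunctor_comp F G)

theorem linTrans_whiskerLeft (F : MedialFunctor C D) {G G' : MedialFunctor D E}
    (α : MedialTrans G G') : (show linFunctor _ ⟶ linFunctor _ from
      linTrans (MedialTrans.whiskerLeft F α)) =
      eqToHom (linFunctor_comp F G) ≫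
        (show LinFunctor.comp _ _ ⟶ LinFunctor.comp _ _ from
          LinTrans.whiskerLeft (linFunctor F) (linTrans α)) ≫
          eqToHom (linFunctor_comp F G').symm :=
  (isBimonTrans_linTrans _).unique
    (IsBimonTrans.eqToHom_comp { appT := fun _ => .intro, appP := fun _ => .intro } _ _)

theorem linTrans_whiskerRight {F F' : MedialFunctor C D} (α : MedialTrans F F')
    (G : MedialFunctor D E) : (show linFunctor _ ⟶ linFunctor _ from
      linTrans (MedialTrans.whiskerRight α G)) =
      eqToHom (linFunctor_comp F G) ≫
        (show LinFunctor.comp _ _ ⟶ LinFunctor.comp _ _ from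
          LinTrans.whiskerRight (linTrans α) (linFunctor G)) ≫
          eqToHom (linFunctor_comp F' G).symm :=
  (isBimonTrans_linTrans _).unique
    (IsBimonTrans.eqToHom_comp { appT := fun _ => .intro, appP := fun _ => .intro } _ _)

/-- The 2-functor sending a symmetric medial linearly distributive category to its cartesian
linearly distributive category of bicommutative medial bimonoids. -/
def twoFunctor : StrictPseudofunctor SMLDCat.{v, u} CLDCat.{v, max u v} :=
  StrictPseudofunctor.mk''
    { obj := fun X => X.bimon inferInstance
      map := fun F => linFunctor F
      map₂ := fun α => linTrans α
      map₂_id := fun _ => rfl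
      map₂_comp := fun _ _ => rfl
      map_id := fun X => linFunctor_id X.carrier
      map_comp := fun F G => linFunctor_comp F G
      map₂_whisker_left := fun F _ _ α => linTrans_whiskerLeft F α
      map₂_whisker_right := fun α G => linTrans_whiskerRight α G }

end MedBimon

end BimonoidTwoFunctor

theorem mainTheorem6 :
    ∃ (S : ∀ X : SMLDCat.{v, u}, CLDC (MedBimon X.carrier))
      (map : ∀ {X Y : SMLDCat.{v, u}}, (X ⟶ Y) → (X.bimon (S X) ⟶ Y.bimon (S Y)))
      (map₂ : ∀ {X Y : SMLDCat.{v, u}} {F G : X ⟶ Y}, (F ⟶ G) → (map F ⟶ map G))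
      (B : StrictPseudofunctor SMLDCat.{v, u} CLDCat.{v, max u v}),
      B.toPrelaxFunctorStruct =
        { obj := fun X => X.bimon (S X), map := map, map₂ := map₂ } ∧
      (∀ X : SMLDCat.{v, u}, @IsBimonSLDC X.carrier _ _ (S X).toSLDC) ∧
      (∀ {X Y : SMLDCat.{v, u}} (F : X ⟶ Y),
        @IsBimonFunctor X.carrier _ _ Y.carrier _ _ (S X).toSLDC (S Y).toSLDC F (map F)) ∧
      (∀ {X Y : SMLDCat.{v, u}} {F G : X ⟶ Y} (α : F ⟶ G),
        @IsBimonTrans X.carrier _ _ Y.carrier _ _ (S X).toSLDC (S Y).toSLDC F G (map F) (map G)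
          α (map₂ α)) := by
  exact ⟨fun _ => inferInstance, fun F => MedBimon.linFunctor F, fun α => MedBimon.linTrans α,
    MedBimon.twoFunctor, rfl, fun X => isBimonSLDC X.carrier,
    fun F => MedBimon.isBimonFunctor_linFunctor F, fun α => MedBimon.isBimonTrans_linTrans α⟩
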